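/- Let $k$ be a field of characteristic $3$. Parities of homogeneous elements are written $|x|\in\mathbb Z/2$. **Symmetric composition superalgebras.** A symmetric composition superalgebra $(S,\bullet,q)$ is a superalgebra $S=S_{\bar 0}\oplus S_{\bar 1}$ with a quadratic form $q_{\bar 0}$ on $S_{\bar 0}$ and a nondegenerate even supersymmetric bilinear form $b$ on $S$ extending the polar form of $q_{\bar 0}$, permitting composition (that is, $q_{\bar 0}(x\bullet y)=q_{\bar 0}(x)q_{\bar 0}(y)$ for $x,y\in S_{\bar 0}$; $b(x\bullet y,x\bullet z)=q_{\bar 0}(x)b(y,z)=b(y\bullet x,z\bullet x)$ for $x\in S_{\bar 0}$, $y,z\in S$; and $b(x\bullet y,z\bullet t)+(-1)^{|x||y|+|x||z|+|y||z|}b(z\bullet y,x\bullet t)=(-1)^{|y||z|}b(x,z)b(y,t)$ for homogeneous elements), with $b(x\bullet y,z)=b(x,y\bullet z)$. Two examples are used. * $S_1=k1$ (purely even), with $1\bullet 1=1$, $q(1)=1$, $b(1,1)=2$. * $S_{4,2}$: let $V$ be a two-dimensional space with a nonzero alternating form $\langle\cdot|\cdot\rangle$, and let $f\mapsto\bar f$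 be the symplectic involution of $\operatorname{End}(V)$, $\langle f(u)|v\rangle=\langle u|\bar f(v)\rangle$. The Hurwitz superalgebra $B(4,2)=\operatorname{End}(V)\oplus V$ has even part $\operatorname{End}(V)$, odd part $V$, composition as product on $\operatorname{End}(V)$, $v\cdot f=f(v)=\bar f\cdot v$ and $u\cdot v=\langle\cdot|u\rangle v$, with $q_{\bar 0}=\det$ and $b(u,v)=\langle u|v\rangle$. With $\bar x=b(x,1)1-x$, $S_{4,2}$ is the same superspace with the same $q_{\bar 0}$ and $b$ and with the product $x\bullet y=\bar x\cdot\bar y$. **The superalgebra $\mathfrak g(S,S')$.** For a symmetric composition superalgebra $S$, the triality Lie superalgebra $\mathfrak{tri}(S)$, with componentwise bracket, has parity-$i$ component the set of all $(d_0,d_1,d_2)\in\mathfrak{osp}(S,b)_i^3$ with $d_0(x\bullet y)=d_1(x)\bullet y+(-1)^{i|x|}x\bullet d_2(y)$. Let $\theta(d_0,d_1,d_2)=(d_2,d_0,d_1)$, let $\sigma_{x,y}(z)=(-1)^{|y||z|}b(x,z)y-(-1)^{|x|(|y|+|z|)}b(y,z)x$, $l_x(y)=x\bullet y$, $r_x(y)=(-1)^{|x||y|}y\bullet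 x$, and $$t_{x,y}=\bigl(\sigma_{x,y},\ \tfrac12 b(x,y)1-r_xl_y,\ \tfrac12 b(x,y)1-l_xr_y\bigr)\in\mathfrak{tri}(S).$$ Then $\mathfrak g(S,S')=\mathfrak{tri}(S)\oplus\mathfrak{tri}(S')\oplus\bigoplus_{i=0}^2\iota_i(S\otimes S')$, where $\iota_i(S\otimes S')$ is a copy of $S\otimes S'$, indices are modulo $3$, $\mathfrak{tri}(S)\oplus\mathfrak{tri}(S')$ is a subalgebra (direct sum), and the super-anticommutative bracket is given on homogeneous elements by $$[(d_0,d_1,d_2),\iota_i(x\otimes x')]=\iota_i(d_i(x)\otimes x'),\qquad [(d'_0,d'_1,d'_2),\iota_i(x\otimes x')]=(-1)^{|d'_i||x|}\iota_i(x\otimes d'_i(x')),$$ $$[\iota_i(x\otimes x'),\iota_{i+1}(y\otimes y')]=(-1)^{|x'||y|}\iota_{i+2}((x\bullet y)\otimes(x'\bullet y')),$$ $$[\iota_i(x\otimes x'),\iota_i(y\otimes y')]=(-1)^{|x||x'|+|x||y'|+|y||y'|}b'(x',y')\,\theta^i(t_{x,y})+(-1)^{|y||x'|}b(x,y)\,\theta'^i(t'_{x',y'}).$$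 **Contragredient Lie superalgebras.** Lie superalgebras in characteristic $3$ are required to satisfy $[x,[x,x]]=0$ for odd $x$. A realization of an $n\times n$ matrix $A=(a_{ij})$ is a vector space $\mathfrak h$ of dimension $2n-\operatorname{rank}A$ with linearly independent families $\alpha_1,\dots,\alpha_n\in\mathfrak h^*$ and $h_1,\dots,h_n\in\mathfrak h$ such that $\alpha_j(h_i)=a_{ij}$. For $\tau\subseteq\{1,\dots,n\}$ let $\tilde{\mathfrak g}(A,\tau)$ be the Lie superalgebra generated by the vector space $\mathfrak h$ (even) and elements $e_i,f_i$ (odd if $i\in\tau$, even otherwise), subject to $$[e_i,f_j]=\delta_{ij}h_i,\quad[h,h']=0,\quad[h,e_i]=\alpha_i(h)e_i,\quad[h,f_i]=-\alpha_i(h)f_i ,$$ and $\mathbb Z$-graded with $\mathfrak h$, $e_i$, $f_i$ in degrees $0,1,-1$. Then $\mathfrak g(A,\tau)=\tilde{\mathfrak g}(A,\tau)/\mathfrak i(A)$, where $\mathfrak i(A)$ is the largest homogeneous ideal that intersects $\mathfrak h$ trivially. **The module $V(\omega_3)$.** Let $W$ be the natural $6$-dimensional module of $\mathfrak{sp}_6=\mathfrak{sp}_6(k)$,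 with invariant alternating form $\{\cdot|\cdot\}$ and symplectic basis $a_1,a_2,a_3,b_1,b_2,b_3$ ($\{a_i|b_j\}=\delta_{ij}$, $\{a_i|a_j\}=0=\{b_i|b_j\}$), and let $\mathfrak{sp}_6$ act on $\bigwedge^3W$ by derivations. Let $$\varphi:\textstyle\bigwedge^3W\to W,\qquad z_1\wedge z_2\wedge z_3\mapsto\{z_1|z_2\}z_3+\{z_2|z_3\}z_1+\{z_3|z_1\}z_2 .$$ Let $\mathfrak t\subset\mathfrak{sp}_6$ be the Cartan subalgebra of the elements that are diagonal in the symplectic basis, $\delta_i\in\mathfrak t^*$ the weight of $b_i$, $\omega_3=\delta_1+\delta_2+\delta_3$, and $\mathfrak n^+$ the sum of the root spaces for the roots $\delta_i-\delta_j$ ($i<j$) and $\delta_i+\delta_j$ ($i\le j$) (more precisely, the span of the corresponding standard root vectors). **Theorem.** The superalgebra $\mathfrak g(S_1,S_{4,2})$ over $k$ is a Lie superalgebra, and: 1. For the matrix $$A=A_{S_1,S_{4,2}}=\begin{pmatrix}2&-1&0\\1&2&1\\0&1&0\end{pmatrix}$$ over $k$ a realization exists, and for every realization of $A$, $\mathfrak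 g(S_1,S_{4,2})$ is isomorphic, as a superalgebra, to the contragredient Lie superalgebra $\mathfrak g(A,\{2,3\})$. 2. $\mathfrak g(S_1,S_{4,2})$ is simple (its bracket is not zero and it has no graded ideals besides $0$ and itself). 3. $\ker\varphi$ is an irreducible $\mathfrak{sp}_6$-module of dimension $14$, and $b_1\wedge b_2\wedge b_3\in\ker\varphi$ is a nonzero vector annihilated by $\mathfrak n^+$, of weight $\omega_3$; that is, $\ker\varphi=V(\omega_3)$. 4. There are an isomorphism of Lie algebras $\mathfrak g(S_1,S_{4,2})_{\bar 0}\cong\mathfrak{sp}_6$ and a linear bijection $\mathfrak g(S_1,S_{4,2})_{\bar 1}\cong\ker\varphi$ which together identify the adjoint action of the even part on the odd part with the action of $\mathfrak{sp}_6$ on $\ker\varphi$. -/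

import Mathlib

/-- The sign `(-1)^i` for a parity `i`. -/
def sg (k : Type*) [Field k] (i : ZMod 2) : k := if i = 0 then 1 else -1

/-- A `ZMod 2`-grading `A = A₀ ⊕ A₁` of a vector space, that is, the structure of a superspace. -/
structure SuperGrading (k A : Type*) [Field k] [AddCommGroup A] [Module k A] where
  gr : ZMod 2 → Submodule k A
  isCompl : IsCompl (gr 0) (gr 1)

/-- A superalgebra: a superspace with an even bilinear multiplication
(no further identity is assumed). -/
structure Superalgebra (k A : Type*) [Field k] [AddCommGroup A] [Module k A] extends
    SuperGrading k A where
  mul : A →ₗ[k] A →ₗ[k] A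
  mul_mem : ∀ {i j : ZMod 2} {x y : A}, x ∈ gr i → y ∈ gr j → mul x y ∈ gr (i + j)

section Signs

variable (k : Type*) [Field k]

@[simp] theorem sg_zero : sg k 0 = 1 := by simp [sg]

@[simp] theorem sg_one : sg k 1 = -1 := by simp [sg]

theorem zmod2_cases (i : ZMod 2) : i = 0 ∨ i = 1 := by revert i; decide

theorem zmod2_one_add_one : (1 + 1 : ZMod 2) = 0 := by decide

theorem zmod2_sum {M : Type*} [AddCommMonoid M] (f : ZMod 2 → M) :
    ∑ i, f i = f 0 + f 1 := Fin.sum_univ_two f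

end Signs

namespace SuperGrading

variable {k A B C : Type*} [Field k] [AddCommGroup A] [Module k A] [AddCommGroup B] [Module k B]
  [AddCommGroup C] [Module k C]

/-- The projection onto the homogeneous component of parity `i`. -/
noncomputable def proj (G : SuperGrading k A) (i : ZMod 2) : A →ₗ[k] A :=
  if i = 0 then (G.gr 0).projection (G.gr 1) G.isCompl
  else (G.gr 1).projection (G.gr 0) G.isCompl.symm

theorem proj_mem (G : SuperGrading k A) (i : ZMod 2) (x : A) : G.proj i x ∈ G.gr i := by
  rcases zmod2_cases i with rfl | rfl
  · simp only [proj, if_true]; exact Submodule.projection_apply_mem _ _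
  · simp only [proj, one_ne_zero, if_false]; exact Submodule.projection_apply_mem _ _

theorem proj_add (G : SuperGrading k A) (x : A) : G.proj 0 x + G.proj 1 x = x := by
  simp only [proj, one_ne_zero, if_false, if_true]
  exact Submodule.projection_add_projection_eq_self _ _

theorem proj_of_mem (G : SuperGrading k A) {i : ZMod 2} {x : A} (hx : x ∈ G.gr i) (j : ZMod 2) :
    G.proj j x = if j = i then x else 0 := by
  rcases zmod2_cases i with rfl | rfl <;> rcases zmod2_cases j with rfl | rfl <;>
    simp only [proj, one_ne_zero, zero_ne_one, if_false, if_true]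
  · exact Submodule.projection_apply_left _ ⟨x, hx⟩
  · exact Submodule.projection_apply_right _ ⟨x, hx⟩
  · exact Submodule.projection_apply_right _ ⟨x, hx⟩
  · exact Submodule.projection_apply_left _ ⟨x, hx⟩

theorem eq_zero_of_mem (G : SuperGrading k A) {x : A} (h0 : x ∈ G.gr 0) (h1 : x ∈ G.gr 1) :
    x = 0 := Submodule.disjoint_def.mp G.isCompl.disjoint x h0 h1

/-- To check that two linear maps agree, it suffices to check homogeneous elements. -/
theorem ext_hom (G : SuperGrading k A) {f g : A →ₗ[k] B}
    (h : ∀ i, ∀ x ∈ G.gr i, f x = g x) : f = g := by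
  ext x
  rw [← G.proj_add x, map_add, map_add, h 0 _ (G.proj_mem 0 x), h 1 _ (G.proj_mem 1 x)]

theorem isCompl_of {p q : Submodule k A} (hs : ∀ x, ∃ y ∈ p, ∃ z ∈ q, y + z = x)
    (hd : ∀ x, x ∈ p → x ∈ q → x = 0) : IsCompl p q := by
  refine ⟨Submodule.disjoint_def.mpr hd, ?_⟩
  rw [codisjoint_iff, eq_top_iff]
  intro x _
  obtain ⟨y, hy, z, hz, rfl⟩ := hs x
  exact Submodule.add_mem_sup hy hz

/-- A bilinear map `β` between superspaces modified by coefficients `s`: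
`twist G H s β x y = s |x| |y| • β x y` for homogeneous `x`, `y`. -/
noncomputable def twist (G : SuperGrading k A) (H : SuperGrading k B) (s : ZMod 2 → ZMod 2 → k)
    (β : A →ₗ[k] B →ₗ[k] C) : A →ₗ[k] B →ₗ[k] C :=
  ∑ i, ∑ j, s i j • β.compl₁₂ (G.proj i) (H.proj j)

theorem twist_apply (G : SuperGrading k A) (H : SuperGrading k B) (s : ZMod 2 → ZMod 2 → k)
    (β : A →ₗ[k] B →ₗ[k] C) {i j : ZMod 2} {x : A} {y : B} (hx : x ∈ G.gr i) (hy : y ∈ H.gr j) :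
    twist G H s β x y = s i j • β x y := by
  simp only [twist, zmod2_sum, LinearMap.add_apply, LinearMap.smul_apply, LinearMap.compl₁₂_apply,
    G.proj_of_mem hx, H.proj_of_mem hy]
  rcases zmod2_cases i with rfl | rfl <;> rcases zmod2_cases j with rfl | rfl <;> simp

/-- The signed flip of a bilinear map: `sflip β y x = (-1)^(|x||y|) β x y`. -/
noncomputable def sflip (G : SuperGrading k A) (H : SuperGrading k B) (β : A →ₗ[k] B →ₗ[k] C) :
    B →ₗ[k] A →ₗ[k] C :=
  (twist G H (fun i j => sg k (i * j)) β).flip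

theorem sflip_apply (G : SuperGrading k A) (H : SuperGrading k B) (β : A →ₗ[k] B →ₗ[k] C)
    {i j : ZMod 2} {x : A} {y : B} (hx : x ∈ G.gr i) (hy : y ∈ H.gr j) :
    sflip G H β y x = sg k (i * j) • β x y := by
  rw [sflip, LinearMap.flip_apply, twist_apply G H _ β hx hy]

/-- A bilinear map of superspaces is even if it is compatible with the gradings. -/
def IsEven (G : SuperGrading k A) (H : SuperGrading k B) (K : SuperGrading k C)
    (β : A →ₗ[k] B →ₗ[k] C) : Prop :=
  ∀ {i j : ZMod 2} {x : A} {y : B}, x ∈ G.gr i → y ∈ H.gr j → β x y ∈ K.gr (i + j)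

theorem IsEven.sflip {G : SuperGrading k A} {H : SuperGrading k B} {K : SuperGrading k C}
    {β : A →ₗ[k] B →ₗ[k] C} (h : IsEven G H K β) : IsEven H G K (SuperGrading.sflip G H β) := by
  intro i j x y hx hy
  rw [sflip_apply G H β hy hx, add_comm]
  exact Submodule.smul_mem _ _ (h hy hx)

/-- The grading of the direct product of two superspaces. -/
def prod (G : SuperGrading k A) (H : SuperGrading k B) : SuperGrading k (A × B) where
  gr i := (G.gr i).prod (H.gr i)
  isCompl := by
    refine isCompl_of (fun x => ?_) (fun x h0 h1 => ?_)
    · exact ⟨(G.proj 0 x.1, H.proj 0 x.2), ⟨G.proj_mem _ _, H.proj_mem _ _⟩,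
        (G.proj 1 x.1, H.proj 1 x.2), ⟨G.proj_mem _ _, H.proj_mem _ _⟩,
        Prod.ext (G.proj_add _) (H.proj_add _)⟩
    · exact Prod.ext (G.eq_zero_of_mem h0.1 h1.1) (H.eq_zero_of_mem h0.2 h1.2)

/-- The grading of a finite power of a superspace. -/
def pi (G : SuperGrading k A) (n : ℕ) : SuperGrading k (Fin n → A) where
  gr i := Submodule.pi Set.univ fun _ => G.gr i
  isCompl := by
    refine isCompl_of (fun x => ?_)
      (fun x h0 h1 => ?_)
    · exact ⟨fun m => G.proj 0 (x m), fun m _ => G.proj_mem _ _,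
        fun m => G.proj 1 (x m), fun m _ => G.proj_mem _ _, funext fun m => G.proj_add _⟩
    · exact funext fun m => G.eq_zero_of_mem (h0 m trivial) (h1 m trivial)

/-- The grading of the space of endomorphisms of a superspace. -/
def endo (G : SuperGrading k A) : SuperGrading k (Module.End k A) where
  gr i :=
    { carrier := {d | ∀ j, ∀ x ∈ G.gr j, d x ∈ G.gr (i + j)}
      add_mem' := fun ha hb j x hx => (G.gr _).add_mem (ha j x hx) (hb j x hx)
      zero_mem' := fun _ _ _ => (G.gr _).zero_mem
      smul_mem' := fun c _ ha j x hx => (G.gr _).smul_mem c (ha j x hx) }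
  isCompl := by
    apply isCompl_of
    · intro d
      refine ⟨G.proj 0 ∘ₗ d ∘ₗ G.proj 0 + G.proj 1 ∘ₗ d ∘ₗ G.proj 1, ?_,
        G.proj 0 ∘ₗ d ∘ₗ G.proj 1 + G.proj 1 ∘ₗ d ∘ₗ G.proj 0, ?_, ?_⟩
      · intro j x hx
        rcases zmod2_cases j with rfl | rfl <;>
          simp [G.proj_of_mem hx, G.proj_mem]
      · intro j x hx
        rcases zmod2_cases j with rfl | rfl <;>
          simp [G.proj_of_mem hx, G.proj_mem, zmod2_one_add_one]
      · ext x
        have h := G.proj_add x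
        have h0 := G.proj_add (d (G.proj 0 x))
        have h1 := G.proj_add (d (G.proj 1 x))
        conv_rhs => rw [← h, map_add, ← h0, ← h1]
        simp only [LinearMap.add_apply, LinearMap.comp_apply]
        abel
    · intro d h0 h1
      refine G.ext_hom fun j x hx => ?_
      have a := h0 j x hx
      have b := h1 j x hx
      rcases zmod2_cases j with rfl | rfl
      · rw [add_zero] at a b; exact G.eq_zero_of_mem a b
      · rw [zero_add] at a; rw [zmod2_one_add_one] at b; exact G.eq_zero_of_mem b a

open scoped TensorProduct in
/-- The grading of the tensor product of two superspaces: `|x ⊗ y| = |x| + |y|`. -/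
noncomputable def tensor (G : SuperGrading k A) (H : SuperGrading k B) :
    SuperGrading k (A ⊗[k] B) where
  gr i := Submodule.span k
    {t | ∃ a b : ZMod 2, a + b = i ∧ ∃ x ∈ G.gr a, ∃ y ∈ H.gr b, x ⊗ₜ[k] y = t}
  isCompl := by
    apply isCompl_of
    · intro t
      induction t with
      | zero => exact ⟨0, Submodule.zero_mem _, 0, Submodule.zero_mem _, add_zero _⟩
      | add s t hs ht =>
        obtain ⟨a, ha, b, hb, rfl⟩ := hs
        obtain ⟨c, hc, d, hd, rfl⟩ := ht
        exact ⟨a + c, Submodule.add_mem _ ha hc, b + d, Submodule.add_mem _ hb hd, by abel⟩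
      | tmul x y =>
        refine ⟨G.proj 0 x ⊗ₜ H.proj 0 y + G.proj 1 x ⊗ₜ H.proj 1 y, ?_,
          G.proj 0 x ⊗ₜ H.proj 1 y + G.proj 1 x ⊗ₜ H.proj 0 y, ?_, ?_⟩
        · exact Submodule.add_mem _
            (Submodule.subset_span ⟨0, 0, rfl, _, G.proj_mem _ _, _, H.proj_mem _ _, rfl⟩)
            (Submodule.subset_span ⟨1, 1, by decide, _, G.proj_mem _ _, _, H.proj_mem _ _, rfl⟩)
        · exact Submodule.add_mem _
            (Submodule.subset_span ⟨0, 1, rfl, _, G.proj_mem _ _, _, H.proj_mem _ _, rfl⟩)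
            (Submodule.subset_span ⟨1, 0, rfl, _, G.proj_mem _ _, _, H.proj_mem _ _, rfl⟩)
        · conv_rhs => rw [← G.proj_add x, ← H.proj_add y]
          simp only [TensorProduct.add_tmul, TensorProduct.tmul_add]
          abel
    · let T := TensorProduct.map (G.proj 0) (H.proj 0) + TensorProduct.map (G.proj 1) (H.proj 1)
      intro t h0 h1
      have e0 : T t = t := by
        refine Submodule.span_induction (p := fun t _ => T t = t) ?_ (map_zero _)
          (fun x y _ _ hx hy => by rw [map_add, hx, hy])
          (fun c x _ hx => by rw [map_smul, hx]) h0
        rintro _ ⟨a, b, hab, x, hx, y, hy, rfl⟩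
        rcases zmod2_cases a with rfl | rfl <;> rcases zmod2_cases b with rfl | rfl <;>
          first
          | exact absurd hab (by decide)
          | simp [T, G.proj_of_mem hx, H.proj_of_mem hy]
      have e1 : T t = 0 := by
        refine Submodule.span_induction (p := fun t _ => T t = 0) ?_ (map_zero _)
          (fun x y _ _ hx hy => by rw [map_add, hx, hy, add_zero])
          (fun c x _ hx => by rw [map_smul, hx, smul_zero]) h1
        rintro _ ⟨a, b, hab, x, hx, y, hy, rfl⟩
        rcases zmod2_cases a with rfl | rfl <;> rcases zmod2_cases b with rfl | rfl <;>
          first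
          | exact absurd hab (by decide)
          | simp [T, G.proj_of_mem hx, H.proj_of_mem hy]
      rw [← e0, e1]

open scoped TensorProduct in
theorem tmul_mem_tensor (G : SuperGrading k A) (H : SuperGrading k B) {i j : ZMod 2} {x : A}
    {y : B} (hx : x ∈ G.gr i) (hy : y ∈ H.gr j) : x ⊗ₜ[k] y ∈ (G.tensor H).gr (i + j) :=
  Submodule.subset_span ⟨i, j, rfl, x, hx, y, hy, rfl⟩

end SuperGrading

namespace Superalgebra

variable {k A A' : Type*} [Field k] [AddCommGroup A] [Module k A] [AddCommGroup A'] [Module k A']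

/-- A submodule is homogeneous for a family of submodules `g` (the components of a grading)
if it is spanned by its homogeneous elements. -/
def IsHomogeneous {ι : Type*} (g : ι → Submodule k A) (I : Submodule k A) : Prop :=
  I ≤ ⨆ i, I ⊓ g i

/-- A two-sided ideal (not necessarily graded). -/
def IsIdeal (B : Superalgebra k A) (I : Submodule k A) : Prop :=
  ∀ x ∈ I, ∀ y, B.mul x y ∈ I ∧ B.mul y x ∈ I

/-- The axioms of a Lie superalgebra. -/
structure IsLie (B : Superalgebra k A) : Prop where
  skew : ∀ {i j : ZMod 2} {x y : A}, x ∈ B.gr i → y ∈ B.gr j →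
    B.mul x y = -(sg k (i * j) • B.mul y x)
  self_even : ∀ x ∈ B.gr 0, B.mul x x = 0
  jacobi : ∀ {i j : ZMod 2} {x y : A} (z : A), x ∈ B.gr i → y ∈ B.gr j →
    B.mul x (B.mul y z) = B.mul (B.mul x y) z + sg k (i * j) • B.mul y (B.mul x z)
  cube_odd : ∀ x ∈ B.gr 1, B.mul x (B.mul x x) = 0

/-- Simplicity: the product is not zero and there are no nontrivial proper graded ideals. -/
def IsSimple (B : Superalgebra k A) : Prop :=
  (∃ x y, B.mul x y ≠ 0) ∧
    ∀ I : Submodule k A, B.IsIdeal I → IsHomogeneous B.gr I → I = ⊥ ∨ I = ⊤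

/-- Isomorphisms of superalgebras: parity preserving linear bijections that are
multiplicative. -/
structure Iso (B : Superalgebra k A) (B' : Superalgebra k A') where
  toEquiv : A ≃ₗ[k] A'
  map_mem : ∀ i, ∀ x ∈ B.gr i, toEquiv x ∈ B'.gr i
  map_mul : ∀ x y, toEquiv (B.mul x y) = B'.mul (toEquiv x) (toEquiv y)

theorem proj_mem_of_isHomogeneous (G : SuperGrading k A) {I : Submodule k A}
    (hI : IsHomogeneous G.gr I) {x : A} (hx : x ∈ I) (i : ZMod 2) : G.proj i x ∈ I := by
  have h : I ≤ I.comap (G.proj i) := by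
    refine hI.trans (iSup_le fun j y hy => ?_)
    rw [Submodule.mem_comap, G.proj_of_mem hy.2]
    split_ifs
    · exact hy.1
    · exact I.zero_mem
  exact h hx

/-- A graded subspace closed under multiplication is a superalgebra. -/
def sub (B : Superalgebra k A) (T : Submodule k A) (hT : IsHomogeneous B.gr T)
    (hmul : ∀ x ∈ T, ∀ y ∈ T, B.mul x y ∈ T) : Superalgebra k T where
  gr i := (B.gr i).comap T.subtype
  isCompl := by
    apply SuperGrading.isCompl_of
    · intro x
      exact ⟨⟨B.proj 0 x, proj_mem_of_isHomogeneous _ hT x.2 0⟩, B.proj_mem _ _,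
        ⟨B.proj 1 x, proj_mem_of_isHomogeneous _ hT x.2 1⟩, B.proj_mem _ _,
        Subtype.ext (B.proj_add _)⟩
    · intro x h0 h1
      exact Subtype.ext (B.eq_zero_of_mem h0 h1)
  mul := LinearMap.mk₂ k (fun x y => (⟨B.mul x y, hmul x x.2 y y.2⟩ : T))
    (fun _ _ _ => Subtype.ext (by simp)) (fun _ _ _ => Subtype.ext (by simp))
    (fun _ _ _ => Subtype.ext (by simp)) (fun _ _ _ => Subtype.ext (by simp))
  mul_mem := fun hx hy => B.mul_mem hx hy

/-- The quotient of a superalgebra by a graded ideal. -/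
def quot (B : Superalgebra k A) (I : Submodule k A) (hI : B.IsIdeal I)
    (hg : IsHomogeneous B.gr I) : Superalgebra k (A ⧸ I) where
  gr i := (B.gr i).map I.mkQ
  isCompl := by
    apply SuperGrading.isCompl_of
    · intro x
      obtain ⟨x, rfl⟩ := I.mkQ_surjective x
      exact ⟨_, Submodule.mem_map_of_mem (B.proj_mem 0 x), _,
        Submodule.mem_map_of_mem (B.proj_mem 1 x), by rw [← map_add, B.proj_add]⟩
    · rintro _ ⟨x, hx, rfl⟩ ⟨y, hy, hxy⟩
      have h : x - y ∈ I := by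
        rw [← Submodule.Quotient.mk_eq_zero, Submodule.Quotient.mk_sub, sub_eq_zero]
        exact hxy.symm
      have h' := proj_mem_of_isHomogeneous _ hg h 0
      rw [map_sub, B.proj_of_mem hx, B.proj_of_mem hy] at h'
      simpa using h'
  mul := I.liftQ
    (LinearMap.flip (I.liftQ (LinearMap.flip (B.mul.compr₂ I.mkQ)) (by
      intro x hx
      rw [LinearMap.mem_ker]
      ext y
      simpa using (hI x hx y).2))) (by
    intro x hx
    rw [LinearMap.mem_ker]
    ext y
    simpa using (hI x hx y).1)
  mul_mem := by
    rintro i j _ _ ⟨x, hx, rfl⟩ ⟨y, hy, rfl⟩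
    exact Submodule.mem_map_of_mem (f := I.mkQ) (B.mul_mem hx hy)

theorem quot_mul_mk (B : Superalgebra k A) (I : Submodule k A) (hI : B.IsIdeal I)
    (hg : IsHomogeneous B.gr I) (x y : A) :
    (B.quot I hI hg).mul (I.mkQ x) (I.mkQ y) = I.mkQ (B.mul x y) := rfl

/-- The ideal generated by a set. -/
def idealSpan (B : Superalgebra k A) (s : Set A) : Submodule k A :=
  sInf {I | B.IsIdeal I ∧ s ⊆ I}

theorem isIdeal_idealSpan (B : Superalgebra k A) (s : Set A) : B.IsIdeal (B.idealSpan s) := by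
  intro x hx y
  simp only [idealSpan, Submodule.mem_sInf] at hx ⊢
  exact ⟨fun I hI => (hI.1 x (hx I hI) y).1, fun I hI => (hI.1 x (hx I hI) y).2⟩

/-- The ideal generated by homogeneous elements is graded. -/
theorem isHomogeneous_idealSpan (B : Superalgebra k A) (s : Set A)
    (hs : ∀ x ∈ s, ∃ i, x ∈ B.gr i) : IsHomogeneous B.gr (B.idealSpan s) := by
  refine sInf_le ⟨?_, ?_⟩
  · intro x hx
    refine Submodule.iSup_induction (fun i => B.idealSpan s ⊓ B.gr i)
      (motive := fun x => ∀ y, B.mul x y ∈ _ ∧ B.mul y x ∈ _) hx ?_ ?_ ?_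
    · intro i x hx y
      have hx' := B.isIdeal_idealSpan s x hx.1
      rw [← B.proj_add y, map_add, map_add, LinearMap.add_apply]
      constructor
      · exact Submodule.add_mem _
          (Submodule.mem_iSup_of_mem _ ⟨(hx' _).1, B.mul_mem hx.2 (B.proj_mem _ _)⟩)
          (Submodule.mem_iSup_of_mem _ ⟨(hx' _).1, B.mul_mem hx.2 (B.proj_mem _ _)⟩)
      · exact Submodule.add_mem _
          (Submodule.mem_iSup_of_mem _ ⟨(hx' _).2, B.mul_mem (B.proj_mem _ _) hx.2⟩)
          (Submodule.mem_iSup_of_mem _ ⟨(hx' _).2, B.mul_mem (B.proj_mem _ _) hx.2⟩)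
    · intro y; simp
    · intro a b ha hb y
      rw [map_add, map_add, LinearMap.add_apply]
      exact ⟨Submodule.add_mem _ (ha y).1 (hb y).1, Submodule.add_mem _ (ha y).2 (hb y).2⟩
  · intro x hx
    obtain ⟨i, hi⟩ := hs x hx
    refine Submodule.mem_iSup_of_mem i ⟨?_, hi⟩
    simp only [idealSpan, Submodule.mem_sInf, SetLike.mem_coe]
    exact fun I hI => hI.2 hx

theorem isIdeal_sSup (B : Superalgebra k A) (S : Set (Submodule k A))
    (h : ∀ I ∈ S, B.IsIdeal I) : B.IsIdeal (sSup S) := by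
  intro x hx
  rw [sSup_eq_iSup'] at hx ⊢
  refine Submodule.iSup_induction (fun I : S => (I : Submodule k A))
    (motive := fun x => ∀ y, B.mul x y ∈ _ ∧ B.mul y x ∈ _) hx ?_ ?_ ?_
  · intro I x hx y
    exact ⟨Submodule.mem_iSup_of_mem I (h I I.2 x hx y).1,
      Submodule.mem_iSup_of_mem I (h I I.2 x hx y).2⟩
  · intro y; simp
  · intro a b ha hb y
    rw [map_add, map_add, LinearMap.add_apply]
    exact ⟨Submodule.add_mem _ (ha y).1 (hb y).1, Submodule.add_mem _ (ha y).2 (hb y).2⟩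

theorem isHomogeneous_sSup {ι : Type*} (g : ι → Submodule k A) (S : Set (Submodule k A))
    (h : ∀ I ∈ S, IsHomogeneous g I) : IsHomogeneous g (sSup S) :=
  sSup_le fun I hI => (h I hI).trans (iSup_mono fun _ => inf_le_inf_right _ (le_sSup hI))

/-- The superalgebra obtained from an associative algebra with a compatible grading by
taking the supercommutator `[a, b] = a b - (-1)^(|a||b|) b a`. -/
noncomputable def supercommutator {E : Type*} [Ring E] [Algebra k E] (G : SuperGrading k E)
    (hG : SuperGrading.IsEven G G G (LinearMap.mul k E)) : Superalgebra k E where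
  toSuperGrading := G
  mul := LinearMap.mul k E - SuperGrading.sflip G G (LinearMap.mul k E)
  mul_mem := fun hx hy => Submodule.sub_mem _ (hG hx hy) (hG.sflip hx hy)

theorem supercommutator_mul {E : Type*} [Ring E] [Algebra k E] (G : SuperGrading k E)
    (hG : SuperGrading.IsEven G G G (LinearMap.mul k E)) {i j : ZMod 2} {x y : E}
    (hx : x ∈ G.gr i) (hy : y ∈ G.gr j) :
    (supercommutator G hG).mul x y = x * y - sg k (i * j) • (y * x) := by
  have h := SuperGrading.sflip_apply G G (LinearMap.mul k E) hy hx
  rw [mul_comm] at h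
  simp only [supercommutator, LinearMap.sub_apply, h, LinearMap.mul_apply']

end Superalgebra
/-- A symmetric composition superalgebra over a field of characteristic different from `2`:
a superalgebra with a regular quadratic superform `(q, b)` permitting composition and with
associative `b`. -/
structure SymmetricCompositionSuperalgebra (k S : Type*) [Field k] [AddCommGroup S]
    [Module k S] extends Superalgebra k S where
  q : QuadraticForm k (gr 0)
  b : S →ₗ[k] S →ₗ[k] k
  b_even : ∀ x ∈ gr 0, ∀ y ∈ gr 1, b x y = 0 ∧ b y x = 0
  b_symm : ∀ x ∈ gr 0, ∀ y ∈ gr 0, b x y = b y x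
  b_alt : ∀ x ∈ gr 1, b x x = 0
  b_polar : ∀ x y : gr 0, b x y = q (x + y) - q x - q y
  b_nondeg : ∀ x, (∀ y, b x y = 0) → x = 0
  q_mul : ∀ x y : gr 0, q ⟨mul x y, mul_mem x.2 y.2⟩ = q x * q y
  b_mul_left : ∀ (x : gr 0) (y z : S), b (mul x y) (mul x z) = q x * b y z
  b_mul_right : ∀ (x : gr 0) (y z : S), b (mul y x) (mul z x) = q x * b y z
  b_mul : ∀ {i j l m : ZMod 2} {x y z t : S}, x ∈ gr i → y ∈ gr j → z ∈ gr l → t ∈ gr m →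
    b (mul x y) (mul z t) + sg k (i * j + i * l + j * l) * b (mul z y) (mul x t) =
      sg k (j * l) * (b x z * b y t)
  b_assoc : ∀ x y z, b (mul x y) z = b x (mul y z)

namespace SymmetricCompositionSuperalgebra

variable {k S : Type*} [Field k] [AddCommGroup S] [Module k S]

section Identities

variable (C : SymmetricCompositionSuperalgebra k S)

theorem b_eq_zero {i j : ZMod 2} {x y : S} (hx : x ∈ C.gr i) (hy : y ∈ C.gr j) (h : i ≠ j) :
    C.b x y = 0 := by
  rcases zmod2_cases i with rfl | rfl <;> rcases zmod2_cases j with rfl | rfl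
  · exact absurd rfl h
  · exact (C.b_even x hx y hy).1
  · exact (C.b_even y hy x hx).2
  · exact absurd rfl h

theorem b_comm {i j : ZMod 2} {x y : S} (hx : x ∈ C.gr i) (hy : y ∈ C.gr j) :
    C.b x y = sg k (i * j) * C.b y x := by
  rcases zmod2_cases i with rfl | rfl <;> rcases zmod2_cases j with rfl | rfl
  · simpa using C.b_symm x hx y hy
  · simp [C.b_even x hx y hy]
  · simp [C.b_even y hy x hx]
  · have h := C.b_alt (x + y) (add_mem hx hy)
    simp only [map_add, LinearMap.add_apply, C.b_alt x hx, C.b_alt y hy] at h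
    simp only [mul_one, sg_one]
    linear_combination h

theorem eq_of_b {x y : S} (h : ∀ i, ∀ z ∈ C.gr i, C.b x z = C.b y z) : x = y := by
  rw [← sub_eq_zero]
  apply C.b_nondeg
  intro z
  rw [← C.proj_add z]
  simp only [map_add, map_sub, LinearMap.sub_apply, h 0 _ (C.proj_mem 0 z),
    h 1 _ (C.proj_mem 1 z), sub_self, add_zero]

theorem mul_mul_right {i j l : ZMod 2} {x y z : S} (hx : x ∈ C.gr i) (hy : y ∈ C.gr j)
    (hz : z ∈ C.gr l) :
    C.mul (C.mul x y) z + sg k (i * j + i * l + j * l) • C.mul (C.mul z y) x =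
      (sg k (j * l) * C.b x z) • y := by
  refine C.eq_of_b fun m t ht => ?_
  have h := C.b_mul hx hy hz ht
  simp only [map_add, map_smul, LinearMap.add_apply, LinearMap.smul_apply, smul_eq_mul, C.b_assoc]
    at h ⊢
  linear_combination h

theorem mul_mul_left {i j l : ZMod 2} {x y z : S} (hx : x ∈ C.gr i) (hy : y ∈ C.gr j)
    (hz : z ∈ C.gr l) :
    C.mul x (C.mul y z) + sg k (i * j + i * l + j * l) • C.mul z (C.mul y x) =
      (sg k (i * j) * C.b x z) • y := by
  refine C.eq_of_b fun m t ht => ?_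
  have h := C.b_mul hy hz ht hx
  have e1 := C.b_comm hx (C.mul_mem (C.mul_mem hy hz) ht)
  have e2 := C.b_comm hz (C.mul_mem (C.mul_mem hy hx) ht)
  have e3 := C.b_comm hz hx
  have e4 := C.b_comm (C.mul_mem hy hx) (C.mul_mem ht hz)
  simp only [map_add, map_smul, LinearMap.add_apply, LinearMap.smul_apply, smul_eq_mul]
  rw [C.b_assoc x, C.b_assoc z, e1, e2, C.b_assoc _ t x, C.b_assoc _ t z, e4]
  rw [e3] at h
  by_cases hp : j + l + m = i
  · subst hp
    rcases zmod2_cases m with rfl | rfl <;> rcases zmod2_cases j with rfl | rfl <;>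
      rcases zmod2_cases l with rfl | rfl <;>
      simp only [mul_zero, mul_one, add_zero, zero_add, zmod2_one_add_one, sg_zero, sg_one] at h ⊢ <;>
      first
      | linear_combination h
      | linear_combination -h
      | (have e := C.b_eq_zero hy ht (by decide)
         simp only [e] at h ⊢
         first
         | linear_combination h
         | linear_combination -h)
  · have g1 : ∀ i j l m : ZMod 2, ¬j + l + m = i → j + l ≠ m + i := by decide
    have g2 : ∀ i j l m : ZMod 2, ¬j + l + m = i → m + l ≠ j + i := by decide
    have g3 : ∀ i j l m : ZMod 2, ¬j + l + m = i → i = l → j ≠ m := by decide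
    have f1 : C.b (C.mul y z) (C.mul t x) = 0 :=
      C.b_eq_zero (C.mul_mem hy hz) (C.mul_mem ht hx) (g1 i j l m hp)
    have f2 : C.b (C.mul t z) (C.mul y x) = 0 :=
      C.b_eq_zero (C.mul_mem ht hz) (C.mul_mem hy hx) (g2 i j l m hp)
    have f3 : C.b x z * C.b y t = 0 := by
      by_cases h : i = l
      · rw [C.b_eq_zero hy ht (g3 i j l m hp h), mul_zero]
      · rw [C.b_eq_zero hx hz h, zero_mul]
    rw [f1, f2]
    linear_combination (-sg k (i * j)) * f3

end Identities

section Triality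

variable (C : SymmetricCompositionSuperalgebra k S)

/-- Triples of endomorphisms with the componentwise supercommutator. -/
noncomputable def triples : Superalgebra k (Fin 3 → Module.End k S) :=
  Superalgebra.supercommutator (C.endo.pi 3) (by
    intro i j x y hx hy m _ l z hz
    have h := hx m trivial _ _ (hy m trivial l z hz)
    rwa [← add_assoc] at h)

theorem triples_mul {i j : ZMod 2} {d e : Fin 3 → Module.End k S}
    (hd : d ∈ C.triples.gr i) (he : e ∈ C.triples.gr j) (m : Fin 3) (x : S) :
    C.triples.mul d e m x = d m (e m x) - sg k (i * j) • e m (d m x) := by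
  have h := Superalgebra.supercommutator_mul (C.endo.pi 3) (by
    intro i j x y hx hy m _ l z hz
    have h := hx m trivial _ _ (hy m trivial l z hz)
    rwa [← add_assoc] at h) hd he
  exact congrArg (fun f : Fin 3 → Module.End k S => f m x) h

/-- The parity `i` component of the orthosymplectic Lie superalgebra of the superform. -/
def osp (i : ZMod 2) : Submodule k (Module.End k S) where
  carrier := {d | d ∈ C.endo.gr i ∧
    ∀ j, ∀ x ∈ C.gr j, ∀ y, C.b (d x) y + sg k (i * j) * C.b x (d y) = 0}
  add_mem' := by
    rintro d e ⟨hd, hd'⟩ ⟨he, he'⟩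
    refine ⟨add_mem hd he, fun j x hx y => ?_⟩
    simp only [LinearMap.add_apply, map_add]
    linear_combination hd' j x hx y + he' j x hx y
  zero_mem' := ⟨zero_mem _, fun j x hx y => by simp⟩
  smul_mem' := by
    rintro c d ⟨hd, hd'⟩
    refine ⟨Submodule.smul_mem _ c hd, fun j x hx y => ?_⟩
    simp only [LinearMap.smul_apply, map_smul, smul_eq_mul]
    linear_combination c * hd' j x hx y

/-- The parity `i` component of the triality Lie superalgebra. -/
def triGr (i : ZMod 2) : Submodule k (Fin 3 → Module.End k S) where
  carrier := {d | (∀ m, d m ∈ C.osp i) ∧ ∀ j, ∀ x ∈ C.gr j, ∀ y,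
    d 0 (C.mul x y) = C.mul (d 1 x) y + sg k (i * j) • C.mul x (d 2 y)}
  add_mem' := by
    rintro d e ⟨hd, hd'⟩ ⟨he, he'⟩
    refine ⟨fun m => add_mem (hd m) (he m), fun j x hx y => ?_⟩
    simp only [Pi.add_apply, LinearMap.add_apply, map_add, hd' j x hx y, he' j x hx y, smul_add]
    abel
  zero_mem' := ⟨fun m => zero_mem _, fun j x hx y => by simp⟩
  smul_mem' := by
    rintro c d ⟨hd, hd'⟩
    refine ⟨fun m => Submodule.smul_mem _ c (hd m), fun j x hx y => ?_⟩
    simp only [Pi.smul_apply, LinearMap.smul_apply, map_smul, hd' j x hx y, smul_add]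
    rw [smul_comm]

/-- The underlying space of the triality Lie superalgebra. -/
def tri : Submodule k (Fin 3 → Module.End k S) := C.triGr 0 ⊔ C.triGr 1

theorem triGr_le (i : ZMod 2) : C.triGr i ≤ C.triples.gr i := fun _ hd m _ => (hd.1 m).1

theorem triGr_le_tri (i : ZMod 2) : C.triGr i ≤ C.tri := by
  rcases zmod2_cases i with rfl | rfl
  · exact le_sup_left
  · exact le_sup_right

theorem osp_b {i j : ZMod 2} {d : Module.End k S} (hd : d ∈ C.osp i) {x : S} (hx : x ∈ C.gr j)
    (y : S) : C.b (d x) y = -(sg k (i * j) * C.b x (d y)) := by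
  linear_combination hd.2 j x hx y

theorem triGr_mul {i j : ZMod 2} {d e : Fin 3 → Module.End k S} (hd : d ∈ C.triGr i)
    (he : e ∈ C.triGr j) : C.triples.mul d e ∈ C.triGr (i + j) := by
  have hm := C.triples_mul (C.triGr_le i hd) (C.triGr_le j he)
  refine ⟨fun m => ⟨C.triples.mul_mem (C.triGr_le i hd) (C.triGr_le j he) m trivial, ?_⟩, ?_⟩
  · intro l x hx y
    have h1 := C.osp_b (hd.1 m) ((he.1 m).1 l x hx) y
    have h2 := C.osp_b (he.1 m) ((hd.1 m).1 l x hx) y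
    have h3 := C.osp_b (he.1 m) hx (d m y)
    have h4 := C.osp_b (hd.1 m) hx (e m y)
    simp only [hm, map_sub, map_smul, LinearMap.sub_apply, LinearMap.smul_apply, smul_eq_mul,
      h1, h2, h3, h4]
    rcases zmod2_cases i with rfl | rfl <;> rcases zmod2_cases j with rfl | rfl <;>
      rcases zmod2_cases l with rfl | rfl <;>
      simp only [mul_zero, mul_one, add_zero, zero_add, zmod2_one_add_one, sg_zero,
        sg_one] <;> ring
  · intro l x hx y
    simp only [hm]
    rw [he.2 l x hx y, hd.2 l x hx y]
    simp only [map_add, map_smul]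
    rw [hd.2 _ _ ((he.1 1).1 l x hx) y, he.2 _ _ ((hd.1 1).1 l x hx) y, hd.2 l x hx (e 2 y),
      he.2 l x hx (d 2 y)]
    simp only [map_sub, map_smul, LinearMap.sub_apply, LinearMap.smul_apply]
    rcases zmod2_cases i with rfl | rfl <;> rcases zmod2_cases j with rfl | rfl <;>
      rcases zmod2_cases l with rfl | rfl <;>
      simp only [mul_zero, mul_one, add_zero, zero_add, zmod2_one_add_one, sg_zero,
        sg_one] <;> module

theorem isHomogeneous_tri : Superalgebra.IsHomogeneous C.triples.gr C.tri :=
  sup_le (le_iSup_of_le 0 (le_inf (C.triGr_le_tri 0) (C.triGr_le 0)))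
    (le_iSup_of_le 1 (le_inf (C.triGr_le_tri 1) (C.triGr_le 1)))

theorem mem_tri {d : Fin 3 → Module.End k S} :
    d ∈ C.tri ↔ ∃ d0 ∈ C.triGr 0, ∃ d1 ∈ C.triGr 1, d0 + d1 = d := Submodule.mem_sup

/-- The triality Lie superalgebra `tri(S)`, with the componentwise bracket. -/
noncomputable def triSuper : Superalgebra k C.tri :=
  C.triples.sub C.tri C.isHomogeneous_tri (by
    intro x hx y hy
    obtain ⟨x0, hx0, x1, hx1, rfl⟩ := C.mem_tri.mp hx
    obtain ⟨y0, hy0, y1, hy1, rfl⟩ := C.mem_tri.mp hy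
    simp only [map_add, LinearMap.add_apply]
    exact add_mem
      (add_mem (C.triGr_le_tri _ (C.triGr_mul hx0 hy0)) (C.triGr_le_tri _ (C.triGr_mul hx1 hy0)))
      (add_mem (C.triGr_le_tri _ (C.triGr_mul hx0 hy1)) (C.triGr_le_tri _ (C.triGr_mul hx1 hy1))))

theorem mem_triSuper_gr {i : ZMod 2} {d : C.tri} : d ∈ C.triSuper.gr i ↔ ↑d ∈ C.triGr i := by
  refine ⟨fun h => ?_, fun h => C.triGr_le i h⟩
  obtain ⟨d, hd⟩ := d
  obtain ⟨d0, hd0, d1, hd1, rfl⟩ := C.mem_tri.mp hd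
  have h' : d0 + d1 ∈ C.triples.gr i := h
  have e := C.triples.proj_of_mem h'
  have e0 := C.triples.proj_of_mem (C.triGr_le 0 hd0)
  have e1 := C.triples.proj_of_mem (C.triGr_le 1 hd1)
  rcases zmod2_cases i with rfl | rfl
  · have := e 1
    rw [map_add, e0, e1] at this
    simp only [one_ne_zero, if_false, if_true, zero_add] at this
    simpa [this] using hd0
  · have := e 0
    rw [map_add, e0, e1] at this
    simp only [zero_ne_one, if_false, if_true, add_zero] at this
    simpa [this] using hd1

/-- The cyclic shift `(d₀, d₁, d₂) ↦ (d₂, d₀, d₁)`. -/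
def shift : (Fin 3 → Module.End k S) →ₗ[k] (Fin 3 → Module.End k S) where
  toFun d := ![d 2, d 0, d 1]
  map_add' d e := by ext m; fin_cases m <;> rfl
  map_smul' c d := by ext m; fin_cases m <;> rfl

theorem shift_shift_mem {i : ZMod 2} {d : Fin 3 → Module.End k S} (hd : d ∈ C.triGr i) :
    shift (shift d) ∈ C.triGr i := by
  refine ⟨fun m => ?_, fun j x hx y => ?_⟩
  · fin_cases m
    · exact hd.1 1
    · exact hd.1 2
    · exact hd.1 0
  · change d 1 (C.mul x y) = C.mul (d 2 x) y + sg k (i * j) • C.mul x (d 0 y)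
    have key : ∀ l, ∀ y ∈ C.gr l,
        d 1 (C.mul x y) = C.mul (d 2 x) y + sg k (i * j) • C.mul x (d 0 y) := by
      intro l y hy
      have m1 : d 1 (C.mul x y) ∈ C.gr (i + (j + l)) := (hd.1 1).1 _ _ (C.mul_mem hx hy)
      have m2 : C.mul (d 2 x) y + sg k (i * j) • C.mul x (d 0 y) ∈ C.gr (i + (j + l)) := by
        refine add_mem ?_ (Submodule.smul_mem _ _ ?_)
        · rw [← add_assoc]; exact C.mul_mem ((hd.1 2).1 j x hx) hy
        · rw [add_left_comm]; exact C.mul_mem hx ((hd.1 0).1 l y hy)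
      refine C.eq_of_b fun m w hw => ?_
      rw [C.b_comm m1 hw, C.b_comm m2 hw]
      have h := congrArg (fun z => C.b z y) (hd.2 m w hw x)
      have h1 := C.osp_b (hd.1 0) (C.mul_mem hw hx) y
      have h2 := C.osp_b (hd.1 1) hw (C.mul x y)
      simp only [map_add, map_smul, LinearMap.add_apply, LinearMap.smul_apply, smul_eq_mul] at h ⊢
      rw [h1, C.b_assoc, C.b_assoc, C.b_assoc, h2] at h
      congr 1
      revert h
      rcases zmod2_cases i with rfl | rfl <;> rcases zmod2_cases j with rfl | rfl <;>
        rcases zmod2_cases m with rfl | rfl <;>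
        simp only [mul_zero, mul_one, add_zero, zero_add, zmod2_one_add_one, sg_zero, sg_one] <;>
        intro h <;> first | linear_combination h | linear_combination -h
    rw [← C.proj_add y]
    simp only [map_add, key _ _ (C.proj_mem _ y), smul_add]
    abel

theorem shift_mem {i : ZMod 2} {d : Fin 3 → Module.End k S} (hd : d ∈ C.triGr i) :
    shift d ∈ C.triGr i := by
  have h := C.shift_shift_mem (C.shift_shift_mem hd)
  have e : shift (shift (shift (shift d))) = shift d := by
    ext m; fin_cases m <;> rfl
  rwa [e] at h

/-- The order three automorphism `θ : (d₀, d₁, d₂) ↦ (d₂, d₀, d₁)` of `tri(S)`. -/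
def theta : C.tri →ₗ[k] C.tri :=
  shift.restrict (by
    intro d hd
    obtain ⟨d0, hd0, d1, hd1, rfl⟩ := C.mem_tri.mp hd
    rw [map_add]
    exact add_mem (C.triGr_le_tri _ (C.shift_mem hd0)) (C.triGr_le_tri _ (C.shift_mem hd1)))

theorem theta_mem {i : ZMod 2} {d : C.tri} (hd : d ∈ C.triSuper.gr i) :
    C.theta d ∈ C.triSuper.gr i := by
  rw [mem_triSuper_gr] at hd ⊢
  exact C.shift_mem hd

/-- The operator `σ_{x,y} : z ↦ (-1)^(|y||z|) b(x,z) y - (-1)^(|x|(|y|+|z|)) b(y,z) x`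
for homogeneous `x`, `y` of parities `i`, `j`. -/
noncomputable def sigmaHom (i j : ZMod 2) : S →ₗ[k] S →ₗ[k] Module.End k S :=
  ∑ l, (sg k (j * l) • LinearMap.mk₂ k (fun x y => ((C.b x).smulRight y) ∘ₗ C.proj l)
      (fun _ _ _ => by ext; simp [add_smul]) (fun _ _ _ => by ext; simp [mul_smul])
      (fun _ _ _ => by ext; simp) (fun _ _ _ => by ext; simp [smul_smul, mul_comm]) -
    sg k (i * (j + l)) • LinearMap.mk₂ k (fun x y => ((C.b y).smulRight x) ∘ₗ C.proj l)
      (fun _ _ _ => by ext; simp) (fun _ _ _ => by ext; simp [smul_smul, mul_comm])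
      (fun _ _ _ => by ext; simp [add_smul]) (fun _ _ _ => by ext; simp [mul_smul]))

theorem sigmaHom_apply (i j : ZMod 2) (x y : S) {l : ZMod 2} {z : S} (hz : z ∈ C.gr l) :
    C.sigmaHom i j x y z =
      (sg k (j * l) * C.b x z) • y - (sg k (i * (j + l)) * C.b y z) • x := by
  simp only [sigmaHom, zmod2_sum, LinearMap.add_apply, LinearMap.sub_apply, LinearMap.smul_apply,
    LinearMap.mk₂_apply, LinearMap.comp_apply, LinearMap.smulRight_apply, C.proj_of_mem hz]
  rcases zmod2_cases l with rfl | rfl <;> simp [mul_smul]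

/-- Left multiplications `l_x : y ↦ x y`. -/
def lmul : S →ₗ[k] Module.End k S := C.mul

/-- Signed right multiplications `r_x : y ↦ (-1)^(|x||y|) y x`. -/
noncomputable def rmul : S →ₗ[k] Module.End k S :=
  SuperGrading.sflip C.toSuperGrading C.toSuperGrading C.mul

theorem rmul_apply {i j : ZMod 2} {x y : S} (hx : x ∈ C.gr i) (hy : y ∈ C.gr j) :
    C.rmul x y = sg k (i * j) • C.mul y x := by
  rw [rmul, SuperGrading.sflip_apply _ _ _ hy hx, mul_comm]

/-- The triple `(σ_{x,y}, ½ b(x,y) 1 - r_x l_y, ½ b(x,y) 1 - l_x r_y)` for homogeneous `x`, `y`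
of parities `i`, `j`. -/
noncomputable def tHom (i j : ZMod 2) : S →ₗ[k] S →ₗ[k] (Fin 3 → Module.End k S) :=
  LinearMap.mk₂ k (fun x y => ![C.sigmaHom i j x y,
      (2⁻¹ * C.b x y) • (1 : Module.End k S) - C.rmul x * C.lmul y,
      (2⁻¹ * C.b x y) • (1 : Module.End k S) - C.lmul x * C.rmul y])
    (fun x x' y => by
      ext m : 1
      fin_cases m <;> simp [mul_add, add_mul, add_smul] <;> abel)
    (fun c x y => by
      ext m : 1
      fin_cases m <;> simp [smul_sub, smul_smul, mul_left_comm])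
    (fun x y y' => by
      ext m : 1
      fin_cases m <;> simp [mul_add, add_smul] <;> abel)
    (fun c x y => by
      ext m : 1
      fin_cases m <;> simp [smul_sub, smul_smul, mul_left_comm])

theorem tHom_mem (h2 : (2 : k) ≠ 0) {i j : ZMod 2} {x y : S} (hx : x ∈ C.gr i) (hy : y ∈ C.gr j) :
    C.tHom i j x y ∈ C.triGr (i + j) := by
  have e0 : ∀ {l : ZMod 2} {z : S}, z ∈ C.gr l → C.tHom i j x y 0 z =
      (sg k (j * l) * C.b x z) • y - (sg k (i * (j + l)) * C.b y z) • x :=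
    fun hz => C.sigmaHom_apply i j x y hz
  have e1 : ∀ {l : ZMod 2} {z : S}, z ∈ C.gr l → C.tHom i j x y 1 z =
      (2⁻¹ * C.b x y) • z - sg k (i * (j + l)) • C.mul (C.mul y z) x :=
    fun hz => congrArg (fun w => (2⁻¹ * C.b x y) • _ - w) (C.rmul_apply hx (C.mul_mem hy hz))
  have e2 : ∀ {l : ZMod 2} {z : S}, z ∈ C.gr l → C.tHom i j x y 2 z =
      (2⁻¹ * C.b x y) • z - sg k (j * l) • C.mul x (C.mul z y) := by
    intro l z hz
    have h := C.rmul_apply hy hz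
    refine (congrArg (fun w => (2⁻¹ * C.b x y) • z - C.mul x w) h).trans ?_
    rw [map_smul]
  have hmem : ∀ {p q r : ZMod 2} {u v w : S}, u ∈ C.gr p → v ∈ C.gr q → w ∈ C.gr r →
      C.b u v • w ∈ C.gr (p + q + r) := by
    intro p q r u v w hu hv hw
    by_cases h : p = q
    · subst h
      have g : ∀ p r : ZMod 2, p + p + r = r := by decide
      rw [g]
      exact Submodule.smul_mem _ _ hw
    · rw [C.b_eq_zero hu hv h, zero_smul]
      exact zero_mem _
  have hb : ∀ {p q : ZMod 2} {u v : S}, u ∈ C.gr p → v ∈ C.gr q →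
      ∃ c, C.b u v = if p = q then c else 0 := by
    intro p q u v hu hv
    refine ⟨C.b u v, ?_⟩
    split_ifs with h
    · rfl
    · exact C.b_eq_zero hu hv h
  obtain ⟨c, hc⟩ : ∃ c, 2⁻¹ * C.b x y = if i = j then c else 0 := by
    obtain ⟨c, hc⟩ := hb hx hy
    refine ⟨2⁻¹ * c, ?_⟩
    rw [hc]
    split_ifs
    · rfl
    · rw [mul_zero]
  have hc' : C.b x y = 2 * (2⁻¹ * C.b x y) := by
    rw [← mul_assoc, mul_inv_cancel₀ h2, one_mul]
  rw [hc] at hc'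
  have hparity : ∀ m, C.tHom i j x y m ∈ C.endo.gr (i + j) := by
    intro m l z hz
    fin_cases m
    · have h := e0 hz
      refine h ▸ sub_mem ?_ ?_
      · rw [mul_smul, add_right_comm]
        exact Submodule.smul_mem _ _ (hmem hx hz hy)
      · rw [mul_smul, add_right_comm, add_comm (i + l), ← add_assoc, add_right_comm]
        exact Submodule.smul_mem _ _ (hmem hy hz hx)
    · have h := e1 hz
      refine h ▸ sub_mem ?_ (Submodule.smul_mem _ _ ?_)
      · rw [mul_smul]
        exact Submodule.smul_mem _ _ (hmem hx hy hz)
      · rw [add_assoc, add_comm]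
        exact C.mul_mem (C.mul_mem hy hz) hx
    · have h := e2 hz
      refine h ▸ sub_mem ?_ (Submodule.smul_mem _ _ ?_)
      · rw [mul_smul]
        exact Submodule.smul_mem _ _ (hmem hx hy hz)
      · rw [add_assoc, add_comm j]
        exact C.mul_mem hx (C.mul_mem hz hy)
  refine ⟨fun m => ⟨hparity m, ?_⟩, ?_⟩
  · intro l z hz w
    have key : ∀ p, ∀ w ∈ C.gr p, C.b (C.tHom i j x y m z) w +
        sg k ((i + j) * l) * C.b z (C.tHom i j x y m w) = 0 := by
      intro p w hw
      fin_cases m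
      · change C.b (C.tHom i j x y 0 z) w + sg k ((i + j) * l) * C.b z (C.tHom i j x y 0 w) = 0
        rw [e0 hz, e0 hw]
        simp only [map_sub, map_smul, LinearMap.sub_apply, LinearMap.smul_apply, smul_eq_mul]
        rw [C.b_comm hz hx, C.b_comm hz hy]
        obtain ⟨c1, h1⟩ := hb hx hz
        obtain ⟨c2, h2⟩ := hb hy hz
        obtain ⟨c3, h3⟩ := hb hx hw
        obtain ⟨c4, h4⟩ := hb hy hw
        rw [h1, h2, h3, h4]
        rcases zmod2_cases i with rfl | rfl <;> rcases zmod2_cases j with rfl | rfl <;>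
          rcases zmod2_cases l with rfl | rfl <;> rcases zmod2_cases p with rfl | rfl <;>
          simp [zmod2_one_add_one] <;> ring
      · change C.b (C.tHom i j x y 1 z) w + sg k ((i + j) * l) * C.b z (C.tHom i j x y 1 w) = 0
        rw [e1 hz, e1 hw]
        have h := C.b_mul hy hz hx hw
        simp only [map_sub, map_smul, LinearMap.sub_apply, LinearMap.smul_apply, smul_eq_mul]
        rw [C.b_assoc, C.b_comm hz (C.mul_mem (C.mul_mem hy hw) hx), C.b_assoc _ x z,
          C.b_comm (C.mul_mem hy hw) (C.mul_mem hx hz)]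
        rw [C.b_comm hy hx, hc'] at h
        obtain ⟨c1, h1⟩ := hb hz hw
        obtain ⟨c2, h2⟩ := hb (C.mul_mem hy hz) (C.mul_mem hx hw)
        obtain ⟨c3, h3⟩ := hb (C.mul_mem hx hz) (C.mul_mem hy hw)
        rw [hc]
        rw [h1, h2, h3] at h ⊢
        revert h
        rcases zmod2_cases i with rfl | rfl <;> rcases zmod2_cases j with rfl | rfl <;>
          rcases zmod2_cases l with rfl | rfl <;> rcases zmod2_cases p with rfl | rfl <;>
          simp [zmod2_one_add_one] <;> intro h <;>
          first | linear_combination h | linear_combination -h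
      · change C.b (C.tHom i j x y 2 z) w + sg k ((i + j) * l) * C.b z (C.tHom i j x y 2 w) = 0
        rw [e2 hz, e2 hw]
        have h := C.b_mul hz hx hw hy
        simp only [map_sub, map_smul, LinearMap.sub_apply, LinearMap.smul_apply, smul_eq_mul]
        rw [← C.b_assoc z x, C.b_comm (C.mul_mem hx (C.mul_mem hz hy)) hw, ← C.b_assoc w x,
          C.b_comm (C.mul_mem hw hx) (C.mul_mem hz hy)]
        rw [hc', C.b_comm (C.mul_mem hw hx) (C.mul_mem hz hy)] at h
        obtain ⟨c1, h1⟩ := hb hz hw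
        obtain ⟨c2, h2⟩ := hb (C.mul_mem hz hx) (C.mul_mem hw hy)
        obtain ⟨c3, h3⟩ := hb (C.mul_mem hz hy) (C.mul_mem hw hx)
        rw [hc]
        rw [h1, h2, h3] at h ⊢
        revert h
        rcases zmod2_cases i with rfl | rfl <;> rcases zmod2_cases j with rfl | rfl <;>
          rcases zmod2_cases l with rfl | rfl <;> rcases zmod2_cases p with rfl | rfl <;>
          simp [zmod2_one_add_one] <;> intro h <;>
          first | linear_combination h | linear_combination -h
    rw [← C.proj_add w]
    have k0 := key 0 _ (C.proj_mem 0 w)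
    have k1 := key 1 _ (C.proj_mem 1 w)
    simp only [map_add]
    linear_combination k0 + k1
  · intro l z hz w
    have key : ∀ p, ∀ w ∈ C.gr p, C.tHom i j x y 0 (C.mul z w) =
        C.mul (C.tHom i j x y 1 z) w + sg k ((i + j) * l) • C.mul z (C.tHom i j x y 2 w) := by
      intro p w hw
      rw [e0 (C.mul_mem hz hw), e1 hz, e2 hw]
      simp only [map_sub, map_smul, LinearMap.sub_apply, LinearMap.smul_apply]
      have A1 := congrArg (fun v => sg k (i * (j + l)) • v)
        (C.mul_mul_right (C.mul_mem hy hz) hx hw)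
      have A3 := congrArg (fun v => (sg k (i * (j + l)) *
        sg k ((j + l) * i + (j + l) * p + i * p)) • v)
        (C.mul_mul_left (C.mul_mem hw hx) hy hz)
      have A5 := congrArg (fun v => (sg k (i * (j + l)) *
        sg k ((j + l) * i + (j + l) * p + i * p) * sg k ((p + i) * j + (p + i) * l + j * l)) •
        C.mul z v) (C.mul_mul_left hy hw hx)
      simp only [map_add, map_smul, smul_add] at A1 A3 A5
      rw [C.b_assoc y] at A1
      rw [C.b_assoc w, C.b_comm hw (C.mul_mem hx hz), C.b_assoc x] at A3
      rw [C.b_comm hy hx, hc'] at A5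
      obtain ⟨c1, h1⟩ := hb hx (C.mul_mem hz hw)
      obtain ⟨c2, h2⟩ := hb hy (C.mul_mem hz hw)
      rw [hc, h1, h2]
      rw [h2] at A1
      rw [h1] at A3
      revert A1 A3 A5
      rcases zmod2_cases i with rfl | rfl <;> rcases zmod2_cases j with rfl | rfl <;>
        rcases zmod2_cases l with rfl | rfl <;> rcases zmod2_cases p with rfl | rfl <;>
        simp only [mul_zero, mul_one, add_zero, zero_add, zmod2_one_add_one, sg_zero, sg_one,
          zero_ne_one, one_ne_zero, if_true, if_false] <;>
        intro A1 A3 A5 <;>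
        linear_combination (norm := module) A1 - A3 + A5
    rw [← C.proj_add w]
    simp only [map_add, key _ _ (C.proj_mem _ w), smul_add]
    abel

/-- The triple `t_{x,y}` in `tri(S)`, extended bilinearly to arbitrary `x`, `y`. -/
noncomputable def t (h2 : (2 : k) ≠ 0) : S →ₗ[k] S →ₗ[k] C.tri :=
  LinearMap.mk₂ k (fun x y => ∑ i, ∑ j,
      (⟨C.tHom i j (C.proj i x) (C.proj j y),
        C.triGr_le_tri _ (C.tHom_mem h2 (C.proj_mem i x) (C.proj_mem j y))⟩ : C.tri))
    (fun _ _ _ => Subtype.ext (by simp [zmod2_sum]; abel))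
    (fun _ _ _ => Subtype.ext (by simp [zmod2_sum]))
    (fun _ _ _ => Subtype.ext (by simp [zmod2_sum]; abel))
    (fun _ _ _ => Subtype.ext (by simp [zmod2_sum]))

theorem t_apply (h2 : (2 : k) ≠ 0) {i j : ZMod 2} {x y : S} (hx : x ∈ C.gr i)
    (hy : y ∈ C.gr j) : (C.t h2 x y : Fin 3 → Module.End k S) = C.tHom i j x y := by
  simp only [t, LinearMap.mk₂_apply, zmod2_sum, Submodule.coe_add, C.proj_of_mem hx,
    C.proj_of_mem hy]
  rcases zmod2_cases i with rfl | rfl <;> rcases zmod2_cases j with rfl | rfl <;> simp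

theorem t_mem (h2 : (2 : k) ≠ 0) {i j : ZMod 2} {x y : S} (hx : x ∈ C.gr i)
    (hy : y ∈ C.gr j) : C.t h2 x y ∈ C.triSuper.gr (i + j) := by
  rw [mem_triSuper_gr, C.t_apply h2 hx hy]
  exact C.tHom_mem h2 hx hy

end Triality
end SymmetricCompositionSuperalgebra

open scoped TensorProduct

section Magic

variable {k S S' : Type*} [Field k] [AddCommGroup S] [Module k S] [AddCommGroup S'] [Module k S']

namespace SuperGrading

variable {A B D : Type*} [AddCommGroup A] [Module k A] [AddCommGroup B] [Module k B]
  [AddCommGroup D] [Module k D]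

theorem isEven_of_tmul_right {F : SuperGrading k D} {G : SuperGrading k S} {H : SuperGrading k S'}
    {K : SuperGrading k A} {β : D →ₗ[k] (S ⊗[k] S') →ₗ[k] A}
    (h : ∀ {i a b : ZMod 2} {d : D} {x : S} {y : S'}, d ∈ F.gr i → x ∈ G.gr a → y ∈ H.gr b →
      β d (x ⊗ₜ y) ∈ K.gr (i + (a + b))) : IsEven F (G.tensor H) K β := by
  intro i j d t hd ht
  refine Submodule.span_induction (p := fun t _ => β d t ∈ K.gr (i + j)) ?_ ?_ ?_ ?_ ht
  · rintro _ ⟨a, b, rfl, x, hx, y, hy, rfl⟩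
    exact h hd hx hy
  · rw [map_zero]; exact zero_mem _
  · intro _ _ _ _ hx hy
    rw [map_add]; exact add_mem hx hy
  · intro c _ _ hx
    rw [map_smul]; exact Submodule.smul_mem _ _ hx

theorem isEven_of_tmul {G : SuperGrading k S} {H : SuperGrading k S'}
    {K : SuperGrading k A} {β : (S ⊗[k] S') →ₗ[k] (S ⊗[k] S') →ₗ[k] A}
    (h : ∀ {a a' c c' : ZMod 2} {x y : S} {x' y' : S'}, x ∈ G.gr a → x' ∈ H.gr a' →
      y ∈ G.gr c → y' ∈ H.gr c' → β (x ⊗ₜ x') (y ⊗ₜ y') ∈ K.gr ((a + a') + (c + c'))) :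
    IsEven (G.tensor H) (G.tensor H) K β := by
  refine isEven_of_tmul_right fun {i c c' s y y'} hs hy hy' => ?_
  refine Submodule.span_induction
    (p := fun s _ => β s (y ⊗ₜ y') ∈ K.gr (i + (c + c'))) ?_ ?_ ?_ ?_ hs
  · rintro _ ⟨a, a', rfl, x, hx, x', hx', rfl⟩
    exact h hx hx' hy hy'
  · rw [map_zero]; exact zero_mem _
  · intro _ _ _ _ hx hy
    rw [map_add]; exact add_mem hx hy
  · intro c _ _ hx
    rw [map_smul]; exact Submodule.smul_mem _ _ hx

end SuperGrading

namespace SymmetricCompositionSuperalgebra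

variable (C : SymmetricCompositionSuperalgebra k S) (C' : SymmetricCompositionSuperalgebra k S')

/-- The parity grading of `S ⊗ S'`. -/
noncomputable def tensorGr : SuperGrading k (S ⊗[k] S') :=
  C.toSuperGrading.tensor C'.toSuperGrading

/-- The action `[(d₀,d₁,d₂), ι_m(x ⊗ x')] = ι_m(d_m(x) ⊗ x')` of `tri(S)`. -/
noncomputable def actLeft (m : Fin 3) : C.tri →ₗ[k] (S ⊗[k] S') →ₗ[k] (S ⊗[k] S') :=
  LinearMap.rTensorHom S' ∘ₗ LinearMap.proj m ∘ₗ C.tri.subtype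

theorem actLeft_tmul (m : Fin 3) (d : C.tri) (x : S) (x' : S') :
    C.actLeft m d (x ⊗ₜ x') = (d : Fin 3 → Module.End k S) m x ⊗ₜ x' := rfl

/-- The action `[(d'₀,d'₁,d'₂), ι_m(x ⊗ x')] = (-1)^(|d'||x|) ι_m(x ⊗ d'_m(x'))` of `tri(S')`. -/
noncomputable def actRight (m : Fin 3) : C'.tri →ₗ[k] (S ⊗[k] S') →ₗ[k] (S ⊗[k] S') :=
  ∑ a, ∑ c, sg k (a * c) •
    ((TensorProduct.mapBilinear (.id k) S S' S S' (C.proj c)) ∘ₗ LinearMap.proj m ∘ₗ C'.tri.subtype ∘ₗ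
      C'.triSuper.proj a)

theorem actRight_tmul (m : Fin 3) {i j : ZMod 2} {d : C'.tri} (hd : d ∈ C'.triSuper.gr i) {x : S}
    (hx : x ∈ C.gr j) (x' : S') :
    actRight C C' m d (x ⊗ₜ x') = sg k (i * j) • x ⊗ₜ (d : Fin 3 → Module.End k S') m x' := by
  simp only [actRight, zmod2_sum, LinearMap.add_apply, LinearMap.smul_apply, LinearMap.comp_apply,
    C'.triSuper.proj_of_mem hd, TensorProduct.mapBilinear_apply, TensorProduct.map_tmul,
    C.proj_of_mem hx, LinearMap.proj_apply, Submodule.subtype_apply]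
  rcases zmod2_cases i with rfl | rfl <;> rcases zmod2_cases j with rfl | rfl <;> simp

/-- The bilinear map
`(x ⊗ x', y ⊗ y') ↦ s(|x|,|x'|,|y|,|y'|) β(x,y) ⊗ β'(x',y')` on `S ⊗ S'`. -/
noncomputable def tensorPair {A A' : Type*} [AddCommGroup A] [Module k A] [AddCommGroup A']
    [Module k A'] (s : ZMod 2 → ZMod 2 → ZMod 2 → ZMod 2 → k)
    (β : S →ₗ[k] S →ₗ[k] A) (β' : S' →ₗ[k] S' →ₗ[k] A') :
    (S ⊗[k] S') →ₗ[k] (S ⊗[k] S') →ₗ[k] (A ⊗[k] A') :=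
  ∑ a, ∑ a', ∑ c, ∑ c', s a a' c c' •
    TensorProduct.map₂ (β.compl₁₂ (C.proj a) (C.proj c)) (β'.compl₁₂ (C'.proj a') (C'.proj c'))

theorem tensorPair_tmul {A A' : Type*} [AddCommGroup A] [Module k A] [AddCommGroup A']
    [Module k A'] (s : ZMod 2 → ZMod 2 → ZMod 2 → ZMod 2 → k)
    (β : S →ₗ[k] S →ₗ[k] A) (β' : S' →ₗ[k] S' →ₗ[k] A') {a a' c c' : ZMod 2} {x y : S}
    {x' y' : S'} (hx : x ∈ C.gr a) (hx' : x' ∈ C'.gr a') (hy : y ∈ C.gr c) (hy' : y' ∈ C'.gr c') :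
    tensorPair C C' s β β' (x ⊗ₜ x') (y ⊗ₜ y') = s a a' c c' • (β x y ⊗ₜ β' x' y') := by
  simp only [tensorPair, zmod2_sum, LinearMap.add_apply, LinearMap.smul_apply,
    TensorProduct.map₂_apply_tmul, TensorProduct.map_tmul, LinearMap.compl₁₂_apply,
    C.proj_of_mem hx, C.proj_of_mem hy, C'.proj_of_mem hx', C'.proj_of_mem hy']
  rcases zmod2_cases a with rfl | rfl <;> rcases zmod2_cases a' with rfl | rfl <;>
    rcases zmod2_cases c with rfl | rfl <;> rcases zmod2_cases c' with rfl | rfl <;> simp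

/-- The product `(x ⊗ x', y ⊗ y') ↦ (-1)^(|x'||y|) (x y) ⊗ (x' y')` on `S ⊗ S'`. -/
noncomputable def tensorMul : (S ⊗[k] S') →ₗ[k] (S ⊗[k] S') →ₗ[k] (S ⊗[k] S') :=
  tensorPair C C' (fun _ a' c _ => sg k (a' * c)) C.mul C'.mul

/-- The map
`(x ⊗ x', y ⊗ y') ↦ (-1)^(|x||x'| + |x||y'| + |y||y'|) b'(x',y') t_{x,y}` into `tri(S)`. -/
noncomputable def pairLeft (h2 : (2 : k) ≠ 0) :
    (S ⊗[k] S') →ₗ[k] (S ⊗[k] S') →ₗ[k] C.tri :=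
  (tensorPair C C' (fun a a' c c' => sg k (a * a' + a * c' + c * c')) (C.t h2) C'.b).compr₂
    (TensorProduct.rid k C.tri).toLinearMap

/-- The map `(x ⊗ x', y ⊗ y') ↦ (-1)^(|y||x'|) b(x,y) t'_{x',y'}` into `tri(S')`. -/
noncomputable def pairRight (h2 : (2 : k) ≠ 0) :
    (S ⊗[k] S') →ₗ[k] (S ⊗[k] S') →ₗ[k] C'.tri :=
  (tensorPair C C' (fun _ a' c _ => sg k (c * a')) C.b (C'.t h2)).compr₂
    (TensorProduct.lid k C'.tri).toLinearMap

theorem isEven_actLeft (m : Fin 3) : SuperGrading.IsEven C.triSuper.toSuperGrading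
    (tensorGr C C') (tensorGr C C') (C.actLeft m) := by
  refine SuperGrading.isEven_of_tmul_right fun {i a b d x y} hd hx hy => ?_
  rw [actLeft_tmul, ← add_assoc]
  exact SuperGrading.tmul_mem_tensor _ _ ((C.mem_triSuper_gr.mp hd).1 m |>.1 a x hx) hy

theorem isEven_actRight (m : Fin 3) : SuperGrading.IsEven C'.triSuper.toSuperGrading
    (tensorGr C C') (tensorGr C C') (actRight C C' m) := by
  refine SuperGrading.isEven_of_tmul_right fun {i a b d x y} hd hx hy => ?_
  rw [actRight_tmul C C' m hd hx, add_left_comm]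
  exact Submodule.smul_mem _ _
    (SuperGrading.tmul_mem_tensor _ _ hx ((C'.mem_triSuper_gr.mp hd).1 m |>.1 b y hy))

theorem isEven_tensorMul : SuperGrading.IsEven (tensorGr C C')
    (tensorGr C C') (tensorGr C C') (tensorMul C C') := by
  refine SuperGrading.isEven_of_tmul fun {a a' c c' x y x' y'} hx hx' hy hy' => ?_
  rw [tensorMul, tensorPair_tmul C C' _ _ _ hx hx' hy hy', add_add_add_comm]
  exact Submodule.smul_mem _ _
    (SuperGrading.tmul_mem_tensor _ _ (C.mul_mem hx hy) (C'.mul_mem hx' hy'))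

theorem isEven_pairLeft (h2 : (2 : k) ≠ 0) : SuperGrading.IsEven (tensorGr C C')
    (tensorGr C C') C.triSuper.toSuperGrading (pairLeft C C' h2) := by
  refine SuperGrading.isEven_of_tmul fun {a a' c c' x y x' y'} hx hx' hy hy' => ?_
  simp only [pairLeft, LinearMap.compr₂_apply, tensorPair_tmul C C' _ _ _ hx hx' hy hy', map_smul,
    LinearEquiv.coe_coe, TensorProduct.rid_tmul]
  by_cases h : a' = c'
  · subst h
    have g : ∀ a a' c : ZMod 2, a + a' + (c + a') = a + c := by decide
    rw [g]
    exact Submodule.smul_mem _ _ (Submodule.smul_mem _ _ (C.t_mem h2 hx hy))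
  · rw [C'.b_eq_zero hx' hy' h, zero_smul, smul_zero]
    exact zero_mem _

theorem isEven_pairRight (h2 : (2 : k) ≠ 0) : SuperGrading.IsEven (tensorGr C C')
    (tensorGr C C') C'.triSuper.toSuperGrading (pairRight C C' h2) := by
  refine SuperGrading.isEven_of_tmul fun {a a' c c' x y x' y'} hx hx' hy hy' => ?_
  simp only [pairRight, LinearMap.compr₂_apply, tensorPair_tmul C C' _ _ _ hx hx' hy hy', map_smul,
    LinearEquiv.coe_coe, TensorProduct.lid_tmul]
  by_cases h : a = c
  · subst h
    have g : ∀ a a' c : ZMod 2, a + a' + (a + c) = a' + c := by decide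
    rw [g]
    exact Submodule.smul_mem _ _ (Submodule.smul_mem _ _ (C'.t_mem h2 hx' hy'))
  · rw [C.b_eq_zero hx hy h, zero_smul, smul_zero]
    exact zero_mem _

/-- The underlying space of `g(S, S')`:
`(tri(S) ⊕ tri(S')) ⊕ (ι₀(S ⊗ S') ⊕ ι₁(S ⊗ S') ⊕ ι₂(S ⊗ S'))`. -/
abbrev MagicSpace (C : SymmetricCompositionSuperalgebra k S)
    (C' : SymmetricCompositionSuperalgebra k S') : Type _ :=
  C.tri × C'.tri × (Fin 3 → S ⊗[k] S')

/-- The parity grading of `g(S, S')`. -/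
noncomputable def magicGr : SuperGrading k (MagicSpace C C') :=
  C.triSuper.prod (C'.triSuper.prod ((tensorGr C C').pi 3))

/-- The bracket of `g(S, S')`. The `ι_m`-component of `[X, Y]` collects the actions of the
`tri`-components on the `ι_m`-components and the products
`[ι_{m+1}, ι_{m+2}]` and `[ι_{m+2}, ι_{m+1}]`, where products in the opposite order are given
by super-anticommutativity. -/
noncomputable def magicMul (h2 : (2 : k) ≠ 0) :
    MagicSpace C C' →ₗ[k] MagicSpace C C' →ₗ[k] MagicSpace C C' :=
  LinearMap.mk₂ k (fun X Y =>
      (C.triSuper.mul X.1 Y.1 +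
          ∑ i : Fin 3, (C.theta ^ (i : ℕ)) (pairLeft C C' h2 (X.2.2 i) (Y.2.2 i)),
        C'.triSuper.mul X.2.1 Y.2.1 +
          ∑ i : Fin 3, (C'.theta ^ (i : ℕ)) (pairRight C C' h2 (X.2.2 i) (Y.2.2 i)),
        fun m =>
          C.actLeft m X.1 (Y.2.2 m) + actRight C C' m X.2.1 (Y.2.2 m)
          - SuperGrading.sflip C.triSuper.toSuperGrading (tensorGr C C') (C.actLeft m)
              (X.2.2 m) Y.1
          - SuperGrading.sflip C'.triSuper.toSuperGrading (tensorGr C C') (actRight C C' m)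
              (X.2.2 m) Y.2.1
          + tensorMul C C' (X.2.2 (m + 1)) (Y.2.2 (m + 2))
          - SuperGrading.sflip (tensorGr C C') (tensorGr C C') (tensorMul C C')
              (X.2.2 (m + 2)) (Y.2.2 (m + 1))))
    (fun X X' Y => by
      refine Prod.ext ?_ (Prod.ext ?_ (funext fun m => ?_)) <;>
        simp [Finset.sum_add_distrib] <;> abel)
    (fun c X Y => by
      refine Prod.ext ?_ (Prod.ext ?_ (funext fun m => ?_)) <;>
        simp [Finset.smul_sum, smul_add, smul_sub])
    (fun X Y Y' => by
      refine Prod.ext ?_ (Prod.ext ?_ (funext fun m => ?_)) <;>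
        simp [Finset.sum_add_distrib] <;> abel)
    (fun c X Y => by
      refine Prod.ext ?_ (Prod.ext ?_ (funext fun m => ?_)) <;>
        simp [Finset.smul_sum, smul_add, smul_sub])

theorem theta_pow_mem {i : ZMod 2} {d : C.tri} (hd : d ∈ C.triSuper.gr i) (n : ℕ) :
    (C.theta ^ n) d ∈ C.triSuper.gr i := by
  induction n with
  | zero => exact hd
  | succ n ih => rw [pow_succ']; exact C.theta_mem ih

/-- The superalgebra `g(S, S')` attached to two symmetric composition superalgebras over a field
of characteristic different from `2`. -/
noncomputable def magic (h2 : (2 : k) ≠ 0) : Superalgebra k (MagicSpace C C') where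
  toSuperGrading := magicGr C C'
  mul := magicMul C C' h2
  mul_mem := by
    rintro i j X Y ⟨hX, hX', hX''⟩ ⟨hY, hY', hY''⟩
    refine ⟨add_mem (C.triSuper.mul_mem hX hY) (sum_mem fun i _ => C.theta_pow_mem
        (isEven_pairLeft C C' h2 (hX'' i trivial) (hY'' i trivial)) _),
      add_mem (C'.triSuper.mul_mem hX' hY') (sum_mem fun i _ => C'.theta_pow_mem
        (isEven_pairRight C C' h2 (hX'' i trivial) (hY'' i trivial)) _),
      fun m _ => sub_mem (add_mem (sub_mem (sub_mem (add_mem ?_ ?_) ?_) ?_) ?_) ?_⟩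
    · exact isEven_actLeft C C' m hX (hY'' m trivial)
    · exact isEven_actRight C C' m hX' (hY'' m trivial)
    · exact SuperGrading.IsEven.sflip (isEven_actLeft C C' m) (hX'' m trivial) hY
    · exact SuperGrading.IsEven.sflip (isEven_actRight C C' m) (hX'' m trivial) hY'
    · exact isEven_tensorMul C C' (hX'' _ trivial) (hY'' _ trivial)
    · exact SuperGrading.IsEven.sflip (isEven_tensorMul C C') (hX'' _ trivial) (hY'' _ trivial)

end SymmetricCompositionSuperalgebra

end Magic

section Examples

variable (k : Type*) [Field k]

theorem two_ne_zero_of_charP_three [CharP k 3] : (2 : k) ≠ 0 := by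
  intro h
  have h' : ((2 : ℕ) : k) = 0 := by exact_mod_cast h
  rw [CharP.cast_eq_zero_iff k 3] at h'
  revert h'; decide

/-- The para-Hurwitz algebra `S₁ = k 1`, with `1 • 1 = 1` and `q(1) = 1`. -/
def S1 (h2 : (2 : k) ≠ 0) : SymmetricCompositionSuperalgebra k k where
  gr i := if i = 0 then ⊤ else ⊥
  isCompl := by simpa using isCompl_top_bot
  mul := LinearMap.mul k k
  mul_mem := by
    intro i j x y hx hy
    rcases zmod2_cases i with rfl | rfl <;> rcases zmod2_cases j with rfl | rfl <;>
      simp_all [zmod2_one_add_one]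
  q := QuadraticMap.sq.comp (Submodule.subtype _)
  b := (2 : k) • LinearMap.mul k k
  b_even := by
    intro x _ y hy
    have hy : y = 0 := by simpa using hy
    simp [hy]
  b_symm := by
    intro x _ y _
    simp [mul_comm x y]
  b_alt := by
    intro x hx
    have hx : x = 0 := by simpa using hx
    simp [hx]
  b_polar := by
    intro x y
    simp only [QuadraticMap.comp_apply, QuadraticMap.sq_apply, map_add, LinearMap.smul_apply,
      LinearMap.mul_apply', smul_eq_mul, Submodule.subtype_apply]
    ring
  b_nondeg := by
    intro x h
    simpa [h2] using h 1
  q_mul := by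
    intro x y
    simp only [QuadraticMap.comp_apply, QuadraticMap.sq_apply, LinearMap.mul_apply',
      Submodule.subtype_apply]
    ring
  b_mul_left := by
    intro x y z
    simp only [QuadraticMap.comp_apply, QuadraticMap.sq_apply, LinearMap.smul_apply,
      LinearMap.mul_apply', smul_eq_mul, Submodule.subtype_apply]
    ring
  b_mul_right := by
    intro x y z
    simp only [QuadraticMap.comp_apply, QuadraticMap.sq_apply, LinearMap.smul_apply,
      LinearMap.mul_apply', smul_eq_mul, Submodule.subtype_apply]
    ring
  b_mul := by
    intro i j l m x y z t hx hy hz ht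
    rcases zmod2_cases i with rfl | rfl
    rcases zmod2_cases j with rfl | rfl
    rcases zmod2_cases l with rfl | rfl
    · simp only [LinearMap.smul_apply, LinearMap.mul_apply', smul_eq_mul, mul_zero, add_zero,
        sg_zero]
      ring
    · have hz : z = 0 := by simpa using hz
      simp [hz]
    · have hy : y = 0 := by simpa using hy
      simp [hy]
    · have hx : x = 0 := by simpa using hx
      simp [hx]
  b_assoc := by
    intro x y z
    simp [mul_assoc]

namespace B42

/-- The space `B(4,2) = End(V) ⊕ V`, with `V = k²` and `End(V)` the `2 × 2` matrices. -/
abbrev Space : Type _ := Matrix (Fin 2) (Fin 2) k × (Fin 2 → k)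

variable {k}

/-- The alternating form `⟨u|v⟩` on `V = k²`. -/
def form (u v : Fin 2 → k) : k := u 0 * v 1 - u 1 * v 0

/-- The symplectic involution of `End(V)` is the adjugate. -/
theorem form_adjugate (f : Matrix (Fin 2) (Fin 2) k) (u v : Fin 2 → k) :
    form (f.mulVec u) v = form u (f.adjugate.mulVec v) := by
  simp only [form, Matrix.adjugate_fin_two, Matrix.mulVec, dotProduct, Fin.sum_univ_two,
    Matrix.of_apply, Matrix.cons_val_zero, Matrix.cons_val_one]
  ring

/-- The endomorphism `u · v = ⟨ . | u⟩ v : w ↦ ⟨w|u⟩ v`. -/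
def rankOne (u v : Fin 2 → k) : Matrix (Fin 2) (Fin 2) k :=
  !![u 1 * v 0, -(u 0 * v 0); u 1 * v 1, -(u 0 * v 1)]

theorem rankOne_mulVec (u v w : Fin 2 → k) : (rankOne u v).mulVec w = form w u • v := by
  ext a
  fin_cases a <;>
  simp [rankOne, form, Matrix.mulVec, dotProduct, Fin.sum_univ_two] <;> ring

/-- The multiplication of `B(4,2)`: composition on `End(V)`, `v · f = f(v) = f̄ · v` and
`u · v = ⟨ . | u⟩ v`. -/
def mul (x y : Space k) : Space k :=
  (x.1 * y.1 + rankOne x.2 y.2, y.1.mulVec x.2 + x.1.adjugate.mulVec y.2)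

/-- The bilinear form of `B(4,2)`: the polar form of the determinant on `End(V)` and `⟨.|.⟩`
on `V`. -/
def b (x y : Space k) : k := ((x.1 + y.1).det - x.1.det - y.1.det) + form x.2 y.2

/-- The superinvolution `x̄ = b(x,1) 1 - x` of `B(4,2)`. -/
def conj (x : Space k) : Space k := b x (1, 0) • ((1, 0) : Space k) - x

/-- The multiplication `x • y = x̄ ȳ` of the para-Hurwitz superalgebra. -/
def paraMul (x y : Space k) : Space k := mul (conj x) (conj y)

theorem b_eq (x y : Space k) : b x y = x.1 0 0 * y.1 1 1 + x.1 1 1 * y.1 0 0 - x.1 0 1 * y.1 1 0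
    - x.1 1 0 * y.1 0 1 + (x.2 0 * y.2 1 - x.2 1 * y.2 0) := by
  simp only [b, form, Matrix.det_fin_two, Matrix.add_apply]
  ring

theorem conj_eq (x : Space k) : conj x = (!![x.1 1 1, -x.1 0 1; -x.1 1 0, x.1 0 0], -x.2) := by
  refine Prod.ext ?_ ?_
  · ext a c
    fin_cases a <;> fin_cases c <;> simp [conj, b_eq]
  · simp [conj]

theorem paraMul_eq (x y : Space k) : paraMul x y =
    (!![x.1 1 1 * y.1 1 1 + x.1 0 1 * y.1 1 0 + x.2 1 * y.2 0,
        -(x.1 1 1 * y.1 0 1) - x.1 0 1 * y.1 0 0 - x.2 0 * y.2 0;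
        -(x.1 1 0 * y.1 1 1) - x.1 0 0 * y.1 1 0 + x.2 1 * y.2 1,
        x.1 1 0 * y.1 0 1 + x.1 0 0 * y.1 0 0 - x.2 0 * y.2 1],
      ![-(y.1 1 1 * x.2 0) + y.1 0 1 * x.2 1 - x.1 0 0 * y.2 0 - x.1 0 1 * y.2 1,
        y.1 1 0 * x.2 0 - y.1 0 0 * x.2 1 - x.1 1 0 * y.2 0 - x.1 1 1 * y.2 1]) := by
  rw [paraMul, conj_eq, conj_eq]
  refine Prod.ext ?_ ?_
  · ext a c
    fin_cases a <;> fin_cases c <;> simp [mul, rankOne] <;> ring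
  · ext a
    fin_cases a <;> simp [mul, Matrix.adjugate_fin_two, dotProduct, Fin.sum_univ_two] <;> ring

theorem space_ext {k : Type*} {x y : Space k} (h1 : x.1 0 0 = y.1 0 0) (h2 : x.1 0 1 = y.1 0 1)
    (h3 : x.1 1 0 = y.1 1 0) (h4 : x.1 1 1 = y.1 1 1) (h5 : x.2 0 = y.2 0) (h6 : x.2 1 = y.2 1) :
    x = y := by
  refine Prod.ext (Matrix.ext fun a c => ?_) (funext fun a => ?_)
  · fin_cases a <;> fin_cases c <;> assumption
  · fin_cases a <;> assumption

/-- The parity grading: `End(V)` is even and `V` is odd. -/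
def grading : SuperGrading k (Space k) where
  gr i := if i = 0 then Submodule.prod ⊤ ⊥ else Submodule.prod ⊥ ⊤
  isCompl := by
    apply SuperGrading.isCompl_of
    · intro x
      exact ⟨(x.1, 0), by simp, (0, x.2), by simp, by simp⟩
    · intro x h0 h1
      simp at h0 h1
      exact Prod.ext h1 h0

/-- The bilinear form of `B(4,2)` as a bilinear map. -/
def bilin : Space k →ₗ[k] Space k →ₗ[k] k :=
  LinearMap.mk₂ k b
    (by intro x y z; simp [b_eq]; ring) (by intro x y z; simp [b_eq]; ring)
    (by intro x y z; simp [b_eq]; ring) (by intro x y z; simp [b_eq]; ring)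

/-- The para-Hurwitz multiplication as a bilinear map. -/
def paraBilin : Space k →ₗ[k] Space k →ₗ[k] Space k :=
  LinearMap.mk₂ k paraMul
    (by
      intro x x' y
      apply space_ext <;> simp [paraMul_eq] <;> ring)
    (by
      intro r x y
      apply space_ext <;> simp [paraMul_eq] <;> ring)
    (by
      intro x y y'
      apply space_ext <;> simp [paraMul_eq] <;> ring)
    (by
      intro r x y
      apply space_ext <;> simp [paraMul_eq] <;> ring)

theorem paraBilin_mem : SuperGrading.IsEven (grading (k := k)) grading grading paraBilin := by
  rintro i j ⟨f, u⟩ ⟨g, v⟩ hx hy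
  rcases zmod2_cases i with rfl | rfl <;> rcases zmod2_cases j with rfl | rfl <;>
    simp only [grading, paraBilin, zero_add, add_zero, zmod2_one_add_one, if_true, one_ne_zero, if_false,
      Submodule.mem_prod, Submodule.mem_top, Submodule.mem_bot, true_and, and_true] at hx hy ⊢ <;>
    subst hx <;> subst hy <;>
    simp only [LinearMap.mk₂_apply, paraMul_eq]
  · ext a; fin_cases a <;> simp
  · ext a c; fin_cases a <;> fin_cases c <;> simp
  · ext a c; fin_cases a <;> fin_cases c <;> simp
  · ext a; fin_cases a <;> simp

/-- The norm on the even part: the determinant of `End(V)`. -/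
def norm : QuadraticForm k ((grading (k := k)).gr 0) where
  toFun := fun x => x.1.1.det
  toFun_smul := by
    intro r x
    simp only [Submodule.coe_smul, Prod.smul_fst, Matrix.det_fin_two, Matrix.smul_apply,
      smul_eq_mul]
    ring
  exists_companion' := by
    refine ⟨LinearMap.mk₂ k (fun x y => b (x.1.1, 0) (y.1.1, 0)) ?_ ?_ ?_ ?_, ?_⟩
    · intro x y z; simp [b_eq]; ring
    · intro x y z; simp [b_eq]; ring
    · intro x y z; simp [b_eq]; ring
    · intro x y z; simp [b_eq]; ring
    · intro x y; simp [b, form]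

end B42

/-- The symmetric composition superalgebra `S_{4,2}` over a field of characteristic `3`: the
para-Hurwitz superalgebra attached to `B(4,2)`. -/
noncomputable def S42 [CharP k 3] : SymmetricCompositionSuperalgebra k (B42.Space k) where
  toSuperGrading := B42.grading
  mul := B42.paraBilin
  mul_mem := B42.paraBilin_mem
  q := B42.norm
  b := B42.bilin
  b_even := by
    rintro ⟨f, u⟩ hx ⟨g, v⟩ hy
    simp only [B42.grading, if_true, one_ne_zero, if_false, Submodule.mem_prod, Submodule.mem_top,
      Submodule.mem_bot, true_and, and_true] at hx hy
    subst hx; subst hy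
    simp [B42.bilin, B42.b_eq]
  b_symm := by
    rintro ⟨f, u⟩ hx ⟨g, v⟩ hy
    simp only [B42.grading, if_true, Submodule.mem_prod, Submodule.mem_top,
      Submodule.mem_bot, true_and] at hx hy
    subst hx; subst hy
    simp [B42.bilin, B42.b_eq]; ring
  b_alt := by
    rintro ⟨f, u⟩ hx
    simp only [B42.grading, one_ne_zero, if_false, Submodule.mem_prod, Submodule.mem_top,
      Submodule.mem_bot, and_true] at hx
    subst hx
    simp [B42.bilin, B42.b_eq]; ring
  b_polar := by
    rintro ⟨⟨f, u⟩, hx⟩ ⟨⟨g, v⟩, hy⟩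
    simp only [B42.grading, if_true, Submodule.mem_prod, Submodule.mem_top,
      Submodule.mem_bot, true_and] at hx hy
    subst hx; subst hy
    change B42.b _ _ = (f + g).det - f.det - g.det
    simp [B42.b, B42.form]
  b_nondeg := by
    rintro ⟨f, u⟩ h
    simp only [B42.bilin, LinearMap.mk₂_apply, B42.b_eq] at h
    refine Prod.ext ?_ ?_
    · ext a c
      fin_cases a <;> fin_cases c
      · simpa using h (!![0, 0; 0, 1], 0)
      · simpa using h (!![0, 0; 1, 0], 0)
      · simpa using h (!![0, 1; 0, 0], 0)
      · simpa using h (!![1, 0; 0, 0], 0)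
    · ext a
      fin_cases a
      · simpa using h (0, ![0, 1])
      · simpa using h (0, ![1, 0])
  q_mul := by
    rintro ⟨⟨f, u⟩, hx⟩ ⟨⟨g, v⟩, hy⟩
    simp only [B42.grading, if_true, Submodule.mem_prod, Submodule.mem_top,
      Submodule.mem_bot, true_and] at hx hy
    subst hx; subst hy
    change (B42.paraMul _ _).1.det = f.det * g.det
    simp [B42.paraMul_eq, Matrix.det_fin_two]; ring
  b_mul_left := by
    rintro ⟨⟨f, u⟩, hx⟩ ⟨g, v⟩ ⟨h, w⟩
    simp only [B42.grading, if_true, Submodule.mem_prod, Submodule.mem_top,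
      Submodule.mem_bot, true_and] at hx
    subst hx
    change B42.b (B42.paraMul _ _) (B42.paraMul _ _) = f.det * B42.b _ _
    simp [B42.paraMul_eq, B42.b_eq, Matrix.det_fin_two]; ring
  b_mul_right := by
    rintro ⟨⟨f, u⟩, hx⟩ ⟨g, v⟩ ⟨h, w⟩
    simp only [B42.grading, if_true, Submodule.mem_prod, Submodule.mem_top,
      Submodule.mem_bot, true_and] at hx
    subst hx
    change B42.b (B42.paraMul _ _) (B42.paraMul _ _) = f.det * B42.b _ _
    simp [B42.paraMul_eq, B42.b_eq, Matrix.det_fin_two]; ring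
  b_mul := by
    have h3 : (3 : k) = 0 := by exact_mod_cast CharP.cast_eq_zero k 3
    rintro i j l m ⟨f, u⟩ ⟨g, v⟩ ⟨h, w⟩ ⟨p, t⟩ hx hy hz ht
    simp only [B42.bilin, B42.paraBilin, LinearMap.mk₂_apply]
    rcases zmod2_cases i with rfl | rfl <;> rcases zmod2_cases j with rfl | rfl <;>
      rcases zmod2_cases l with rfl | rfl <;> rcases zmod2_cases m with rfl | rfl <;>
      simp only [B42.grading, if_true, one_ne_zero, if_false,
        Submodule.mem_prod, Submodule.mem_top, Submodule.mem_bot, true_and, and_true]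
        at hx hy hz ht <;>
      subst hx <;> subst hy <;> subst hz <;> subst ht <;>
      simp [B42.paraMul_eq, B42.b_eq, zmod2_one_add_one] <;>
      first
      | ring1
      | linear_combination (-(u 1 * v 0 * w 0 * t 1) + u 1 * w 0 * v 1 * t 0 + v 0 * t 1 * u 0 * w 1
          - u 0 * v 1 * w 1 * t 0) * h3
  b_assoc := by
    rintro ⟨f, u⟩ ⟨g, v⟩ ⟨h, w⟩
    simp [B42.bilin, B42.paraBilin, B42.paraMul_eq, B42.b_eq]; ring

end Examples

section Contragredient

/-- A realization `(𝔥, {α_1, …, α_n}, {h_1, …, h_n})` of a square matrix `A`. -/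
structure Realization {k : Type*} [Field k] {n : ℕ} (A : Matrix (Fin n) (Fin n) k)
    (𝔥 : Type*) [AddCommGroup 𝔥] [Module k 𝔥] where
  root : Fin n → Module.Dual k 𝔥
  coroot : Fin n → 𝔥
  root_linearIndependent : LinearIndependent k root
  coroot_linearIndependent : LinearIndependent k coroot
  root_coroot : ∀ i j, root j (coroot i) = A i j
  finite : Module.Finite k 𝔥
  finrank_eq : Module.finrank k 𝔥 + A.rank = 2 * n

namespace Contragredient

/-- The generators: the elements of `𝔥`, and the symbols `e_i` and `f_i`. -/
inductive Gen (n : ℕ) (𝔥 : Type*) where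
  | h (x : 𝔥) : Gen n 𝔥
  | e (i : Fin n) : Gen n 𝔥
  | f (i : Fin n) : Gen n 𝔥

variable {k : Type*} [Field k] {n : ℕ} {𝔥 : Type*}

open Classical in
/-- The parity of a generator: `𝔥` is even, and `e_i`, `f_i` are odd exactly when `i ∈ τ`. -/
noncomputable def Gen.parity (τ : Set (Fin n)) : Gen n 𝔥 → ZMod 2
  | .h _ => 0
  | .e i => if i ∈ τ then 1 else 0
  | .f i => if i ∈ τ then 1 else 0

/-- The degree of a generator in the `ℤ`-grading. -/
def Gen.degree : Gen n 𝔥 → ℤ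
  | .h _ => 0
  | .e _ => 1
  | .f _ => -1

/-- The extension of a weight function on letters to nonassociative words. -/
def wordWeight {X G : Type*} [Add G] (w : X → G) : FreeMagma X → G
  | .of x => w x
  | .mul u v => wordWeight w u + wordWeight w v

/-- The free nonassociative algebra on the generators. -/
abbrev Free (k : Type*) [Field k] (n : ℕ) (𝔥 : Type*) : Type _ :=
  FreeNonUnitalNonAssocAlgebra k (Gen n 𝔥)

/-- The span of the words of weight `g`. -/
noncomputable def wordGr (k : Type*) [Field k] {X G : Type*} [Add G] (w : X → G) (g : G) :
    Submodule k (FreeNonUnitalNonAssocAlgebra k X) :=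
  Submodule.span k {x | ∃ u : FreeMagma X, wordWeight w u = g ∧ MonoidAlgebra.single u 1 = x}

theorem single_mem_wordGr {X G : Type*} [Add G] (w : X → G) (u : FreeMagma X) (c : k) :
    MonoidAlgebra.single u c ∈ wordGr k w (wordWeight w u) := by
  have h : MonoidAlgebra.single u c = c • MonoidAlgebra.single u (1 : k) := by simp
  rw [h]
  exact Submodule.smul_mem _ _ (Submodule.subset_span ⟨u, rfl, rfl⟩)

theorem coeff_eq_zero {X G : Type*} [Add G] (w : X → G) {g : G}
    {x : FreeNonUnitalNonAssocAlgebra k X} (hx : x ∈ wordGr k w g) {u : FreeMagma X}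
    (hu : wordWeight w u ≠ g) : x.coeff u = 0 := by
  classical
  refine Submodule.span_induction (p := fun x _ => x.coeff u = 0) ?_ ?_ ?_ ?_ hx
  · rintro _ ⟨v, hv, rfl⟩
    rw [MonoidAlgebra.coeff_single, Finsupp.single_apply, if_neg]
    rintro rfl
    exact hu hv
  · simp
  · intro a b _ _ ha hb
    simp [ha, hb]
  · intro c a _ ha
    simp [ha]

/-- The free nonassociative superalgebra on the generators. -/
noncomputable def freeSuper (k : Type*) [Field k] {n : ℕ} (𝔥 : Type*) (τ : Set (Fin n)) :
    Superalgebra k (Free k n 𝔥) where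
  gr := wordGr k (Gen.parity τ)
  isCompl := by
    apply SuperGrading.isCompl_of
    · intro x
      induction x using MonoidAlgebra.induction_linear with
      | zero => exact ⟨0, zero_mem _, 0, zero_mem _, add_zero _⟩
      | add a b ha hb =>
        obtain ⟨a0, ha0, a1, ha1, rfl⟩ := ha
        obtain ⟨b0, hb0, b1, hb1, rfl⟩ := hb
        exact ⟨a0 + b0, add_mem ha0 hb0, a1 + b1, add_mem ha1 hb1, by abel⟩
      | single u c =>
        have h := single_mem_wordGr (Gen.parity τ) u c
        rcases zmod2_cases (wordWeight (Gen.parity τ) u) with e | e <;> rw [e] at h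
        · exact ⟨_, h, 0, zero_mem _, add_zero _⟩
        · exact ⟨0, zero_mem _, _, h, zero_add _⟩
    · intro x h0 h1
      ext u
      rcases zmod2_cases (wordWeight (Gen.parity τ) u) with e | e
      · exact coeff_eq_zero _ h1 (by rw [e]; decide)
      · exact coeff_eq_zero _ h0 (by rw [e]; decide)
  mul := LinearMap.mul k _
  mul_mem := by
    intro i j x y hx hy
    refine Submodule.span_induction
      (p := fun x _ => x * y ∈ wordGr k (Gen.parity τ) (i + j)) ?_ ?_ ?_ ?_ hx
    · rintro _ ⟨u, hu, rfl⟩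
      refine Submodule.span_induction (p := fun y _ =>
        MonoidAlgebra.single u 1 * y ∈ wordGr k (Gen.parity τ) (i + j)) ?_ ?_ ?_ ?_ hy
      · rintro _ ⟨v, hv, rfl⟩
        rw [MonoidAlgebra.single_mul_single, ← hu, ← hv]
        exact single_mem_wordGr (Gen.parity τ) (u * v) _
      · rw [mul_zero]; exact zero_mem _
      · intro _ _ _ _ ha hb
        rw [mul_add]; exact add_mem ha hb
      · intro c _ _ ha
        rw [mul_smul_comm]; exact Submodule.smul_mem _ _ ha
    · rw [zero_mul]; exact zero_mem _
    · intro _ _ _ _ ha hb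
      rw [add_mul]; exact add_mem ha hb
    · intro c _ _ ha
      rw [smul_mul_assoc]; exact Submodule.smul_mem _ _ ha

/-- The generator `e_i`, `f_i` or `h ∈ 𝔥` as an element of the free algebra. -/
noncomputable def gen (k : Type*) [Field k] {n : ℕ} {𝔥 : Type*} (x : Gen n 𝔥) : Free k n 𝔥 :=
  FreeNonUnitalNonAssocAlgebra.of k x

theorem gen_mem (τ : Set (Fin n)) (x : Gen n 𝔥) :
    gen k x ∈ (freeSuper k 𝔥 τ).gr (x.parity τ) :=
  single_mem_wordGr (Gen.parity τ) (.of x) 1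

variable [AddCommGroup 𝔥] [Module k 𝔥] {A : Matrix (Fin n) (Fin n) k}

/-- The relators: the identities of Lie superalgebras, the linear structure of `𝔥`, and the
relations `[e_i,f_j] = δ_ij h_i`, `[h,h'] = 0`, `[h,e_i] = α_i(h) e_i`,
`[h,f_i] = -α_i(h) f_i`. -/
inductive Rel (R : Realization A 𝔥) (τ : Set (Fin n)) : Free k n 𝔥 → Prop
  | skew (i j : ZMod 2) (x y : Free k n 𝔥) (hx : x ∈ (freeSuper k 𝔥 τ).gr i)
      (hy : y ∈ (freeSuper k 𝔥 τ).gr j) : Rel R τ (x * y + sg k (i * j) • (y * x))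
  | self_even (x : Free k n 𝔥) (hx : x ∈ (freeSuper k 𝔥 τ).gr 0) : Rel R τ (x * x)
  | jacobi (i j l : ZMod 2) (x y z : Free k n 𝔥) (hx : x ∈ (freeSuper k 𝔥 τ).gr i)
      (hy : y ∈ (freeSuper k 𝔥 τ).gr j) (hz : z ∈ (freeSuper k 𝔥 τ).gr l) :
      Rel R τ (x * (y * z) - (x * y) * z - sg k (i * j) • (y * (x * z)))
  | cube_odd (x : Free k n 𝔥) (hx : x ∈ (freeSuper k 𝔥 τ).gr 1) : Rel R τ (x * (x * x))
  | h_add (x y : 𝔥) : Rel R τ (gen k (.h (x + y)) - gen k (.h x) - gen k (.h y))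
  | h_smul (c : k) (x : 𝔥) : Rel R τ (gen k (.h (c • x)) - c • gen k (.h x))
  | e_f (i : Fin n) : Rel R τ (gen k (.e i) * gen k (.f i) - gen k (.h (R.coroot i)))
  | e_f_ne (i j : Fin n) (hij : i ≠ j) : Rel R τ (gen k (.e i) * gen k (.f j))
  | h_h (x y : 𝔥) : Rel R τ (gen k (.h x) * gen k (.h y))
  | h_e (x : 𝔥) (i : Fin n) :
      Rel R τ (gen k (.h x) * gen k (.e i) - R.root i x • gen k (.e i))
  | h_f (x : 𝔥) (i : Fin n) :
      Rel R τ (gen k (.h x) * gen k (.f i) + R.root i x • gen k (.f i))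

theorem Rel.homogeneous {R : Realization A 𝔥} {τ : Set (Fin n)} {x : Free k n 𝔥}
    (hx : Rel R τ x) : ∃ i, x ∈ (freeSuper k 𝔥 τ).gr i := by
  have hm : ∀ {i j : ZMod 2} {x y : Free k n 𝔥}, x ∈ (freeSuper k 𝔥 τ).gr i →
      y ∈ (freeSuper k 𝔥 τ).gr j → x * y ∈ (freeSuper k 𝔥 τ).gr (i + j) :=
    (freeSuper k 𝔥 τ).mul_mem
  have hg := gen_mem (k := k) (𝔥 := 𝔥) τ
  cases hx with
  | skew i j x y hx hy =>
    refine ⟨i + j, add_mem (hm hx hy) (Submodule.smul_mem _ _ ?_)⟩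
    rw [add_comm]; exact hm hy hx
  | self_even x hx => exact ⟨_, hm hx hx⟩
  | jacobi i j l x y z hx hy hz =>
    refine ⟨i + (j + l), sub_mem (sub_mem (hm hx (hm hy hz)) ?_) (Submodule.smul_mem _ _ ?_)⟩
    · rw [← add_assoc]; exact hm (hm hx hy) hz
    · rw [add_left_comm]; exact hm hy (hm hx hz)
  | cube_odd x hx => exact ⟨_, hm hx (hm hx hx)⟩
  | h_add x y => exact ⟨0, sub_mem (sub_mem (hg (.h _)) (hg (.h _))) (hg (.h _))⟩
  | h_smul c x => exact ⟨0, sub_mem (hg (.h _)) (Submodule.smul_mem _ _ (hg (.h _)))⟩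
  | e_f i =>
    refine ⟨0, sub_mem ?_ (hg (.h _))⟩
    have h := hm (hg (.e i)) (hg (.f i))
    have e : Gen.parity τ (.e i : Gen n 𝔥) + Gen.parity τ (.f i : Gen n 𝔥) = 0 := by
      have g : ∀ a : ZMod 2, a + a = 0 := by decide
      exact g _
    rwa [e] at h
  | e_f_ne i j _ => exact ⟨_, hm (hg _) (hg _)⟩
  | h_h x y => exact ⟨_, hm (hg _) (hg _)⟩
  | h_e x i =>
    refine ⟨Gen.parity τ (.e i : Gen n 𝔥), sub_mem ?_ (Submodule.smul_mem _ _ (hg _))⟩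
    have h := hm (hg (.h x)) (hg (.e i))
    rwa [show Gen.parity τ (.h x : Gen n 𝔥) = 0 from rfl, zero_add] at h
  | h_f x i =>
    refine ⟨Gen.parity τ (.f i : Gen n 𝔥), add_mem ?_ (Submodule.smul_mem _ _ (hg _))⟩
    have h := hm (hg (.h x)) (hg (.f i))
    rwa [show Gen.parity τ (.h x : Gen n 𝔥) = 0 from rfl, zero_add] at h

/-- The ideal of the free superalgebra generated by the relators. -/
noncomputable def relIdeal (R : Realization A 𝔥) (τ : Set (Fin n)) : Submodule k (Free k n 𝔥) :=
  (freeSuper k 𝔥 τ).idealSpan {x | Rel R τ x}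

/-- The Lie superalgebra `g̃(A, τ)` generated by `𝔥`, `e_i`, `f_i` subject to the relations
`[e_i,f_j] = δ_ij h_i`, `[h,h'] = 0`, `[h,e_i] = α_i(h) e_i`, `[h,f_i] = -α_i(h) f_i`. -/
noncomputable def tilde (R : Realization A 𝔥) (τ : Set (Fin n)) :
    Superalgebra k (Free k n 𝔥 ⧸ relIdeal R τ) :=
  (freeSuper k 𝔥 τ).quot (relIdeal R τ) ((freeSuper k 𝔥 τ).isIdeal_idealSpan _)
    ((freeSuper k 𝔥 τ).isHomogeneous_idealSpan _ fun _ hx => hx.homogeneous)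

/-- The components of the `ℤ`-grading of `g̃(A, τ)`, with `𝔥` in degree `0`, `e_i` in degree `1`
and `f_i` in degree `-1`. -/
noncomputable def tildeDegree (R : Realization A 𝔥) (τ : Set (Fin n)) (m : ℤ) :
    Submodule k (Free k n 𝔥 ⧸ relIdeal R τ) :=
  (wordGr k Gen.degree m).map (relIdeal R τ).mkQ

/-- The ideals of `g̃(A, τ)` (graded by parity, as all ideals of superalgebras) that are homogeneous
for the `ℤ`-grading and intersect `𝔥` trivially. -/
def IsTrivialOnCartan (R : Realization A 𝔥) (τ : Set (Fin n))
    (I : Submodule k (Free k n 𝔥 ⧸ relIdeal R τ)) : Prop :=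
  (tilde R τ).IsIdeal I ∧ Superalgebra.IsHomogeneous (tilde R τ).gr I ∧
    Superalgebra.IsHomogeneous (tildeDegree R τ) I ∧
    ∀ x : 𝔥, (relIdeal R τ).mkQ (gen k (.h x)) ∈ I → (relIdeal R τ).mkQ (gen k (.h x)) = 0

/-- The largest homogeneous ideal `i(A)` of `g̃(A, τ)` that intersects `𝔥` trivially. -/
noncomputable def maxIdeal (R : Realization A 𝔥) (τ : Set (Fin n)) :
    Submodule k (Free k n 𝔥 ⧸ relIdeal R τ) :=
  sSup {I | IsTrivialOnCartan R τ I}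

end Contragredient

/-- The contragredient Lie superalgebra `g(A, τ) = g̃(A, τ) / i(A)`. -/
noncomputable def contragredient {k : Type*} [Field k] {n : ℕ} {A : Matrix (Fin n) (Fin n) k}
    {𝔥 : Type*} [AddCommGroup 𝔥] [Module k 𝔥] (R : Realization A 𝔥) (τ : Set (Fin n)) :
    Superalgebra k ((Contragredient.Free k n 𝔥 ⧸ Contragredient.relIdeal R τ) ⧸
      Contragredient.maxIdeal R τ) :=
  (Contragredient.tilde R τ).quot (Contragredient.maxIdeal R τ)
    (Superalgebra.isIdeal_sSup _ _ fun _ h => h.1)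
    (Superalgebra.isHomogeneous_sSup _ _ fun _ h => h.2.1)

end Contragredient

attribute [local instance 100] LieRing.ofAssociativeRing

section Symplectic

variable {k : Type*} [Field k]

/-- The derivation action of an endomorphism `X` of `W` on exterior powers, as an alternating map:
`z₁ ∧ … ∧ z_n ↦ ∑ i, z₁ ∧ … ∧ X z_i ∧ … ∧ z_n`. -/
noncomputable def wedgeDerivAlt {W : Type*} [AddCommGroup W] [Module k W] (n : ℕ)
    (X : Module.End k W) : W [⋀^Fin n]→ₗ[k] (⋀[k]^n W) where
  toMultilinearMap := ∑ i, (exteriorPower.ιMulti k n).toMultilinearMap.compLinearMap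
    (Function.update (fun _ => LinearMap.id) i X)
  map_eq_zero_of_eq' := by
    intro v a b hab hne
    have hterm : ∀ i, ((exteriorPower.ιMulti k n).toMultilinearMap.compLinearMap
        (Function.update (fun _ => LinearMap.id) i X)) v =
        exteriorPower.ιMulti k n (Function.update v i (X (v i))) := by
      intro i
      rw [MultilinearMap.compLinearMap_apply]
      change exteriorPower.ιMulti k n _ = _
      congr 1
      funext j
      by_cases h : j = i
      · subst h; simp
      · simp [h]
    change (∑ i, (exteriorPower.ιMulti k n).toMultilinearMap.compLinearMap
      (Function.update (fun _ => LinearMap.id) i X)) v = 0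
    rw [sum_apply]
    simp only [hterm]
    rw [← Finset.add_sum_erase _ _ (Finset.mem_univ a),
      ← Finset.add_sum_erase _ _ (Finset.mem_erase.mpr ⟨hne.symm, Finset.mem_univ b⟩),
      Finset.sum_eq_zero, add_zero]
    · have hs : Function.update v b (X (v b)) = Function.update v a (X (v a)) ∘ Equiv.swap a b := by
        funext j
        by_cases ha : j = a
        · subst ha; simp [hne, hne.symm, hab]
        · by_cases hb : j = b
          · subst hb; simp [hab]
          · simp [Equiv.swap_apply_of_ne_of_ne ha hb, ha, hb]
      rw [hs, AlternatingMap.map_swap _ _ hne, add_neg_cancel]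
    · intro i hi
      simp only [Finset.mem_erase, Finset.mem_univ, and_true] at hi
      exact AlternatingMap.map_eq_zero_of_eq _ _
        (by rw [Function.update_of_ne hi.2.symm, Function.update_of_ne hi.1.symm, hab]) hne

/-- The derivation action of an endomorphism of `W` on `⋀^n W`. -/
noncomputable def wedgeDeriv {W : Type*} [AddCommGroup W] [Module k W] (n : ℕ)
    (X : Module.End k W) : Module.End k (⋀[k]^n W) :=
  exteriorPower.alternatingMapLinearEquiv (wedgeDerivAlt n X)

theorem wedgeDeriv_ιMulti {W : Type*} [AddCommGroup W] [Module k W] (n : ℕ)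
    (X : Module.End k W) (z : Fin n → W) :
    wedgeDeriv n X (exteriorPower.ιMulti k n z) =
      ∑ i, exteriorPower.ιMulti k n (Function.update z i (X (z i))) := by
  rw [wedgeDeriv, exteriorPower.alternatingMapLinearEquiv_apply_ιMulti]
  change (∑ i, (exteriorPower.ιMulti k n).toMultilinearMap.compLinearMap
      (Function.update (fun _ => LinearMap.id) i X)) z = _
  rw [sum_apply]
  refine Finset.sum_congr rfl fun i _ => ?_
  rw [MultilinearMap.compLinearMap_apply]
  change exteriorPower.ιMulti k n _ = _
  congr 1
  funext j
  by_cases h : j = i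
  · subst h; simp
  · simp [h]

variable (k)

/-- The natural six dimensional module `W` of `sp₆`. -/
abbrev W6 : Type _ := Fin 3 ⊕ Fin 3 → k

/-- The symplectic Lie algebra `sp₆` of matrices. -/
abbrev sp6 : LieSubalgebra k (Matrix (Fin 3 ⊕ Fin 3) (Fin 3 ⊕ Fin 3) k) :=
  LieAlgebra.Symplectic.sp (Fin 3) k

variable {k}

/-- The invariant alternating form `{u|v} = uᵀ J v` on `W`. A symplectic basis consists of
`a_i = e_{inr i}` and `b_i = e_{inl i}`. -/
def altForm (u v : W6 k) : k := u ⬝ᵥ (Matrix.J (Fin 3) k).mulVec v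

theorem altForm_eq (u v : W6 k) :
    altForm u v = ∑ i, (u (.inr i) * v (.inl i) - u (.inl i) * v (.inr i)) := by
  simp [altForm, Matrix.J, Matrix.mulVec, dotProduct, Fintype.sum_sum_type, Matrix.one_apply,
    Matrix.fromBlocks, Finset.sum_sub_distrib]
  ring

theorem altForm_add_left (u v w : W6 k) : altForm (u + v) w = altForm u w + altForm v w := by
  simp [altForm]

theorem altForm_add_right (u v w : W6 k) : altForm u (v + w) = altForm u v + altForm u w := by
  simp [altForm, Matrix.mulVec_add]

theorem altForm_smul_left (c : k) (u v : W6 k) : altForm (c • u) v = c * altForm u v := by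
  simp [altForm]

theorem altForm_smul_right (c : k) (u v : W6 k) : altForm u (c • v) = c * altForm u v := by
  simp [altForm, Matrix.mulVec_smul]

theorem altForm_self (u : W6 k) : altForm u u = 0 := by
  simp [altForm_eq, mul_comm]

theorem altForm_swap (u v : W6 k) : altForm u v = -altForm v u := by
  simp only [altForm_eq, ← Finset.sum_neg_distrib]
  exact Finset.sum_congr rfl fun i _ => by ring

theorem altForm_invariant (X : sp6 k) (u v : W6 k) :
    altForm ((X : Matrix _ _ k).mulVec u) v + altForm u ((X : Matrix _ _ k).mulVec v) = 0 := by
  have h : (X : Matrix _ _ k).transpose * Matrix.J (Fin 3) k =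
      Matrix.J (Fin 3) k * -(X : Matrix _ _ k) :=
    (mem_skewAdjointMatricesSubmodule (J := Matrix.J (Fin 3) k) (A₁ := X.1)).mp X.2
  have e : altForm ((X : Matrix _ _ k).mulVec u) v =
      u ⬝ᵥ ((X : Matrix _ _ k).transpose * Matrix.J (Fin 3) k).mulVec v := by
    rw [altForm, ← Matrix.mulVec_mulVec, Matrix.dotProduct_mulVec u, Matrix.vecMul_transpose]
  rw [e, h, altForm, ← Matrix.mulVec_mulVec, ← dotProduct_add, ← Matrix.mulVec_add,
    Matrix.neg_mulVec, neg_add_cancel, Matrix.mulVec_zero, dotProduct_zero]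

/-- The action of `sp₆` on `⋀³ W`. -/
noncomputable def spWedge (X : sp6 k) : Module.End k (⋀[k]^3 (W6 k)) :=
  wedgeDeriv 3 (Matrix.toLin' (X : Matrix _ _ k))

variable (k)

/-- The contraction `⋀³ W → W`,
`z₁ ∧ z₂ ∧ z₃ ↦ {z₁|z₂} z₃ + {z₂|z₃} z₁ + {z₃|z₁} z₂`, as an alternating map. -/
noncomputable def contractionAlt : W6 k [⋀^Fin 3]→ₗ[k] W6 k where
  toFun z := altForm (z 0) (z 1) • z 2 + altForm (z 1) (z 2) • z 0 + altForm (z 2) (z 0) • z 1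
  map_update_add' := by
    intro inst z i x y
    obtain rfl : inst = instDecidableEqFin 3 := Subsingleton.elim _ _
    match i with
    | 0 => simp [altForm_add_left, altForm_add_right, add_smul]; abel
    | 1 => simp [altForm_add_left, altForm_add_right, add_smul]; abel
    | 2 => simp [altForm_add_left, altForm_add_right, add_smul]; abel
  map_update_smul' := by
    intro inst z i c x
    obtain rfl : inst = instDecidableEqFin 3 := Subsingleton.elim _ _
    match i with
    | 0 => simp [altForm_smul_left, altForm_smul_right, mul_smul]; module
    | 1 => simp [altForm_smul_left, altForm_smul_right, mul_smul]; module
    | 2 => simp [altForm_smul_left, altForm_smul_right, mul_smul]; module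
  map_eq_zero_of_eq' := by
    intro z i j h hne
    have h01 : ∀ u w : W6 k, altForm u u • w + altForm u w • u + altForm w u • u = 0 := by
      intro u w
      rw [altForm_self, altForm_swap u w]; module
    match i, j with
    | 0, 0 => exact absurd rfl hne
    | 1, 1 => exact absurd rfl hne
    | 2, 2 => exact absurd rfl hne
    | 0, 1 => rw [← h]; exact h01 _ _
    | 1, 0 => rw [h]; exact h01 _ _
    | 1, 2 => rw [← h, altForm_self, altForm_swap (z 0)]; module
    | 2, 1 => rw [h, altForm_self, altForm_swap (z 0)]; module
    | 0, 2 => rw [← h, altForm_self, altForm_swap (z 0)]; module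
    | 2, 0 => rw [h, altForm_self, altForm_swap (z 0)]; module

/-- The contraction `⋀³ W → W` as a linear map. -/
noncomputable def contraction : (⋀[k]^3 (W6 k)) →ₗ[k] W6 k :=
  exteriorPower.alternatingMapLinearEquiv (contractionAlt k)

/-- A subspace of `⋀³ W` is an irreducible `sp₆`-submodule: it is invariant, nonzero, and has no
invariant subspaces except `0` and itself. -/
def IsIrreducibleSubmodule (U : Submodule k (⋀[k]^3 (W6 k))) : Prop :=
  (∀ X : sp6 k, ∀ w ∈ U, spWedge X w ∈ U) ∧ U ≠ ⊥ ∧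
    ∀ N ≤ U, (∀ X : sp6 k, ∀ w ∈ N, spWedge X w ∈ N) → N = ⊥ ∨ N = U

/-- The elements of the nilpotent subalgebra `n⁺` of `sp₆` spanned by the root vectors of roots
`δ_i - δ_j` (`i < j`) and `δ_i + δ_j`, `2δ_i`: block matrices `(A B; 0 -Aᵀ)` with `A` strictly upper
triangular. -/
def IsPositive (X : sp6 k) : Prop :=
  (∀ i j, X.1 (.inr i) (.inl j) = 0) ∧
    ∀ i j, j ≤ i → X.1 (.inl i) (.inl j) = 0

/-- The elements of the Cartan subalgebra of diagonal matrices of `sp₆`. -/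
def IsCartan (X : sp6 k) : Prop := X.1.IsDiag

/-- A highest weight vector of weight `ω₃ = δ₁ + δ₂ + δ₃`: a nonzero vector annihilated by `n⁺` on
which the diagonal matrix `diag(c₁,c₂,c₃,-c₁,-c₂,-c₃)` acts as `c₁ + c₂ + c₃`. -/
def IsHighestWeightVectorOmega3 (w : ⋀[k]^3 (W6 k)) : Prop :=
  w ≠ 0 ∧ (∀ X : sp6 k, IsPositive k X → spWedge X w = 0) ∧
    ∀ X : sp6 k, IsCartan k X →
      spWedge X w = (∑ i, X.1 (.inl i) (.inl i)) • w

end Symplectic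

/-- The Cartan matrix of `g(S₁, S_{4,2})`. -/
def cartanMatrixS1S42 (k : Type*) [Field k] : Matrix (Fin 3) (Fin 3) k :=
  !![2, -1, 0; 1, 2, 1; 0, 1, 0]

/-- The Lie superalgebra `g(S₁, S_{4,2})` over a field of characteristic `3`. -/
noncomputable def gS1S42 (k : Type*) [Field k] [CharP k 3] : Superalgebra k
    (SymmetricCompositionSuperalgebra.MagicSpace (S1 k (two_ne_zero_of_charP_three k)) (S42 k)) :=
  SymmetricCompositionSuperalgebra.magic (S1 k (two_ne_zero_of_charP_three k)) (S42 k)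
    (two_ne_zero_of_charP_three k)

namespace Superalgebra

variable {k A : Type*} [Field k] [AddCommGroup A] [Module k A]

/-- The product of the even part. -/
def evenMul (B : Superalgebra k A) (x y : B.gr 0) : B.gr 0 := ⟨B.mul x y, B.mul_mem x.2 y.2⟩

/-- The action of the even part on the odd part. -/
def evenAct (B : Superalgebra k A) (x : B.gr 0) (y : B.gr 1) : B.gr 1 :=
  ⟨B.mul x y, B.mul_mem x.2 y.2⟩

end Superalgebra

/-! Everything is proved in an explicit model and carried over by an isomorphism.

Since `tri(S₁) = 0` and `S₁ = k`, the space `g(S₁, S)` is `tri(S)` plus three copies of `S`. For `S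
= S_{4,2}` take three copies V₀, V₁, V₂ of V. The even part of `tri(S)` is sl(V₀) ⊕ sl(V₁) ⊕ sl(V₂),
its odd part is V₀ ⊗ V₁ ⊗ V₂ (trilinear forms), and the i-th copy of S is Hom(V_{i+1}, V_{i+2}) ⊕
V_i. So the even part is the sum of the sl(V_i) and of the V_i ⊗ V_j, which is sp(V₀ ⊥ V₁ ⊥ V₂) =
sp₆, of dimension 21. The odd part is V₀ ⊗ V₁ ⊗ V₂ plus V₀ ⊕ V₁ ⊕ V₂, of dimension 14, which is `ker
φ` restricted to the three sl₂.

The model `SpWedgeModel.algebra` is k²¹ ⊕ k¹⁴ with the commutator of sp₆, the action on V(ω₃) and an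
equivariant symmetric map from V(ω₃) to sp₆. The sp₆ identities and equivariance hold over any
field. The Jacobi identity for three odd elements and [x,[x,x]] = 0 are where characteristic 3
enters the axioms (`action_oddBracket`, `action_oddBracket_self`). `nonempty_iso_gS1S42` identifies
the model with `g(S₁, S_{4,2})`. It needs `tri(S_{4,2})` in full: its elements are determined by
their effect on odd vectors (`tri_ext_even`, `tri_ext_odd`) and are exactly those written down
(`exists_evenMap`, `exists_oddMap`).

V(ω₃) is irreducible because its 14 weights are distinct modulo 3, so that submodules are spanned by
basis vectors, and because root vectors join these basis vectors in a cycle (`action_irreducible`).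
Simplicity follows: the odd part of a graded ideal is 0 or everything; in the first case the ideal
vanishes since sp₆ acts faithfully, in the second it contains the even part, which is spanned by
brackets of odd elements.

The contragredient statement follows from a recognition principle (`ChevalleySystem.nonempty_iso`):
a simple Lie superalgebra generated by elements satisfying the relations of g̃(A, τ), with a
compatible ℤ-grading and with 𝔥 embedded, is the quotient of g̃(A, τ) by its largest ideal trivial
on 𝔥. The essential input is that the degree zero component of g̃(A, τ) is the image of 𝔥
(`tildeDegree_le`). The matrix A has determinant 1 in characteristic 3, so in every realization the
coroots form a basis of 𝔥.

On the symplectic side, sixteen and more minors are avoided by Plücker coordinates: six linear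
relations cut the 20 minors of ⋀³W down to 14, and in these the action of sp₆ on `ker φ` is the one
of the model (`coordinates_spWedge`). -/

set_option linter.unusedSimpArgs false

open scoped TensorProduct

/-! ### Isomorphisms of superalgebras and transport of structure -/

namespace Superalgebra

variable {k A A' : Type*} [Field k] [AddCommGroup A] [Module k A] [AddCommGroup A'] [Module k A']

theorem subset_idealSpan (B : Superalgebra k A) (s : Set A) : s ⊆ B.idealSpan s := by
  intro x hx
  simp only [idealSpan, Submodule.mem_sInf, SetLike.mem_coe]
  exact fun I hI => hI.2 hx

theorem idealSpan_le (B : Superalgebra k A) {s : Set A} {I : Submodule k A} (hI : B.IsIdeal I)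
    (hs : s ⊆ I) : B.idealSpan s ≤ I := sInf_le ⟨hI, hs⟩

/-- The inverse of an isomorphism of superalgebras. -/
def Iso.symm {B : Superalgebra k A} {B' : Superalgebra k A'} (e : B.Iso B') : B'.Iso B where
  toEquiv := e.toEquiv.symm
  map_mem := by
    intro i x hx
    -- An isomorphism commutes with the parity projections; this is what makes its inverse even.
    have h : ∀ j, e.toEquiv (B.proj j (e.toEquiv.symm x)) = B'.proj j x := by
      intro j
      have hs := B.proj_add (e.toEquiv.symm x)
      have h0 := e.map_mem 0 _ (B.proj_mem 0 (e.toEquiv.symm x))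
      have h1 := e.map_mem 1 _ (B.proj_mem 1 (e.toEquiv.symm x))
      have h2 := congrArg (fun y => B'.proj j (e.toEquiv y)) hs
      simp only [map_add, LinearEquiv.apply_symm_apply, B'.proj_of_mem h0, B'.proj_of_mem h1] at h2
      rcases zmod2_cases j with rfl | rfl <;> simpa using h2
    have h2 := h i
    rw [B'.proj_of_mem hx, if_pos rfl, ← e.toEquiv.eq_symm_apply] at h2
    rw [← h2]
    exact B.proj_mem _ _
  map_mul := by
    intro x y
    rw [LinearEquiv.symm_apply_eq, e.map_mul, LinearEquiv.apply_symm_apply,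
      LinearEquiv.apply_symm_apply]

/-- The composition of isomorphisms of superalgebras. -/
def Iso.trans {A'' : Type*} [AddCommGroup A''] [Module k A''] {B : Superalgebra k A}
    {B' : Superalgebra k A'} {B'' : Superalgebra k A''} (e : B.Iso B') (e' : B'.Iso B'') :
    B.Iso B'' where
  toEquiv := e.toEquiv.trans e'.toEquiv
  map_mem := fun i x hx => e'.map_mem i _ (e.map_mem i x hx)
  map_mul := fun x y => by simp [e.map_mul, e'.map_mul]

theorem IsLie.of_iso {B : Superalgebra k A} {B' : Superalgebra k A'} (e : B.Iso B')
    (h : B'.IsLie) : B.IsLie where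
  skew := by
    intro i j x y hx hy
    apply e.toEquiv.injective
    simp only [map_neg, map_smul, e.map_mul]
    exact h.skew (e.map_mem _ _ hx) (e.map_mem _ _ hy)
  self_even := by
    intro x hx
    apply e.toEquiv.injective
    rw [e.map_mul, map_zero, h.self_even _ (e.map_mem _ _ hx)]
  jacobi := by
    intro i j x y z hx hy
    apply e.toEquiv.injective
    simp only [map_add, map_smul, e.map_mul]
    exact h.jacobi _ (e.map_mem _ _ hx) (e.map_mem _ _ hy)
  cube_odd := by
    intro x hx
    apply e.toEquiv.injective
    rw [e.map_mul, e.map_mul, map_zero, h.cube_odd _ (e.map_mem _ _ hx)]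

theorem isHomogeneous_map {B : Superalgebra k A} {B' : Superalgebra k A'} (f : A →ₗ[k] A')
    (hf : ∀ i, ∀ x ∈ B.gr i, f x ∈ B'.gr i) {I : Submodule k A} (hI : IsHomogeneous B.gr I) :
    IsHomogeneous B'.gr (I.map f) := by
  rintro _ ⟨x, hx, rfl⟩
  rw [← B.proj_add x, map_add]
  refine add_mem (Submodule.mem_iSup_of_mem 0 ?_) (Submodule.mem_iSup_of_mem 1 ?_) <;>
  exact ⟨⟨_, proj_mem_of_isHomogeneous _ hI hx _, rfl⟩, hf _ _ (B.proj_mem _ _)⟩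

/-- Surjectivity lifts the second factor of a product; otherwise the image would only be an ideal of
the range. -/
theorem IsIdeal.map {B : Superalgebra k A} {B' : Superalgebra k A'} (f : A →ₗ[k] A')
    (hf : ∀ x y, f (B.mul x y) = B'.mul (f x) (f y)) (hs : Function.Surjective f)
    {I : Submodule k A} (hI : B.IsIdeal I) : B'.IsIdeal (I.map f) := by
  rintro _ ⟨x, hx, rfl⟩ y
  obtain ⟨y, rfl⟩ := hs y
  rw [← hf, ← hf]
  exact ⟨⟨_, (hI x hx y).1, rfl⟩, ⟨_, (hI x hx y).2, rfl⟩⟩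

theorem IsSimple.of_iso {B : Superalgebra k A} {B' : Superalgebra k A'} (e : B.Iso B')
    (h : B'.IsSimple) : B.IsSimple := by
  obtain ⟨⟨x, y, hxy⟩, hI⟩ := h
  refine ⟨⟨e.toEquiv.symm x, e.toEquiv.symm y, fun h0 => hxy ?_⟩, fun I h1 h2 => ?_⟩
  · have := congrArg e.toEquiv h0
    simpa [e.map_mul] using this
  · have := hI (I.map e.toEquiv.toLinearMap) (h1.map _ e.map_mul e.toEquiv.surjective)
      (isHomogeneous_map _ e.map_mem h2)
    rcases this with h | h
    · left
      exact (Submodule.map_eq_bot_iff (e := e.toEquiv)).mp h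
    · right
      exact (Submodule.map_eq_top_iff (e := e.toEquiv) (p := I)).mp h

/-! ### Words in generators and triangular decomposition -/

/-- The left normed words of length `m + 1` in a family of elements. -/
def normedWords {ι : Type*} (B : Superalgebra k A) (g : ι → A) : ℕ → Set A
  | 0 => Set.range g
  | m + 1 => {x | ∃ i, ∃ y ∈ normedWords B g m, B.mul (g i) y = x}

theorem exists_mem_gr_of_mem_normedWords {ι : Type*} (B : Superalgebra k A) {g : ι → A}
    {p : ι → ZMod 2} (hg : ∀ i, g i ∈ B.gr (p i)) :
    ∀ (m : ℕ), ∀ x ∈ normedWords B g m, ∃ j, x ∈ B.gr j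
  | 0 => by rintro _ ⟨i, rfl⟩; exact ⟨_, hg i⟩
  | m + 1 => by
    rintro _ ⟨i, y, hy, rfl⟩
    obtain ⟨j, hj⟩ := exists_mem_gr_of_mem_normedWords B hg m y hy
    exact ⟨_, B.mul_mem (hg i) hj⟩

/-- The span of the left normed words of length `m + 1`. -/
def layer {ι : Type*} (B : Superalgebra k A) (g : ι → A) (m : ℕ) : Submodule k A :=
  Submodule.span k (normedWords B g m)

theorem mem_layer_zero {ι : Type*} (B : Superalgebra k A) (g : ι → A) (i : ι) :
    g i ∈ B.layer g 0 := Submodule.subset_span ⟨i, rfl⟩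

/-- Reduces statements about a layer to words, with linearity packed into `f`. -/
theorem span_induction_le {s : Set A} {f : A →ₗ[k] A'} {N : Submodule k A'}
    (h : ∀ x ∈ s, f x ∈ N) : ∀ x ∈ Submodule.span k s, f x ∈ N :=
  fun _ hx => (Submodule.span_le (p := N.comap f)).mpr h hx

theorem mul_mem_layer_succ {ι : Type*} (B : Superalgebra k A) (g : ι → A) (i : ι) (m : ℕ) :
    ∀ x ∈ B.layer g m, B.mul (g i) x ∈ B.layer g (m + 1) :=
  span_induction_le fun x hx => Submodule.subset_span ⟨i, x, hx, rfl⟩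

/-- A triangular configuration: an even subspace acting diagonally on two families of homogeneous
elements, and containing the brackets between these. -/
structure Triangular {ι : Type*} (B : Superalgebra k A) (N : Submodule k A) (e f : ι → A)
    (p : ι → ZMod 2) : Prop where
  even : N ≤ B.gr 0
  e_mem : ∀ i, e i ∈ B.gr (p i)
  f_mem : ∀ i, f i ∈ B.gr (p i)
  comm : ∀ x ∈ N, ∀ y ∈ N, B.mul x y = 0
  mul_e : ∀ x ∈ N, ∀ i, ∃ c : k, B.mul x (e i) = c • e i
  mul_f : ∀ x ∈ N, ∀ i, ∃ c : k, B.mul x (f i) = c • f i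
  e_f : ∀ i j, B.mul (e i) (f j) ∈ N

namespace Triangular

variable {ι : Type*} {B : Superalgebra k A} {N : Submodule k A} {e f : ι → A} {p : ι → ZMod 2}

theorem symm (hB : B.IsLie) (h : Triangular B N e f p) : Triangular B N f e p where
  even := h.even
  e_mem := h.f_mem
  f_mem := h.e_mem
  comm := h.comm
  mul_e := h.mul_f
  mul_f := h.mul_e
  e_f := by
    intro i j
    rw [hB.skew (h.f_mem i) (h.e_mem j)]
    exact neg_mem (N.smul_mem _ (h.e_f j i))

theorem e_mul (hB : B.IsLie) (h : Triangular B N e f p) {x : A} (hx : x ∈ N) (i : ι) :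
    B.mul (e i) x ∈ B.layer e 0 := by
  obtain ⟨c, hc⟩ := h.mul_e x hx i
  rw [hB.skew (h.e_mem i) (h.even hx), hc]
  exact neg_mem (Submodule.smul_mem _ _ (Submodule.smul_mem _ _ (B.mem_layer_zero e i)))

/-- Elements of `N` scale the letters, so the Jacobi identity lets them pass through a word letter
by letter. -/
theorem mul_layer (hB : B.IsLie) (h : Triangular B N e f p) {x : A} (hx : x ∈ N) :
    ∀ m, ∀ y ∈ B.layer e m, B.mul x y ∈ B.layer e m
  | 0 => span_induction_le (by
      rintro _ ⟨i, rfl⟩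
      obtain ⟨c, hc⟩ := h.mul_e x hx i
      rw [hc]
      exact Submodule.smul_mem _ _ (B.mem_layer_zero e i))
  | m + 1 => span_induction_le (by
      rintro _ ⟨i, y, hy, rfl⟩
      obtain ⟨c, hc⟩ := h.mul_e x hx i
      rw [hB.jacobi y (h.even hx) (h.e_mem i), hc, map_smul, LinearMap.smul_apply]
      exact add_mem (Submodule.smul_mem _ _ (B.mul_mem_layer_succ e i m _ (Submodule.subset_span hy)))
        (Submodule.smul_mem _ _ (B.mul_mem_layer_succ e i m _
          (mul_layer hB h hx m y (Submodule.subset_span hy)))))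

/-- The component of degree `m`. -/
def component (B : Superalgebra k A) (N : Submodule k A) (e f : ι → A) : ℤ → Submodule k A
  | .ofNat 0 => N
  | .ofNat (m + 1) => B.layer e m
  | .negSucc m => B.layer f m

/-- Exchanging the two families reverses the grading. With `Triangular.symm` this reduces negative
degrees to positive ones. -/
theorem component_neg (B : Superalgebra k A) (N : Submodule k A) (e f : ι → A) (m : ℤ) :
    component B N e f (-m) = component B N f e m := by
  match m with
  | .ofNat 0 => rfl
  | .ofNat (m + 1) => rfl
  | .negSucc m => rfl

/-- The Jacobi identity turns [f_i, [e_j, y]] into [[f_i, e_j], y] ± [e_j, [f_i, y]], with [f_i,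
e_j] in `N`. Since `layer e m` has degree `m + 1`, the result sits in degree `m`, which is `N` for
`m = 0`. -/
theorem f_mul_layer (hB : B.IsLie) (h : Triangular B N e f p) (i : ι) :
    ∀ m : ℕ, ∀ y ∈ B.layer e m, B.mul (f i) y ∈ component B N e f m
  | 0 => span_induction_le (by
      rintro _ ⟨j, rfl⟩
      exact (h.symm hB).e_f i j)
  | m + 1 => span_induction_le (by
      rintro _ ⟨j, y, hy, rfl⟩
      rw [hB.jacobi y (h.f_mem i) (h.e_mem j)]
      refine add_mem (h.mul_layer hB ((h.symm hB).e_f i j) m y (Submodule.subset_span hy))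
        (Submodule.smul_mem _ _ ?_)
      have := f_mul_layer hB h i m y (Submodule.subset_span hy)
      -- For `m = 0` the inner bracket lies in `N`, and bracketing it with a letter falls back into
      -- the first layer; otherwise one letter is added.
      match m, this with
      | 0, this => exact h.e_mul hB this j
      | m + 1, this => exact B.mul_mem_layer_succ e j m _ this)

theorem e_mul_component (hB : B.IsLie) (h : Triangular B N e f p) (i : ι) :
    ∀ m : ℤ, ∀ y ∈ component B N e f m, B.mul (e i) y ∈ component B N e f (m + 1)
  | .ofNat 0 => fun _ hy => h.e_mul hB hy i
  | .ofNat (m + 1) => B.mul_mem_layer_succ e i m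
  | .negSucc m => by
    intro y hy
    have := (h.symm hB).f_mul_layer hB i m y hy
    rw [← component_neg] at this
    convert this using 2
    rw [Int.negSucc_eq]; ring

/-- Induction on the length of the word: the Jacobi identity, solved for [[e_i, x], y], leaves only
brackets with `e_i` and with the shorter word `x`. -/
theorem layer_mul_component (hB : B.IsLie) (h : Triangular B N e f p) :
    ∀ m : ℕ, ∀ x ∈ normedWords B e m, ∀ (a : ℤ), ∀ y ∈ component B N e f a,
      B.mul x y ∈ component B N e f (m + 1 + a)
  | 0 => by
    rintro _ ⟨i, rfl⟩ a y hy
    convert h.e_mul_component hB i a y hy using 2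
    push_cast; ring
  | m + 1 => by
    rintro _ ⟨i, x, hx, rfl⟩ a y hy
    obtain ⟨j, hj⟩ := B.exists_mem_gr_of_mem_normedWords h.e_mem m x hx
    have hJ := hB.jacobi y (h.e_mem i) hj
    rw [← sub_eq_iff_eq_add] at hJ
    rw [← hJ]
    have h1 := h.e_mul_component hB i _ _ (layer_mul_component hB h m x hx a y hy)
    have h2 := layer_mul_component hB h m x hx _ _ (h.e_mul_component hB i _ _ hy)
    refine sub_mem ?_ (Submodule.smul_mem _ _ ?_)
    · convert h1 using 2
      push_cast; ring
    · convert h2 using 2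
      push_cast; ring

/-- The span of `N` and all layers is thus closed under products, degrees adding up. Directness of
this sum is never needed. -/
theorem mul_component (hB : B.IsLie) (h : Triangular B N e f p) (a b : ℤ) (x y : A)
    (hx : x ∈ component B N e f a) (hy : y ∈ component B N e f b) :
    B.mul x y ∈ component B N e f (a + b) := by
  have key : ∀ (e f : ι → A) (_ : Triangular B N e f p) (m : ℕ) (b : ℤ) (x y : A),
      x ∈ B.layer e m → y ∈ component B N e f b →
      B.mul x y ∈ component B N e f (m + 1 + b) := by
    intro e f h m b x y hx hy
    refine span_induction_le (f := B.mul.flip y) (fun x hx => ?_) x hx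
    exact h.layer_mul_component hB m x hx b y hy
  match a, hx with
  | .ofNat 0, hx =>
    change B.mul x y ∈ component B N e f (0 + b)
    rw [zero_add]
    match b, hy with
    | .ofNat 0, hy => rw [h.comm x hx y hy]; exact zero_mem _
    | .ofNat (m + 1), hy => exact h.mul_layer hB hx m y hy
    | .negSucc m, hy => exact (h.symm hB).mul_layer hB hx m y hy
  | .ofNat (m + 1), hx => exact key e f h m b x y hx hy
  | .negSucc m, hx =>
    rw [← neg_neg b, component_neg] at hy
    have := key f e (h.symm hB) m (-b) x y hx hy
    rw [← component_neg] at this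
    convert this using 2
    rw [Int.negSucc_eq]; ring

end Triangular

end Superalgebra

/-! ### The Lie superalgebra g̃(A, τ) and recognition of its simple quotient -/

namespace Contragredient

variable {k : Type*} [Field k] {n : ℕ} {𝔥 : Type*}

/-- The universal property of the free nonassociative algebra for maps to superalgebras. -/
theorem exists_lift {A : Type*} [AddCommGroup A] [Module k A] (B : Superalgebra k A)
    (g : Gen n 𝔥 → A) : ∃ Φ : Free k n 𝔥 →ₗ[k] A, (∀ x, Φ (gen k x) = g x) ∧
      ∀ x y, Φ (x * y) = B.mul (Φ x) (Φ y) := by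
  -- The universal property of the free nonassociative algebra asks for no identities, so any
  -- bilinear product serves as the multiplication of a ring.
  let I : NonUnitalNonAssocRing A :=
    { (inferInstance : AddCommGroup A) with
      mul := fun x y => B.mul x y
      left_distrib := fun x y z => map_add (B.mul x) y z
      right_distrib := fun x y z => LinearMap.map_add₂ B.mul x y z
      zero_mul := fun x => LinearMap.map_zero₂ B.mul x
      mul_zero := fun x => map_zero (B.mul x) }
  have : IsScalarTower k A A := ⟨fun c x y => LinearMap.map_smul₂ B.mul c x y⟩
  have : SMulCommClass k A A := ⟨fun c x y => (map_smul (B.mul x) c y).symm⟩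
  let Φ := FreeNonUnitalNonAssocAlgebra.lift k g
  exact ⟨(Φ : Free k n 𝔥 →ₗ[k] A), fun x => FreeNonUnitalNonAssocAlgebra.lift_of_apply k g x,
    fun x y => map_mul Φ x y⟩

/-- Words span the free algebra. -/
theorem iSup_wordGr {G : Type*} [Add G] (w : Gen n 𝔥 → G) : ⨆ g, wordGr k w g = ⊤ := by
  rw [eq_top_iff]
  intro x _
  induction x using MonoidAlgebra.induction_linear with
  | zero => exact zero_mem _
  | add a b ha hb => exact add_mem (ha trivial) (hb trivial)
  | single u c => exact Submodule.mem_iSup_of_mem _ (single_mem_wordGr w u c)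

/-- A multiplicative linear map respecting the weights of the generators respects weights. -/
theorem map_wordGr {G A : Type*} [Add G] [AddCommGroup A] [Module k A] (w : Gen n 𝔥 → G)
    (N : G → Submodule k A) (m : A →ₗ[k] A →ₗ[k] A)
    (hm : ∀ {a b : G} {x y : A}, x ∈ N a → y ∈ N b → m x y ∈ N (a + b))
    (Φ : Free k n 𝔥 →ₗ[k] A) (hΦ : ∀ x y, Φ (x * y) = m (Φ x) (Φ y))
    (hg : ∀ x, Φ (gen k x) ∈ N (w x)) (g : G) : ∀ x ∈ wordGr k w g, Φ x ∈ N g := by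
  refine Superalgebra.span_induction_le ?_
  rintro _ ⟨u, rfl, rfl⟩
  induction u with
  | ih1 x => exact hg x
  | ih2 u v hu hv =>
    have e : (MonoidAlgebra.single (u * v) 1 : Free k n 𝔥) =
        MonoidAlgebra.single u 1 * MonoidAlgebra.single v 1 := by
      rw [MonoidAlgebra.single_mul_single, mul_one]
    have h := hm hu hv
    rw [← hΦ, ← e] at h
    exact h

variable [AddCommGroup 𝔥] [Module k 𝔥] {A : Matrix (Fin n) (Fin n) k}
  (R : Realization A 𝔥) (τ : Set (Fin n))

section Tilde

variable {R τ}

theorem mkQ_eq_zero {x : Free k n 𝔥} (hx : Rel R τ x) : (relIdeal R τ).mkQ x = 0 := by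
  rw [Submodule.mkQ_apply, Submodule.Quotient.mk_eq_zero]
  exact (freeSuper k 𝔥 τ).subset_idealSpan _ hx

theorem tilde_mul_mkQ (x y : Free k n 𝔥) :
    (tilde R τ).mul ((relIdeal R τ).mkQ x) ((relIdeal R τ).mkQ y) = (relIdeal R τ).mkQ (x * y) :=
  rfl

theorem isLie_tilde : (tilde R τ).IsLie where
  skew := by
    rintro i j _ _ ⟨x, hx, rfl⟩ ⟨y, hy, rfl⟩
    rw [eq_neg_iff_add_eq_zero, tilde_mul_mkQ, tilde_mul_mkQ, ← map_smul, ← map_add]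
    exact mkQ_eq_zero (.skew i j x y hx hy)
  self_even := by
    rintro _ ⟨x, hx, rfl⟩
    exact mkQ_eq_zero (.self_even x hx)
  jacobi := by
    rintro i j _ _ z ⟨x, hx, rfl⟩ ⟨y, hy, rfl⟩
    -- The Jacobi relators have homogeneous third argument, so an arbitrary one is split by parity.
    have key : ∀ l, ∀ z ∈ (tilde R τ).gr l,
        (tilde R τ).mul ((relIdeal R τ).mkQ x) ((tilde R τ).mul ((relIdeal R τ).mkQ y) z) =
          (tilde R τ).mul ((tilde R τ).mul ((relIdeal R τ).mkQ x) ((relIdeal R τ).mkQ y)) z +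
          sg k (i * j) • (tilde R τ).mul ((relIdeal R τ).mkQ y)
            ((tilde R τ).mul ((relIdeal R τ).mkQ x) z) := by
      rintro l _ ⟨z, hz, rfl⟩
      rw [← sub_eq_zero, ← sub_sub]
      simp only [tilde_mul_mkQ, ← map_smul, ← map_sub]
      exact mkQ_eq_zero (.jacobi i j l x y z hx hy hz)
    rw [← (tilde R τ).proj_add z]
    simp only [map_add, key 0 _ ((tilde R τ).proj_mem 0 z), key 1 _ ((tilde R τ).proj_mem 1 z),
      smul_add]
    abel
  cube_odd := by
    rintro _ ⟨x, hx, rfl⟩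
    exact mkQ_eq_zero (.cube_odd x hx)

variable (R τ)

/-- The image of a generator in `g̃(A, τ)`. -/
noncomputable def tildeGen (x : Gen n 𝔥) : Free k n 𝔥 ⧸ relIdeal R τ := (relIdeal R τ).mkQ (gen k x)

theorem tildeGen_mem (x : Gen n 𝔥) : tildeGen R τ x ∈ (tilde R τ).gr (x.parity τ) :=
  Submodule.mem_map_of_mem (gen_mem τ x)

/-- The image of `𝔥` in `g̃(A, τ)`. -/
noncomputable def tildeCartan : Submodule k (Free k n 𝔥 ⧸ relIdeal R τ) where
  -- The generators are indexed by the bare set 𝔥; it is the relators `h_add` and `h_smul` that make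
  -- this range a subspace.
  carrier := Set.range fun x : 𝔥 => tildeGen R τ (.h x)
  zero_mem' := ⟨0, by
    have h := mkQ_eq_zero (Rel.h_smul (R := R) (τ := τ) 0 0)
    rw [zero_smul, zero_smul, sub_zero] at h
    exact h⟩
  add_mem' := by
    rintro _ _ ⟨x, rfl⟩ ⟨y, rfl⟩
    have h := mkQ_eq_zero (Rel.h_add (R := R) (τ := τ) x y)
    rw [map_sub, map_sub, sub_sub, sub_eq_zero] at h
    exact ⟨x + y, h⟩
  smul_mem' := by
    rintro c _ ⟨x, rfl⟩
    have h := mkQ_eq_zero (Rel.h_smul (R := R) (τ := τ) c x)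
    rw [map_sub, map_smul, sub_eq_zero] at h
    exact ⟨c • x, h⟩

theorem triangular_tilde : (tilde R τ).Triangular (tildeCartan R τ)
    (fun i => tildeGen R τ (.e i)) (fun i => tildeGen R τ (.f i))
    (fun i => (Gen.e i : Gen n 𝔥).parity τ) where
  even := by
    rintro _ ⟨x, rfl⟩
    exact tildeGen_mem R τ (.h x)
  e_mem i := tildeGen_mem R τ (.e i)
  f_mem i := tildeGen_mem R τ (.f i)
  comm := by
    rintro _ ⟨x, rfl⟩ _ ⟨y, rfl⟩
    exact mkQ_eq_zero (.h_h x y)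
  mul_e := by
    rintro _ ⟨x, rfl⟩ i
    refine ⟨R.root i x, ?_⟩
    have h := mkQ_eq_zero (Rel.h_e (R := R) (τ := τ) x i)
    rw [map_sub, map_smul, sub_eq_zero] at h
    exact h
  mul_f := by
    rintro _ ⟨x, rfl⟩ i
    refine ⟨-R.root i x, ?_⟩
    have h := mkQ_eq_zero (Rel.h_f (R := R) (τ := τ) x i)
    rw [map_add, map_smul, ← eq_neg_iff_add_eq_zero, ← neg_smul] at h
    exact h
  e_f := by
    intro i j
    by_cases hij : i = j
    · subst hij
      have h := mkQ_eq_zero (Rel.e_f (R := R) (τ := τ) i)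
      rw [map_sub, sub_eq_zero] at h
      exact ⟨_, h.symm⟩
    · have h := mkQ_eq_zero (Rel.e_f_ne (R := R) (τ := τ) i j hij)
      rw [show (tilde R τ).mul (tildeGen R τ (.e i)) (tildeGen R τ (.f j)) = 0 from h]
      exact zero_mem _

/-- The components multiply correctly and contain the generators, so a word of degree `m`, however
bracketed, lies in the component `m`. In degree 0 this says that only the image of 𝔥 is left. -/
theorem tildeDegree_le (m : ℤ) : tildeDegree R τ m ≤ Superalgebra.Triangular.component (tilde R τ)
    (tildeCartan R τ) (fun i => tildeGen R τ (.e i)) (fun i => tildeGen R τ (.f i)) m := by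
  rintro _ ⟨x, hx, rfl⟩
  refine map_wordGr Gen.degree _ (tilde R τ).mul ?_ (relIdeal R τ).mkQ
    (fun _ _ => rfl) ?_ m x hx
  · intro a b x y hx hy
    exact (triangular_tilde R τ).mul_component isLie_tilde a b x y hx hy
  · rintro (x | i | i)
    · exact ⟨x, rfl⟩
    · exact (tilde R τ).mem_layer_zero (fun i => tildeGen R τ (.e i)) i
    · exact (tilde R τ).mem_layer_zero (fun i => tildeGen R τ (.f i)) i

theorem iSup_tildeDegree : ⨆ m, tildeDegree R τ m = ⊤ := by
  simp only [tildeDegree, ← Submodule.map_iSup, iSup_wordGr, Submodule.map_top, Submodule.range_mkQ]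

end Tilde

/-- A superalgebra with a family of elements satisfying the relations of `g̃(A, τ)` and generating
it, together with projections onto the components of a compatible `ℤ`-grading. -/
structure ChevalleySystem {L : Type*} [AddCommGroup L] [Module k L] (B : Superalgebra k L) where
  e : Fin n → L
  f : Fin n → L
  h : 𝔥 →ₗ[k] L
  e_mem : ∀ i, e i ∈ B.gr ((Gen.e i : Gen n 𝔥).parity τ)
  f_mem : ∀ i, f i ∈ B.gr ((Gen.f i : Gen n 𝔥).parity τ)
  h_mem : ∀ x, h x ∈ B.gr 0
  e_f : ∀ i, B.mul (e i) (f i) = h (R.coroot i)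
  e_f_ne : ∀ i j, i ≠ j → B.mul (e i) (f j) = 0
  h_h : ∀ x y, B.mul (h x) (h y) = 0
  h_e : ∀ x i, B.mul (h x) (e i) = R.root i x • e i
  h_f : ∀ x i, B.mul (h x) (f i) = -(R.root i x • f i)
  h_injective : Function.Injective h
  h_ne_zero : ∃ x, h x ≠ 0
  generates : ∀ N : Submodule k L, (∀ x ∈ N, ∀ y ∈ N, B.mul x y ∈ N) → (∀ i, e i ∈ N) →
    (∀ i, f i ∈ N) → N = ⊤
  deg : ℤ → Submodule k L
  deg_h : ∀ x, h x ∈ deg 0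
  deg_e : ∀ i, e i ∈ deg 1
  deg_f : ∀ i, f i ∈ deg (-1)
  deg_e_mul : ∀ i m, ∀ x ∈ deg m, B.mul (e i) x ∈ deg (m + 1)
  deg_f_mul : ∀ i m, ∀ x ∈ deg m, B.mul (f i) x ∈ deg (m - 1)
  degProj : ℤ → L →ₗ[k] L
  degProj_apply : ∀ m m', ∀ x ∈ deg m, degProj m' x = if m' = m then x else 0

namespace ChevalleySystem

variable {R τ} {L : Type*} [AddCommGroup L] [Module k L] {B : Superalgebra k L}

/-- The kernel of a multiplicative map is an ideal, and each relator goes to an axiom of `IsLie` or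
to a relation of the system. -/
theorem relIdeal_le (S : ChevalleySystem R τ B) (hB : B.IsLie) (Φ : Free k n 𝔥 →ₗ[k] L)
    (hh : ∀ x, Φ (gen k (.h x)) = S.h x) (he : ∀ i, Φ (gen k (.e i)) = S.e i)
    (hf : ∀ i, Φ (gen k (.f i)) = S.f i) (hΦ : ∀ x y, Φ (x * y) = B.mul (Φ x) (Φ y))
    (hgr : ∀ i, ∀ x ∈ (freeSuper k 𝔥 τ).gr i, Φ x ∈ B.gr i) :
    relIdeal R τ ≤ LinearMap.ker Φ := by
  refine (freeSuper k 𝔥 τ).idealSpan_le (I := LinearMap.ker Φ) ?_ ?_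
  · intro x hx y
    have hx' : Φ x = 0 := hx
    constructor
    · change Φ (x * y) = 0
      rw [hΦ, hx', map_zero, LinearMap.zero_apply]
    · change Φ (y * x) = 0
      rw [hΦ, hx', map_zero]
  · intro x hx
    change Φ x = 0
    cases hx with
    | skew i j x y hx hy =>
      rw [map_add, map_smul, hΦ, hΦ, hB.skew (hgr _ _ hx) (hgr _ _ hy), neg_add_cancel]
    | self_even x hx => rw [hΦ, hB.self_even _ (hgr _ _ hx)]
    | jacobi i j l x y z hx hy hz =>
      simp only [map_sub, map_smul, hΦ]
      rw [hB.jacobi _ (hgr _ _ hx) (hgr _ _ hy)]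
      abel
    | cube_odd x hx => rw [hΦ, hΦ, hB.cube_odd _ (hgr _ _ hx)]
    | h_add x y => simp only [map_sub, hh, map_add]; abel
    | h_smul c x => simp only [map_sub, hh, map_smul, sub_self]
    | e_f i => rw [map_sub, hΦ, he, hf, hh, S.e_f, sub_self]
    | e_f_ne i j hij => rw [hΦ, he, hf, S.e_f_ne i j hij]
    | h_h x y => rw [hΦ, hh, hh, S.h_h]
    | h_e x i => rw [map_sub, map_smul, hΦ, hh, he, S.h_e, sub_self]
    | h_f x i => rw [map_add, map_smul, hΦ, hh, hf, S.h_f, neg_add_cancel]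

/-- The canonical map from `g̃(A, τ)`. -/
theorem exists_hom (S : ChevalleySystem R τ B) (hB : B.IsLie) :
    ∃ Ψ : (Free k n 𝔥 ⧸ relIdeal R τ) →ₗ[k] L, (∀ x, Ψ (tildeGen R τ (.h x)) = S.h x) ∧
      (∀ i, Ψ (tildeGen R τ (.e i)) = S.e i) ∧ (∀ i, Ψ (tildeGen R τ (.f i)) = S.f i) ∧
      (∀ x y, Ψ ((tilde R τ).mul x y) = B.mul (Ψ x) (Ψ y)) ∧
      (∀ i, ∀ x ∈ (tilde R τ).gr i, Ψ x ∈ B.gr i) ∧ Function.Surjective Ψ := by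
  obtain ⟨Φ, hg, hΦ⟩ := exists_lift B (Gen.rec S.h S.e S.f : Gen n 𝔥 → L)
  have hgr : ∀ i, ∀ x ∈ (freeSuper k 𝔥 τ).gr i, Φ x ∈ B.gr i := by
    refine map_wordGr (Gen.parity τ) B.gr B.mul (fun hx hy => B.mul_mem hx hy) Φ hΦ ?_
    intro x
    rw [hg]
    cases x with
    | h x => exact S.h_mem x
    | e i => exact S.e_mem i
    | f i => exact S.f_mem i
  have hle := S.relIdeal_le hB Φ (fun x => hg (.h x)) (fun i => hg (.e i)) (fun i => hg (.f i))
    hΦ hgr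
  refine ⟨(relIdeal R τ).liftQ Φ hle, fun x => hg (.h x), fun i => hg (.e i), fun i => hg (.f i),
    ?_, ?_, ?_⟩
  · intro x y
    obtain ⟨x, rfl⟩ := (relIdeal R τ).mkQ_surjective x
    obtain ⟨y, rfl⟩ := (relIdeal R τ).mkQ_surjective y
    exact hΦ x y
  · rintro i _ ⟨x, hx, rfl⟩
    exact hgr i x hx
  · rw [← LinearMap.range_eq_top, Submodule.range_liftQ]
    refine S.generates _ ?_ (fun i => ⟨_, hg (.e i)⟩) (fun i => ⟨_, hg (.f i)⟩)
    rintro _ ⟨x, rfl⟩ _ ⟨y, rfl⟩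
    exact ⟨x * y, hΦ x y⟩

/-- Left normed words suffice by `tildeDegree_le`; this is why a Chevalley system only needs `deg`
to be compatible with left multiplication by the `e_i` and `f_i`. -/
theorem map_component (S : ChevalleySystem R τ B) {Ψ : (Free k n 𝔥 ⧸ relIdeal R τ) →ₗ[k] L}
    (hh : ∀ x, Ψ (tildeGen R τ (.h x)) = S.h x)
    (he : ∀ i, Ψ (tildeGen R τ (.e i)) = S.e i) (hf : ∀ i, Ψ (tildeGen R τ (.f i)) = S.f i)
    (hΨ : ∀ x y, Ψ ((tilde R τ).mul x y) = B.mul (Ψ x) (Ψ y)) (m : ℤ) :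
    ∀ x ∈ tildeDegree R τ m, Ψ x ∈ S.deg m := by
  have hE : ∀ m : ℕ, ∀ x ∈ (tilde R τ).normedWords (fun i => tildeGen R τ (.e i)) m,
      Ψ x ∈ S.deg (m + 1) := by
    intro m
    induction m with
    | zero =>
      rintro _ ⟨i, rfl⟩
      rw [he]
      exact S.deg_e i
    | succ m ih =>
      rintro _ ⟨i, y, hy, rfl⟩
      rw [hΨ, he]
      exact S.deg_e_mul i _ _ (ih y hy)
  -- Words of length `m + 1` in the `f_i` have degree `-(m + 1)`.
  have hF : ∀ m : ℕ, ∀ x ∈ (tilde R τ).normedWords (fun i => tildeGen R τ (.f i)) m,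
      Ψ x ∈ S.deg (-m - 1) := by
    intro m
    induction m with
    | zero =>
      rintro _ ⟨i, rfl⟩
      rw [hf]
      simpa using S.deg_f i
    | succ m ih =>
      rintro _ ⟨i, y, hy, rfl⟩
      rw [hΨ, hf]
      convert S.deg_f_mul i _ _ (ih y hy) using 2
      push_cast; ring
  intro x hx
  have hx := tildeDegree_le R τ m hx
  match m, hx with
  | .ofNat 0, hx =>
    obtain ⟨y, rfl⟩ := hx
    change Ψ (tildeGen R τ (.h y)) ∈ _
    rw [hh]
    exact S.deg_h y
  | .ofNat (m + 1), hx => exact Superalgebra.span_induction_le (hE m) x hx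
  | .negSucc m, hx =>
    have := Superalgebra.span_induction_le (hF m) x hx
    rw [Int.negSucc_eq]
    convert this using 2
    ring

/-- Taking homogeneous components commutes with Ψ. This serves both inclusions between the kernel of
Ψ and the maximal ideal. -/
theorem degProj_sum (S : ChevalleySystem R τ B) {Ψ : (Free k n 𝔥 ⧸ relIdeal R τ) →ₗ[k] L}
    (hΨ : ∀ m, ∀ x ∈ tildeDegree R τ m, Ψ x ∈ S.deg m) (y : ℤ →₀ (Free k n 𝔥 ⧸ relIdeal R τ))
    (hy : ∀ m, y m ∈ tildeDegree R τ m) (m : ℤ) :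
    S.degProj m (Ψ (y.sum fun _ x => x)) = Ψ (y m) := by
  rw [Finsupp.sum, map_sum, map_sum, Finset.sum_eq_single m]
  · rw [S.degProj_apply m m _ (hΨ m _ (hy m)), if_pos rfl]
  · intro j _ hj
    rw [S.degProj_apply j m _ (hΨ j _ (hy j)), if_neg hj.symm]
  · intro hm
    rw [Finsupp.notMem_support_iff.mp hm, map_zero, map_zero]

/-- A simple Lie superalgebra with a Chevalley system is contragredient. -/
theorem nonempty_iso (S : ChevalleySystem R τ B) (hB : B.IsLie) (hs : B.IsSimple) :
    Nonempty (B.Iso (contragredient R τ)) := by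
  obtain ⟨Ψ, hh, he, hf, hΨ, hgr, hsurj⟩ := S.exists_hom hB
  have hdeg := S.map_component hh he hf hΨ
  have hker : maxIdeal R τ = LinearMap.ker Ψ := by
    apply le_antisymm
    · refine sSup_le fun I hI => ?_
      obtain ⟨h1, h2, h3, h4⟩ := hI
      -- The image of `I` is a graded ideal of a simple superalgebra, hence zero or everything.
      rcases hs.2 _ (h1.map Ψ hΨ hsurj) (Superalgebra.isHomogeneous_map Ψ hgr h2) with h | h
      · intro x hx
        have hx' := Submodule.mem_map_of_mem (f := Ψ) hx
        rw [h] at hx'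
        exact hx'
      -- If the image were everything, a nonzero `S.h x` would be Ψ of some element of `I`. The
      -- degree zero component of that element lies in `I` and in the image of 𝔥, so it vanishes, a
      -- contradiction.
      · exfalso
        obtain ⟨x, hx⟩ := S.h_ne_zero
        have hx' : S.h x ∈ I.map Ψ := h ▸ trivial
        obtain ⟨y, hy, hyx⟩ := hx'
        obtain ⟨y, hy', rfl⟩ := (Submodule.mem_iSup_iff_exists_finsupp _ _).mp (h3 hy)
        have e := S.degProj_sum hdeg y (fun m => (hy' m).2) 0
        rw [hyx, S.degProj_apply 0 0 _ (S.deg_h x), if_pos rfl] at e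
        have hc := tildeDegree_le R τ 0 (hy' 0).2
        obtain ⟨z, hz⟩ := hc
        have hz0 : y 0 = 0 := by
          rw [← hz]
          refine h4 z ?_
          have := (hy' 0).1
          rw [← hz] at this
          exact this
        rw [hz0, map_zero] at e
        exact hx e
    -- The kernel is itself one of the ideals in question: it is graded by parity and by degree
    -- because Ψ respects both, and it meets 𝔥 trivially because `S.h` is injective.
    · refine le_sSup ⟨?_, ?_, ?_, ?_⟩
      · intro x hx y
        have hx' : Ψ x = 0 := hx
        constructor
        · rw [LinearMap.mem_ker, hΨ, hx', map_zero, LinearMap.zero_apply]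
        · rw [LinearMap.mem_ker, hΨ, hx', map_zero]
      · intro x hx
        have hx' : Ψ x = 0 := hx
        rw [← (tilde R τ).proj_add x, map_add] at hx'
        have h0 := hgr 0 _ ((tilde R τ).proj_mem 0 x)
        have h1 := hgr 1 _ ((tilde R τ).proj_mem 1 x)
        have e1 : Ψ ((tilde R τ).proj 1 x) = 0 := by
          refine B.eq_zero_of_mem ?_ h1
          rw [eq_neg_of_add_eq_zero_right hx']
          exact neg_mem h0
        have e0 : Ψ ((tilde R τ).proj 0 x) = 0 := by
          rw [e1, add_zero] at hx'
          exact hx'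
        rw [← (tilde R τ).proj_add x]
        exact add_mem (Submodule.mem_iSup_of_mem 0 ⟨e0, (tilde R τ).proj_mem 0 x⟩)
          (Submodule.mem_iSup_of_mem 1 ⟨e1, (tilde R τ).proj_mem 1 x⟩)
      · intro x hx
        have hx' : Ψ x = 0 := hx
        have htop : x ∈ ⨆ m, tildeDegree R τ m := by
          rw [iSup_tildeDegree]; trivial
        obtain ⟨y, hy, rfl⟩ := (Submodule.mem_iSup_iff_exists_finsupp _ _).mp htop
        refine sum_mem fun m _ => Submodule.mem_iSup_of_mem m ⟨?_, hy m⟩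
        have e := S.degProj_sum hdeg y hy m
        rw [hx', map_zero] at e
        exact e.symm
      · intro x hx
        have hx' : Ψ (tildeGen R τ (.h x)) = 0 := hx
        rw [hh] at hx'
        have : x = 0 := S.h_injective (by rw [hx', map_zero])
        subst this
        have h := mkQ_eq_zero (Rel.h_smul (R := R) (τ := τ) 0 0)
        rwa [zero_smul, zero_smul, sub_zero] at h
  have hquot : ∀ x, ((Submodule.quotEquivOfEq _ _ hker).trans
      (Ψ.quotKerEquivOfSurjective hsurj)).symm (Ψ x) = (maxIdeal R τ).mkQ x := by
    intro x
    rw [LinearEquiv.symm_apply_eq]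
    rfl
  refine ⟨⟨((Submodule.quotEquivOfEq _ _ hker).trans
      (Ψ.quotKerEquivOfSurjective hsurj)).symm, ?_, ?_⟩⟩
  · intro i x hx
    obtain ⟨y, rfl⟩ := hsurj x
    -- A homogeneous element has a homogeneous preimage, namely the parity `i` part of any preimage.
    have e : Ψ ((tilde R τ).proj i y) = Ψ y := by
      have h0 := hgr 0 _ ((tilde R τ).proj_mem 0 y)
      have h1 := hgr 1 _ ((tilde R τ).proj_mem 1 y)
      have h2 := congrArg (fun z => B.proj i (Ψ z)) ((tilde R τ).proj_add y)
      simp only [map_add, B.proj_of_mem h0, B.proj_of_mem h1, B.proj_of_mem hx] at h2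
      rcases zmod2_cases i with rfl | rfl <;> simpa using h2
    rw [← e, hquot]
    exact Submodule.mem_map_of_mem ((tilde R τ).proj_mem i y)
  · intro x y
    obtain ⟨x, rfl⟩ := hsurj x
    obtain ⟨y, rfl⟩ := hsurj y
    rw [← hΨ, hquot, hquot, hquot]
    rfl

end ChevalleySystem

end Contragredient

/-! ### Structure constants of sp₆ ⊕ V(ω₃) -/

namespace SpWedgeModel

variable {k : Type*} [Field k]

/-- The commutator of `sp₆` in coordinates. -/
def evenBracket (x y : Fin 21 → k) : Fin 21 → k
  -- Coordinates 0–2, 3–5, 6–8 are the diagonal, upper and lower entries of sl(V₀), sl(V₁), sl(V₂).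
  -- Coordinates 9–12, 13–16, 17–20 are 2 × 2 matrices in Hom(V₁, V₂), Hom(V₂, V₀), Hom(V₀, V₁).
  | 0 => x 1 * y 2 - x 2 * y 1 - x 13 * y 16 + x 14 * y 15 - x 15 * y 14 + x 16 * y 13
      + x 17 * y 20 + x 18 * y 19 - x 19 * y 18 - x 20 * y 17
  | 1 => 2 * x 0 * y 1 - 2 * x 1 * y 0 + 2 * x 13 * y 14 - 2 * x 14 * y 13 + 2 * x 18 * y 20
      - 2 * x 20 * y 18
  | 2 => -(2 * x 0 * y 2) + 2 * x 2 * y 0 - 2 * x 15 * y 16 + 2 * x 16 * y 15 - 2 * x 17 * y 19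
      + 2 * x 19 * y 17
  | 3 => x 4 * y 5 - x 5 * y 4 + x 9 * y 12 + x 10 * y 11 - x 11 * y 10 - x 12 * y 9
      - x 17 * y 20 + x 18 * y 19 - x 19 * y 18 + x 20 * y 17
  | 4 => 2 * x 3 * y 4 - 2 * x 4 * y 3 + 2 * x 10 * y 12 - 2 * x 12 * y 10 + 2 * x 17 * y 18
      - 2 * x 18 * y 17
  | 5 => -(2 * x 3 * y 5) + 2 * x 5 * y 3 - 2 * x 9 * y 11 + 2 * x 11 * y 9 - 2 * x 19 * y 20
      + 2 * x 20 * y 19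
  | 6 => x 7 * y 8 - x 8 * y 7 - x 9 * y 12 + x 10 * y 11 - x 11 * y 10 + x 12 * y 9
      + x 13 * y 16 + x 14 * y 15 - x 15 * y 14 - x 16 * y 13
  | 7 => 2 * x 6 * y 7 - 2 * x 7 * y 6 + 2 * x 9 * y 10 - 2 * x 10 * y 9 + 2 * x 14 * y 16
      - 2 * x 16 * y 14
  | 8 => -(2 * x 6 * y 8) + 2 * x 8 * y 6 - 2 * x 11 * y 12 + 2 * x 12 * y 11 - 2 * x 13 * y 15
      + 2 * x 15 * y 13
  | 9 => -(x 3 * y 9) - x 5 * y 10 + x 6 * y 9 + x 7 * y 11 + x 9 * y 3 - x 9 * y 6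
      + x 10 * y 5 - x 11 * y 7 + x 14 * y 19 + x 16 * y 20 - x 19 * y 14 - x 20 * y 16
  | 10 => x 3 * y 10 - x 4 * y 9 + x 6 * y 10 + x 7 * y 12 + x 9 * y 4 - x 10 * y 3
      - x 10 * y 6 - x 12 * y 7 - x 14 * y 17 - x 16 * y 18 + x 17 * y 14 + x 18 * y 16
  | 11 => -(x 3 * y 11) - x 5 * y 12 - x 6 * y 11 + x 8 * y 9 - x 9 * y 8 + x 11 * y 3
      + x 11 * y 6 + x 12 * y 5 - x 13 * y 19 - x 15 * y 20 + x 19 * y 13 + x 20 * y 15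
  | 12 => x 3 * y 12 - x 4 * y 11 - x 6 * y 12 + x 8 * y 10 - x 10 * y 8 + x 11 * y 4
      - x 12 * y 3 + x 12 * y 6 + x 13 * y 17 + x 15 * y 18 - x 17 * y 13 - x 18 * y 15
  | 13 => x 0 * y 13 + x 1 * y 15 - x 6 * y 13 - x 8 * y 14 - x 11 * y 18 - x 12 * y 20
      - x 13 * y 0 + x 13 * y 6 + x 14 * y 8 - x 15 * y 1 + x 18 * y 11 + x 20 * y 12
  | 14 => x 0 * y 14 + x 1 * y 16 + x 6 * y 14 - x 7 * y 13 + x 9 * y 18 + x 10 * y 20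
      + x 13 * y 7 - x 14 * y 0 - x 14 * y 6 - x 16 * y 1 - x 18 * y 9 - x 20 * y 10
  | 15 => -(x 0 * y 15) + x 2 * y 13 - x 6 * y 15 - x 8 * y 16 + x 11 * y 17 + x 12 * y 19
      - x 13 * y 2 + x 15 * y 0 + x 15 * y 6 + x 16 * y 8 - x 17 * y 11 - x 19 * y 12
  | 16 => -(x 0 * y 16) + x 2 * y 14 + x 6 * y 16 - x 7 * y 15 - x 9 * y 17 - x 10 * y 19
      - x 14 * y 2 + x 15 * y 7 + x 16 * y 0 - x 16 * y 6 + x 17 * y 9 + x 19 * y 10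
  | 17 => -(x 0 * y 17) - x 2 * y 18 + x 3 * y 17 + x 4 * y 19 + x 10 * y 15 + x 12 * y 16
      - x 15 * y 10 - x 16 * y 12 + x 17 * y 0 - x 17 * y 3 + x 18 * y 2 - x 19 * y 4
  | 18 => x 0 * y 18 - x 1 * y 17 + x 3 * y 18 + x 4 * y 20 - x 10 * y 13 - x 12 * y 14
      + x 13 * y 10 + x 14 * y 12 + x 17 * y 1 - x 18 * y 0 - x 18 * y 3 - x 20 * y 4
  | 19 => -(x 0 * y 19) - x 2 * y 20 - x 3 * y 19 + x 5 * y 17 - x 9 * y 15 - x 11 * y 16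
      + x 15 * y 9 + x 16 * y 11 - x 17 * y 5 + x 19 * y 0 + x 19 * y 3 + x 20 * y 2
  | 20 => x 0 * y 20 - x 1 * y 19 - x 3 * y 20 + x 5 * y 18 + x 9 * y 13 + x 11 * y 14
      - x 13 * y 9 - x 14 * y 11 - x 18 * y 5 + x 19 * y 1 - x 20 * y 0 + x 20 * y 3
  | ⟨_ + 21, h⟩ => absurd h (by omega)

/-- The action of `sp₆` on the fourteen dimensional module in coordinates. -/
def action (x : Fin 21 → k) (v : Fin 14 → k) : Fin 14 → k
  -- Coordinates 0–7 are those of V₀ ⊗ V₁ ⊗ V₂ in binary order, the first factor varying slowest;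
  -- 8–9, 10–11, 12–13 are V₀, V₁, V₂.
  | 0 => x 0 * v 0 + x 1 * v 4 + x 3 * v 0 + x 4 * v 2 + x 6 * v 0 + x 7 * v 1 - 2 * x 10 * v 8
      - 2 * x 14 * v 10 - 2 * x 18 * v 12
  | 1 => x 0 * v 1 + x 1 * v 5 + x 3 * v 1 + x 4 * v 3 - x 6 * v 1 + x 8 * v 0 - 2 * x 12 * v 8
      + 2 * x 13 * v 10 - 2 * x 18 * v 13
  | 2 => x 0 * v 2 + x 1 * v 6 - x 3 * v 2 + x 5 * v 0 + x 6 * v 2 + x 7 * v 3 + 2 * x 9 * v 8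
      - 2 * x 14 * v 11 - 2 * x 20 * v 12
  | 3 => x 0 * v 3 + x 1 * v 7 - x 3 * v 3 + x 5 * v 1 - x 6 * v 3 + x 8 * v 2 + 2 * x 11 * v 8
      + 2 * x 13 * v 11 - 2 * x 20 * v 13
  | 4 => -(x 0 * v 4) + x 2 * v 0 + x 3 * v 4 + x 4 * v 6 + x 6 * v 4 + x 7 * v 5
      - 2 * x 10 * v 9 - 2 * x 16 * v 10 + 2 * x 17 * v 12
  | 5 => -(x 0 * v 5) + x 2 * v 1 + x 3 * v 5 + x 4 * v 7 - x 6 * v 5 + x 8 * v 4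
      - 2 * x 12 * v 9 + 2 * x 15 * v 10 + 2 * x 17 * v 13
  | 6 => -(x 0 * v 6) + x 2 * v 2 - x 3 * v 6 + x 5 * v 4 + x 6 * v 6 + x 7 * v 7
      + 2 * x 9 * v 9 - 2 * x 16 * v 11 + 2 * x 19 * v 12
  | 7 => -(x 0 * v 7) + x 2 * v 3 - x 3 * v 7 + x 5 * v 5 - x 6 * v 7 + x 8 * v 6
      + 2 * x 11 * v 9 + 2 * x 15 * v 11 + 2 * x 19 * v 13
  | 8 => x 0 * v 8 + x 1 * v 9 + x 9 * v 1 + x 10 * v 3 - x 11 * v 0 - x 12 * v 2 - x 13 * v 12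
      - x 14 * v 13 - x 18 * v 11 + x 20 * v 10
  | 9 => -(x 0 * v 9) + x 2 * v 8 + x 9 * v 5 + x 10 * v 7 - x 11 * v 4 - x 12 * v 6
      - x 15 * v 12 - x 16 * v 13 + x 17 * v 11 - x 19 * v 10
  | 10 => x 3 * v 10 + x 4 * v 11 - x 10 * v 13 + x 12 * v 12 + x 13 * v 4 + x 14 * v 5
      - x 15 * v 0 - x 16 * v 1 - x 17 * v 8 - x 18 * v 9
  | 11 => -(x 3 * v 11) + x 5 * v 10 + x 9 * v 13 - x 11 * v 12 + x 13 * v 6 + x 14 * v 7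
      - x 15 * v 2 - x 16 * v 3 - x 19 * v 8 - x 20 * v 9
  | 12 => x 6 * v 12 + x 7 * v 13 - x 9 * v 10 - x 10 * v 11 - x 14 * v 9 + x 16 * v 8
      + x 17 * v 2 + x 18 * v 6 - x 19 * v 0 - x 20 * v 4
  | 13 => -(x 6 * v 13) + x 8 * v 12 - x 11 * v 10 - x 12 * v 11 + x 13 * v 9 - x 15 * v 8
      + x 17 * v 3 + x 18 * v 7 - x 19 * v 1 - x 20 * v 5

/-- The equivariant symmetric map from the fourteen dimensional module to `sp₆` in coordinates. -/
def oddBracket (v w : Fin 14 → k) : Fin 21 → k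
  -- The scale of this map is the one that makes it agree with the bracket of `g(S₁, S_{4,2})`.
  | 0 => v 0 * w 7 - v 1 * w 6 - v 2 * w 5 + v 3 * w 4 + v 4 * w 3 - v 5 * w 2 - v 6 * w 1
      + v 7 * w 0 + 2 * v 8 * w 9 + 2 * v 9 * w 8
  | 1 => -(2 * v 0 * w 3) + 2 * v 1 * w 2 + 2 * v 2 * w 1 - 2 * v 3 * w 0 - 4 * v 8 * w 8
  | 2 => 2 * v 4 * w 7 - 2 * v 5 * w 6 - 2 * v 6 * w 5 + 2 * v 7 * w 4 + 4 * v 9 * w 9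
  | 3 => v 0 * w 7 - v 1 * w 6 + v 2 * w 5 - v 3 * w 4 - v 4 * w 3 + v 5 * w 2 - v 6 * w 1
      + v 7 * w 0 + 2 * v 10 * w 11 + 2 * v 11 * w 10
  | 4 => -(2 * v 0 * w 5) + 2 * v 1 * w 4 + 2 * v 4 * w 1 - 2 * v 5 * w 0 - 4 * v 10 * w 10
  | 5 => 2 * v 2 * w 7 - 2 * v 3 * w 6 - 2 * v 6 * w 3 + 2 * v 7 * w 2 + 4 * v 11 * w 11
  | 6 => v 0 * w 7 + v 1 * w 6 - v 2 * w 5 - v 3 * w 4 - v 4 * w 3 - v 5 * w 2 + v 6 * w 1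
      + v 7 * w 0 + 2 * v 12 * w 13 + 2 * v 13 * w 12
  | 7 => -(2 * v 0 * w 6) + 2 * v 2 * w 4 + 2 * v 4 * w 2 - 2 * v 6 * w 0 - 4 * v 12 * w 12
  | 8 => 2 * v 1 * w 7 - 2 * v 3 * w 5 - 2 * v 5 * w 3 + 2 * v 7 * w 1 + 4 * v 13 * w 13
  | 9 => 2 * v 2 * w 9 - 2 * v 6 * w 8 - 2 * v 8 * w 6 + 2 * v 9 * w 2 - 2 * v 11 * w 12
      - 2 * v 12 * w 11
  | 10 => -(2 * v 0 * w 9) + 2 * v 4 * w 8 + 2 * v 8 * w 4 - 2 * v 9 * w 0 + 2 * v 10 * w 12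
      + 2 * v 12 * w 10
  | 11 => 2 * v 3 * w 9 - 2 * v 7 * w 8 - 2 * v 8 * w 7 + 2 * v 9 * w 3 - 2 * v 11 * w 13
      - 2 * v 13 * w 11
  | 12 => -(2 * v 1 * w 9) + 2 * v 5 * w 8 + 2 * v 8 * w 5 - 2 * v 9 * w 1 + 2 * v 10 * w 13
      + 2 * v 13 * w 10
  | 13 => 2 * v 1 * w 11 - 2 * v 3 * w 10 - 2 * v 8 * w 13 - 2 * v 10 * w 3 + 2 * v 11 * w 1
      - 2 * v 13 * w 8
  | 14 => -(2 * v 0 * w 11) + 2 * v 2 * w 10 + 2 * v 8 * w 12 + 2 * v 10 * w 2 - 2 * v 11 * w 0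
      + 2 * v 12 * w 8
  | 15 => 2 * v 5 * w 11 - 2 * v 7 * w 10 - 2 * v 9 * w 13 - 2 * v 10 * w 7 + 2 * v 11 * w 5
      - 2 * v 13 * w 9
  | 16 => -(2 * v 4 * w 11) + 2 * v 6 * w 10 + 2 * v 9 * w 12 + 2 * v 10 * w 6 - 2 * v 11 * w 4
      + 2 * v 12 * w 9
  | 17 => 2 * v 4 * w 13 - 2 * v 5 * w 12 - 2 * v 9 * w 10 - 2 * v 10 * w 9 - 2 * v 12 * w 5
      + 2 * v 13 * w 4
  | 18 => -(2 * v 0 * w 13) + 2 * v 1 * w 12 + 2 * v 8 * w 10 + 2 * v 10 * w 8 + 2 * v 12 * w 1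
      - 2 * v 13 * w 0
  | 19 => 2 * v 6 * w 13 - 2 * v 7 * w 12 - 2 * v 9 * w 11 - 2 * v 11 * w 9 - 2 * v 12 * w 7
      + 2 * v 13 * w 6
  | 20 => -(2 * v 2 * w 13) + 2 * v 3 * w 12 + 2 * v 8 * w 11 + 2 * v 11 * w 8 + 2 * v 12 * w 3
      - 2 * v 13 * w 2
  | ⟨_ + 21, h⟩ => absurd h (by omega)

end SpWedgeModel

/-! ### Coordinates on the matrix algebra sp₆ -/

namespace SpWedgeModel

variable {k : Type*} [Field k]

/-- The matrix of `sp₆` with given coordinates. -/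
def toMatrix (x : Fin 21 → k) : Matrix (Fin 3 ⊕ Fin 3) (Fin 3 ⊕ Fin 3) k
  -- The rows and columns `inl i`, `inr i` span V_i. The signs in the blocks between different V_i
  -- are chosen so that the commutator becomes `evenBracket`.
  | .inl 0, .inl 0 => x 0
  | .inl 0, .inl 1 => -x 20
  | .inl 0, .inl 2 => x 13
  | .inl 0, .inr 0 => x 1
  | .inl 0, .inr 1 => x 18
  | .inl 0, .inr 2 => x 14
  | .inl 1, .inl 0 => x 17
  | .inl 1, .inl 1 => x 3
  | .inl 1, .inl 2 => -x 12
  | .inl 1, .inr 0 => x 18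
  | .inl 1, .inr 1 => x 4
  | .inl 1, .inr 2 => x 10
  | .inl 2, .inl 0 => -x 16
  | .inl 2, .inl 1 => x 9
  | .inl 2, .inl 2 => x 6
  | .inl 2, .inr 0 => x 14
  | .inl 2, .inr 1 => x 10
  | .inl 2, .inr 2 => x 7
  | .inr 0, .inl 0 => x 2
  | .inr 0, .inl 1 => x 19
  | .inr 0, .inl 2 => x 15
  | .inr 0, .inr 0 => -x 0
  | .inr 0, .inr 1 => -x 17
  | .inr 0, .inr 2 => x 16
  | .inr 1, .inl 0 => x 19
  | .inr 1, .inl 1 => x 5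
  | .inr 1, .inl 2 => x 11
  | .inr 1, .inr 0 => x 20
  | .inr 1, .inr 1 => -x 3
  | .inr 1, .inr 2 => -x 9
  | .inr 2, .inl 0 => x 15
  | .inr 2, .inl 1 => x 11
  | .inr 2, .inl 2 => x 8
  | .inr 2, .inr 0 => -x 13
  | .inr 2, .inr 1 => x 12
  | .inr 2, .inr 2 => -x 6

/-- The coordinates of a matrix of `sp₆`. -/
def ofMatrix (X : Matrix (Fin 3 ⊕ Fin 3) (Fin 3 ⊕ Fin 3) k) : Fin 21 → k
  | 0 => X (.inl 0) (.inl 0)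
  | 1 => X (.inl 0) (.inr 0)
  | 2 => X (.inr 0) (.inl 0)
  | 3 => X (.inl 1) (.inl 1)
  | 4 => X (.inl 1) (.inr 1)
  | 5 => X (.inr 1) (.inl 1)
  | 6 => X (.inl 2) (.inl 2)
  | 7 => X (.inl 2) (.inr 2)
  | 8 => X (.inr 2) (.inl 2)
  | 9 => X (.inl 2) (.inl 1)
  | 10 => X (.inl 1) (.inr 2)
  | 11 => X (.inr 1) (.inl 2)
  | 12 => X (.inr 2) (.inr 1)
  | 13 => X (.inl 0) (.inl 2)
  | 14 => X (.inl 0) (.inr 2)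
  | 15 => X (.inr 0) (.inl 2)
  | 16 => X (.inr 0) (.inr 2)
  | 17 => X (.inl 1) (.inl 0)
  | 18 => X (.inl 0) (.inr 1)
  | 19 => X (.inr 0) (.inl 1)
  | 20 => X (.inr 1) (.inr 0)
  | ⟨_ + 21, h⟩ => absurd h (by omega)

/-- This is Xᵀ J = -J X read block by block; these symmetries are why 21 entries determine the
matrix. -/
theorem mem_sp6_iff {X : Matrix (Fin 3 ⊕ Fin 3) (Fin 3 ⊕ Fin 3) k} : X ∈ sp6 k ↔
    (∀ i j, X (.inr i) (.inl j) = X (.inr j) (.inl i)) ∧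
    (∀ i j, X (.inl i) (.inr j) = X (.inl j) (.inr i)) ∧
    ∀ i j, X (.inr i) (.inr j) = -X (.inl j) (.inl i) := by
  have h : X ∈ sp6 k ↔ X.transpose * Matrix.J (Fin 3) k = Matrix.J (Fin 3) k * -X :=
    mem_skewAdjointMatricesSubmodule (J := Matrix.J (Fin 3) k) (A₁ := X)
  rw [h, ← Matrix.ext_iff]
  simp only [Sum.forall, Matrix.J, Matrix.mul_apply, Fintype.sum_sum_type, Matrix.transpose_apply,
    Matrix.fromBlocks_apply₁₁, Matrix.fromBlocks_apply₁₂, Matrix.fromBlocks_apply₂₁,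
    Matrix.fromBlocks_apply₂₂, Matrix.zero_apply, Matrix.neg_apply, Matrix.one_apply, mul_zero,
    zero_mul, Finset.sum_const_zero, zero_add, add_zero, mul_neg, neg_mul, mul_ite, ite_mul,
    mul_one, one_mul, Finset.sum_neg_distrib, Finset.sum_ite_eq, Finset.sum_ite_eq',
    Finset.mem_univ, if_true, neg_neg, neg_inj]
  constructor
  · rintro ⟨h1, h2⟩
    exact ⟨fun i j => (h1 j).1 i, fun i j => (h2 j).2 i,
      fun i j => neg_eq_iff_eq_neg.mp ((h1 i).2 j).symm⟩
  · rintro ⟨h1, h2, h3⟩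
    refine ⟨fun i => ⟨fun j => h1 j i, fun j => ?_⟩, fun i => ⟨fun j => ?_, fun j => h2 j i⟩⟩
    · rw [h3, neg_neg]
    · rw [h3]

theorem toMatrix_mem (x : Fin 21 → k) : toMatrix x ∈ sp6 k := by
  rw [mem_sp6_iff]
  refine ⟨fun i j => ?_, fun i j => ?_, fun i j => ?_⟩ <;> fin_cases i <;> fin_cases j <;>
    simp only [Fin.reduceFinMk, Fin.zero_eta, Fin.mk_one, Fin.isValue, toMatrix, neg_neg]

theorem ofMatrix_toMatrix (x : Fin 21 → k) : ofMatrix (toMatrix x) = x := by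
  funext l
  fin_cases l <;> simp only [Fin.reduceFinMk, Fin.zero_eta, Fin.mk_one, Fin.isValue, toMatrix,
    ofMatrix]

theorem toMatrix_ofMatrix {X : Matrix (Fin 3 ⊕ Fin 3) (Fin 3 ⊕ Fin 3) k} (hX : X ∈ sp6 k) :
    toMatrix (ofMatrix X) = X := by
  obtain ⟨h1, h2, h3⟩ := mem_sp6_iff.mp hX
  ext (i | i) (j | j) <;> fin_cases i <;> fin_cases j <;>
    simp only [Fin.reduceFinMk, Fin.zero_eta, Fin.mk_one, Fin.isValue, toMatrix, ofMatrix, h3,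
      neg_neg] <;>
    first | exact h1 _ _ | exact h2 _ _

/-- Lets `evenBracket` inherit skew symmetry and the Jacobi identity from matrices, in place of
large polynomial identities. -/
theorem toMatrix_evenBracket (x y : Fin 21 → k) :
    toMatrix (evenBracket x y) = toMatrix x * toMatrix y - toMatrix y * toMatrix x := by
  ext (i | i) (j | j) <;>
    simp only [Matrix.sub_apply, Matrix.mul_apply, Fintype.sum_sum_type, Fin.sum_univ_three] <;>
    fin_cases i <;> fin_cases j <;>
    simp only [Fin.reduceFinMk, Fin.zero_eta, Fin.mk_one, Fin.isValue, toMatrix, evenBracket] <;>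
    ring

theorem toMatrix_add (x y : Fin 21 → k) : toMatrix (x + y) = toMatrix x + toMatrix y := by
  ext (i | i) (j | j) <;> fin_cases i <;> fin_cases j <;>
    simp only [Matrix.add_apply, Fin.reduceFinMk, Fin.zero_eta, Fin.mk_one, Fin.isValue, toMatrix,
      Pi.add_apply, neg_add]

theorem toMatrix_smul (c : k) (x : Fin 21 → k) : toMatrix (c • x) = c • toMatrix x := by
  ext (i | i) (j | j) <;> fin_cases i <;> fin_cases j <;>
    simp only [Matrix.smul_apply, Fin.reduceFinMk, Fin.zero_eta, Fin.mk_one, Fin.isValue, toMatrix,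
      Pi.smul_apply, smul_neg]

variable (k)

/-- The coordinates of the Lie algebra `sp₆`. -/
def sp6Equiv : (Fin 21 → k) ≃ₗ[k] sp6 k where
  toFun x := ⟨toMatrix x, toMatrix_mem x⟩
  invFun X := ofMatrix X.1
  left_inv x := ofMatrix_toMatrix x
  right_inv X := Subtype.ext (toMatrix_ofMatrix X.2)
  map_add' x y := Subtype.ext (toMatrix_add x y)
  map_smul' c x := Subtype.ext (toMatrix_smul c x)

variable {k}

theorem sp6Equiv_coe (x : Fin 21 → k) : (sp6Equiv k x).1 = toMatrix x := rfl

theorem sp6Equiv_evenBracket (x y : Fin 21 → k) :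
    sp6Equiv k (evenBracket x y) = ⁅sp6Equiv k x, sp6Equiv k y⁆ := by
  apply Subtype.ext
  rw [LieSubalgebra.coe_bracket, Ring.lie_def]
  exact toMatrix_evenBracket x y

end SpWedgeModel

/-! ### Identities between bracket, action and odd product -/

namespace SpWedgeModel

variable {k : Type*} [Field k]

theorem evenBracket_add (x x' y : Fin 21 → k) :
    evenBracket (x + x') y = evenBracket x y + evenBracket x' y := by
  apply (sp6Equiv k).injective
  simp only [sp6Equiv_evenBracket, map_add, add_lie]

theorem evenBracket_smul (c : k) (x y : Fin 21 → k) :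
    evenBracket (c • x) y = c • evenBracket x y := by
  apply (sp6Equiv k).injective
  simp only [sp6Equiv_evenBracket, map_smul, smul_lie]

theorem evenBracket_skew (x y : Fin 21 → k) : evenBracket x y = -evenBracket y x := by
  apply (sp6Equiv k).injective
  rw [sp6Equiv_evenBracket, map_neg, sp6Equiv_evenBracket, lie_skew]

theorem evenBracket_self (x : Fin 21 → k) : evenBracket x x = 0 := by
  apply (sp6Equiv k).injective
  rw [sp6Equiv_evenBracket, map_zero, lie_self]

theorem evenBracket_jacobi (x y z : Fin 21 → k) : evenBracket x (evenBracket y z) =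
    evenBracket (evenBracket x y) z + evenBracket y (evenBracket x z) := by
  apply (sp6Equiv k).injective
  simp only [sp6Equiv_evenBracket, map_add]
  exact leibniz_lie _ _ _

theorem action_add_left (x x' : Fin 21 → k) (v : Fin 14 → k) :
    action (x + x') v = action x v + action x' v := by
  funext l
  fin_cases l <;> simp only [Fin.reduceFinMk, Fin.zero_eta, Fin.mk_one, Fin.isValue, Pi.add_apply,
    action] <;> ring

theorem action_smul_left (c : k) (x : Fin 21 → k) (v : Fin 14 → k) :
    action (c • x) v = c • action x v := by
  funext l
  fin_cases l <;> simp only [Fin.reduceFinMk, Fin.zero_eta, Fin.mk_one, Fin.isValue, Pi.smul_apply,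
    smul_eq_mul, action] <;> ring

theorem action_add_right (x : Fin 21 → k) (v v' : Fin 14 → k) :
    action x (v + v') = action x v + action x v' := by
  funext l
  fin_cases l <;> simp only [Fin.reduceFinMk, Fin.zero_eta, Fin.mk_one, Fin.isValue, Pi.add_apply,
    action] <;> ring

theorem action_smul_right (c : k) (x : Fin 21 → k) (v : Fin 14 → k) :
    action x (c • v) = c • action x v := by
  funext l
  fin_cases l <;> simp only [Fin.reduceFinMk, Fin.zero_eta, Fin.mk_one, Fin.isValue, Pi.smul_apply,
    smul_eq_mul, action] <;> ring

theorem oddBracket_add (v v' w : Fin 14 → k) :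
    oddBracket (v + v') w = oddBracket v w + oddBracket v' w := by
  funext l
  fin_cases l <;> simp only [Fin.reduceFinMk, Fin.zero_eta, Fin.mk_one, Fin.isValue, Pi.add_apply,
    oddBracket] <;> ring

theorem oddBracket_smul (c : k) (v w : Fin 14 → k) :
    oddBracket (c • v) w = c • oddBracket v w := by
  funext l
  fin_cases l <;> simp only [Fin.reduceFinMk, Fin.zero_eta, Fin.mk_one, Fin.isValue, Pi.smul_apply,
    smul_eq_mul, oddBracket] <;> ring

theorem oddBracket_comm (v w : Fin 14 → k) : oddBracket v w = oddBracket w v := by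
  funext l
  fin_cases l <;> simp only [Fin.reduceFinMk, Fin.zero_eta, Fin.mk_one, Fin.isValue,
    oddBracket] <;> ring

/-- An identity between polynomials with integer coefficients; the characteristic plays no role here
or in `evenBracket_oddBracket`. -/
theorem action_evenBracket (x y : Fin 21 → k) (v : Fin 14 → k) :
    action (evenBracket x y) v = action x (action y v) - action y (action x v) := by
  funext l
  fin_cases l <;> simp only [Fin.reduceFinMk, Fin.zero_eta, Fin.mk_one, Fin.isValue, Pi.sub_apply,
    evenBracket, action] <;> ring

theorem evenBracket_oddBracket (x : Fin 21 → k) (v w : Fin 14 → k) :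
    evenBracket x (oddBracket v w) = oddBracket (action x v) w + oddBracket v (action x w) := by
  funext l
  fin_cases l <;> simp only [Fin.reduceFinMk, Fin.zero_eta, Fin.mk_one, Fin.isValue, Pi.add_apply,
    evenBracket, oddBracket, action] <;> ring

/-- Jacobi identity for three odd elements. After expansion the cyclic sum is divisible by 3, which
is the reason why this superalgebra lives in characteristic 3. -/
theorem action_oddBracket [CharP k 3] (u v w : Fin 14 → k) :
    action (oddBracket u v) w + action (oddBracket v w) u + action (oddBracket w u) v = 0 := by
  have h3 : (3 : k) = 0 := by exact_mod_cast CharP.cast_eq_zero k 3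
  funext l
  fin_cases l <;> simp only [Fin.reduceFinMk, Fin.zero_eta, Fin.mk_one, Fin.isValue, Pi.add_apply,
    Pi.zero_apply, oddBracket, action] <;> grind

/-- Not a consequence of `action_oddBracket`: equal arguments there give only three times this
expression, which carries no information in characteristic 3. -/
theorem action_oddBracket_self [CharP k 3] (v : Fin 14 → k) : action (oddBracket v v) v = 0 := by
  have h3 : (3 : k) = 0 := by exact_mod_cast CharP.cast_eq_zero k 3
  funext l
  fin_cases l <;> simp only [Fin.reduceFinMk, Fin.zero_eta, Fin.mk_one, Fin.isValue,
    Pi.zero_apply, oddBracket, action] <;> grind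

end SpWedgeModel

/-! ### The Lie superalgebra sp₆ ⊕ V(ω₃) -/

namespace SpWedgeModel

variable {k : Type*} [Field k]

variable (k)

/-- The superspace `sp₆ ⊕ V(ω₃)` in coordinates. -/
abbrev Space : Type _ := (Fin 21 → k) × (Fin 14 → k)

variable {k}

/-- The product of `sp₆ ⊕ V(ω₃)`. -/
def mul (X Y : Space k) : Space k :=
  (evenBracket X.1 Y.1 + oddBracket X.2 Y.2, action X.1 Y.2 - action Y.1 X.2)

theorem evenBracket_add_right (x y y' : Fin 21 → k) :
    evenBracket x (y + y') = evenBracket x y + evenBracket x y' := by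
  rw [evenBracket_skew, evenBracket_add, evenBracket_skew x y, evenBracket_skew x y', neg_add]

theorem evenBracket_smul_right (c : k) (x y : Fin 21 → k) :
    evenBracket x (c • y) = c • evenBracket x y := by
  rw [evenBracket_skew, evenBracket_smul, evenBracket_skew x y, smul_neg]

theorem oddBracket_add_right (v w w' : Fin 14 → k) :
    oddBracket v (w + w') = oddBracket v w + oddBracket v w' := by
  rw [oddBracket_comm, oddBracket_add, oddBracket_comm w, oddBracket_comm w']

theorem oddBracket_smul_right (c : k) (v w : Fin 14 → k) :
    oddBracket v (c • w) = c • oddBracket v w := by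
  rw [oddBracket_comm, oddBracket_smul, oddBracket_comm w]

theorem evenBracket_zero (x : Fin 21 → k) : evenBracket x 0 = 0 := by
  simpa using evenBracket_smul_right 0 x 0

theorem zero_evenBracket (x : Fin 21 → k) : evenBracket 0 x = 0 := by
  simpa using evenBracket_smul 0 0 x

theorem action_zero (x : Fin 21 → k) : action x 0 = 0 := by
  simpa using action_smul_right 0 x 0

theorem zero_action (v : Fin 14 → k) : action 0 v = 0 := by
  simpa using action_smul_left 0 0 v

theorem oddBracket_zero (v : Fin 14 → k) : oddBracket v 0 = 0 := by
  simpa using oddBracket_smul_right 0 v 0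

theorem zero_oddBracket (v : Fin 14 → k) : oddBracket 0 v = 0 := by
  simpa using oddBracket_smul 0 0 v

theorem action_neg (x : Fin 21 → k) (v : Fin 14 → k) : action x (-v) = -action x v := by
  simpa using action_smul_right (-1) x v

theorem neg_oddBracket (v w : Fin 14 → k) : oddBracket (-v) w = -oddBracket v w := by
  simpa using oddBracket_smul (-1) v w

theorem oddBracket_neg (v w : Fin 14 → k) : oddBracket v (-w) = -oddBracket v w := by
  simpa using oddBracket_smul_right (-1) v w

variable (k)

/-- The parity grading of `sp₆ ⊕ V(ω₃)`. -/
def grading : SuperGrading k (Space k) where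
  gr i := if i = 0 then Submodule.prod ⊤ ⊥ else Submodule.prod ⊥ ⊤
  isCompl := by
    apply SuperGrading.isCompl_of
    · intro x
      exact ⟨(x.1, 0), by simp, (0, x.2), by simp, by simp⟩
    · intro x h0 h1
      simp at h0 h1
      exact Prod.ext h1 h0

variable {k}

theorem mem_even {X : Space k} : X ∈ (grading k).gr 0 ↔ X.2 = 0 := by simp [grading]

theorem mem_odd {X : Space k} : X ∈ (grading k).gr 1 ↔ X.1 = 0 := by simp [grading]

variable (k)

/-- The superalgebra `sp₆ ⊕ V(ω₃)`. -/
def algebra : Superalgebra k (Space k) where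
  toSuperGrading := grading k
  mul := LinearMap.mk₂ k mul
    (by
      intro X X' Y
      simp only [mul, Prod.fst_add, Prod.snd_add, evenBracket_add, oddBracket_add, action_add_left,
        action_add_right, Prod.mk_add_mk]
      congr 1 <;> abel)
    (by
      intro c X Y
      simp only [mul, Prod.smul_fst, Prod.smul_snd, evenBracket_smul, oddBracket_smul,
        action_smul_left, action_smul_right, Prod.smul_mk, smul_add, smul_sub])
    (by
      intro X Y Y'
      simp only [mul, Prod.fst_add, Prod.snd_add, evenBracket_add_right, oddBracket_add_right,
        action_add_left, action_add_right, Prod.mk_add_mk]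
      congr 1 <;> abel)
    (by
      intro c X Y
      simp only [mul, Prod.smul_fst, Prod.smul_snd, evenBracket_smul_right, oddBracket_smul_right,
        action_smul_left, action_smul_right, Prod.smul_mk, smul_add, smul_sub])
  mul_mem := by
    rintro i j ⟨x, v⟩ ⟨y, w⟩ hX hY
    rcases zmod2_cases i with rfl | rfl <;> rcases zmod2_cases j with rfl | rfl <;>
      simp only [mem_even, mem_odd] at hX hY <;> subst hX <;> subst hY <;>
      simp [mem_even, mem_odd, zmod2_one_add_one, mul, evenBracket_zero, zero_evenBracket,
        zero_action, action_zero, zero_oddBracket, oddBracket_zero]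

variable {k}

theorem algebra_mul (X Y : Space k) : (algebra k).mul X Y = mul X Y := rfl

theorem mem_algebra_even {X : Space k} : X ∈ (algebra k).gr 0 ↔ X.2 = 0 := mem_even

theorem mem_algebra_odd {X : Space k} : X ∈ (algebra k).gr 1 ↔ X.1 = 0 := mem_odd

/-- Sorted by parities, the Jacobi identity splits into that of sp₆, the module identity,
equivariance of the odd product and its cyclic identity. -/
theorem isLie_algebra [CharP k 3] : (algebra k).IsLie where
  skew := by
    rintro i j ⟨x, v⟩ ⟨y, w⟩ hX hY
    rcases zmod2_cases i with rfl | rfl <;> rcases zmod2_cases j with rfl | rfl <;>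
      simp only [mem_algebra_even, mem_algebra_odd] at hX hY <;> subst hX <;> subst hY <;>
      simp [algebra_mul, mul, evenBracket_zero, zero_evenBracket,
        zero_action, action_zero, zero_oddBracket, oddBracket_zero]
    · exact evenBracket_skew _ _
    · exact oddBracket_comm _ _
  self_even := by
    rintro ⟨x, v⟩ hX
    simp only [mem_algebra_even] at hX
    subst hX
    simp [algebra_mul, mul, evenBracket_self, oddBracket_zero]
  jacobi := by
    rintro i j ⟨x, v⟩ ⟨y, w⟩ ⟨z, u⟩ hX hY
    rcases zmod2_cases i with rfl | rfl <;> rcases zmod2_cases j with rfl | rfl <;>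
      simp only [mem_algebra_even, mem_algebra_odd] at hX hY <;> subst hX <;> subst hY <;>
      simp only [algebra_mul, mul, evenBracket_zero, zero_evenBracket, zero_action, action_zero,
        zero_oddBracket, oddBracket_zero, add_zero, zero_add, sub_zero, zero_sub, mul_one, mul_zero,
        sg_zero, sg_one, one_smul, neg_smul, Prod.mk_add_mk, Prod.neg_mk, action_neg, oddBracket_neg]
        <;> refine Prod.ext ?_ ?_ <;> dsimp only
    · exact evenBracket_jacobi _ _ _
    · rw [action_evenBracket]; abel
    · rw [evenBracket_oddBracket, neg_zero, add_zero]
    · rw [action_evenBracket]; abel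
    · rw [evenBracket_oddBracket, neg_oddBracket]; abel
    · rw [action_evenBracket]; abel
    · rw [evenBracket_skew, evenBracket_oddBracket, oddBracket_comm (action z v)]; abel
    · have h := action_oddBracket v w u
      rw [oddBracket_comm u v] at h
      linear_combination (norm := module) -h
  cube_odd := by
    rintro ⟨x, v⟩ hX
    simp only [mem_algebra_odd] at hX
    subst hX
    simp [algebra_mul, mul, evenBracket_zero, zero_evenBracket,
        zero_action, action_zero, zero_oddBracket, oddBracket_zero, action_oddBracket_self]

end SpWedgeModel

/-! ### The bracket of g(S₁, S) on tri(S) ⊕ S³ -/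

namespace SymmetricCompositionSuperalgebra

section

variable {k S : Type*} [Field k] [AddCommGroup S] [Module k S]
  (C : SymmetricCompositionSuperalgebra k S)

theorem t_zero_apply (h2 : (2 : k) ≠ 0) {i j l : ZMod 2} {x y z : S} (hx : x ∈ C.gr i)
    (hy : y ∈ C.gr j) (hz : z ∈ C.gr l) : (C.t h2 x y).1 0 z =
      (sg k (j * l) * C.b x z) • y - (sg k (i * (j + l)) * C.b y z) • x := by
  rw [C.t_apply h2 hx hy]
  exact C.sigmaHom_apply i j x y hz

theorem t_one_apply (h2 : (2 : k) ≠ 0) {i j l : ZMod 2} {x y z : S} (hx : x ∈ C.gr i)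
    (hy : y ∈ C.gr j) (hz : z ∈ C.gr l) : (C.t h2 x y).1 1 z =
      (2⁻¹ * C.b x y) • z - sg k (i * (j + l)) • C.mul (C.mul y z) x := by
  rw [C.t_apply h2 hx hy]
  have h := C.rmul_apply hx (C.mul_mem hy hz)
  change (2⁻¹ * C.b x y) • z - C.rmul x (C.mul y z) = _
  rw [h]

theorem t_two_apply (h2 : (2 : k) ≠ 0) {i j l : ZMod 2} {x y z : S} (hx : x ∈ C.gr i)
    (hy : y ∈ C.gr j) (hz : z ∈ C.gr l) : (C.t h2 x y).1 2 z =
      (2⁻¹ * C.b x y) • z - sg k (j * l) • C.mul x (C.mul z y) := by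
  rw [C.t_apply h2 hx hy]
  have h := C.rmul_apply hy hz
  change (2⁻¹ * C.b x y) • z - C.mul x (C.rmul y z) = _
  rw [h, map_smul]

theorem triSuper_mul_apply {i j : ZMod 2} {d e : C.tri} (hd : d ∈ C.triSuper.gr i)
    (he : e ∈ C.triSuper.gr j) (m : Fin 3) (x : S) :
    (C.triSuper.mul d e).1 m x = d.1 m (e.1 m x) - sg k (i * j) • e.1 m (d.1 m x) :=
  C.triples_mul (C.triGr_le i (C.mem_triSuper_gr.mp hd)) (C.triGr_le j (C.mem_triSuper_gr.mp he))
    m x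

/-- θ^q carries slot `m - q` to slot `m`, whence the cyclic pattern of indices. -/
theorem sum_theta_apply (d : Fin 3 → C.tri) :
    ((∑ q : Fin 3, (C.theta ^ (q : ℕ)) (d q) : C.tri) : Fin 3 → Module.End k S) =
      ![(d 0).1 0 + (d 1).1 2 + (d 2).1 1, (d 0).1 1 + (d 1).1 0 + (d 2).1 2,
        (d 0).1 2 + (d 1).1 1 + (d 2).1 0] := by
  rw [Fin.sum_univ_three]
  funext m
  fin_cases m <;> rfl

end

section

variable {k S : Type*} [Field k] [AddCommGroup S] [Module k S] (h2 : (2 : k) ≠ 0)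

/-- An even component preserves 2xy, so 4 d(1) = 0; an odd one maps 1 to the odd part of S₁, which
is zero. -/
theorem S1_tri_eq_zero (d : (S1 k h2).tri) : d = 0 := by
  have hone : (1 : k) ∈ (S1 k h2).gr 0 := Submodule.mem_top
  obtain ⟨d, hd⟩ := d
  obtain ⟨d0, hd0, d1, hd1, rfl⟩ := (S1 k h2).mem_tri.mp hd
  have e0 : d0 = 0 := by
    funext m
    refine LinearMap.ext_ring ?_
    have h := (hd0.1 m).2 0 1 hone 1
    have h' : 2 * d0 m 1 + 2 * d0 m 1 = 0 := by
      simpa [S1] using h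
    have h4 : (2 * 2) * d0 m 1 = 0 := by linear_combination h'
    exact (mul_eq_zero.mp h4).resolve_left (mul_ne_zero h2 h2)
  have e1 : d1 = 0 := by
    funext m
    refine LinearMap.ext_ring ?_
    have h := (hd1.1 m).1 0 1 hone
    rw [add_zero] at h
    exact (Submodule.mem_bot k).mp h
  exact Subtype.ext (by simp [e0, e1])

/-- The element of `g(S₁, S)` with given components in `tri(S)` and in the three copies of
`S = S₁ ⊗ S`. -/
def oneElement (C : SymmetricCompositionSuperalgebra k S) (d : C.tri) (s : Fin 3 → S) :
    MagicSpace (S1 k h2) C := (0, d, fun m => 1 ⊗ₜ s m)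

theorem magic_mul_tri {S' : Type*} [AddCommGroup S'] [Module k S']
    (C : SymmetricCompositionSuperalgebra k S) (C' : SymmetricCompositionSuperalgebra k S')
    (X Y : MagicSpace C C') : ((magic C C' h2).mul X Y).2.1 = C'.triSuper.mul X.2.1 Y.2.1 +
      ∑ i : Fin 3, (C'.theta ^ (i : ℕ)) (pairRight C C' h2 (X.2.2 i) (Y.2.2 i)) := rfl

theorem magic_mul_tensor {S' : Type*} [AddCommGroup S'] [Module k S']
    (C : SymmetricCompositionSuperalgebra k S) (C' : SymmetricCompositionSuperalgebra k S')
    (X Y : MagicSpace C C') (m : Fin 3) : ((magic C C' h2).mul X Y).2.2 m =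
      C.actLeft m X.1 (Y.2.2 m) + actRight C C' m X.2.1 (Y.2.2 m)
        - SuperGrading.sflip C.triSuper.toSuperGrading (tensorGr C C') (C.actLeft m) (X.2.2 m) Y.1
        - SuperGrading.sflip C'.triSuper.toSuperGrading (tensorGr C C') (actRight C C' m)
            (X.2.2 m) Y.2.1
        + tensorMul C C' (X.2.2 (m + 1)) (Y.2.2 (m + 2))
        - SuperGrading.sflip (tensorGr C C') (tensorGr C C') (tensorMul C C')
            (X.2.2 (m + 2)) (Y.2.2 (m + 1)) := rfl

variable {C : SymmetricCompositionSuperalgebra k S}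

theorem oneElement_fst (d : C.tri) (s : Fin 3 → S) : (oneElement h2 C d s).1 = 0 := rfl

theorem oneElement_tri (d : C.tri) (s : Fin 3 → S) : (oneElement h2 C d s).2.1 = d := rfl

theorem oneElement_tensor (d : C.tri) (s : Fin 3 → S) (m : Fin 3) :
    (oneElement h2 C d s).2.2 m = 1 ⊗ₜ s m := rfl

theorem oneElement_mem {i : ZMod 2} {d : C.tri} {s : Fin 3 → S} (hd : d ∈ C.triSuper.gr i)
    (hs : ∀ m, s m ∈ C.gr i) : oneElement h2 C d s ∈ (magic (S1 k h2) C h2).gr i := by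
  refine ⟨Submodule.zero_mem _, hd, fun m _ => ?_⟩
  have h := SuperGrading.tmul_mem_tensor (S1 k h2).toSuperGrading C.toSuperGrading (i := 0)
    (x := (1 : k)) Submodule.mem_top (hs m)
  rwa [zero_add] at h

variable (C) in
/-- The component in `tri(S)` of a product in `g(S₁, S)`. -/
noncomputable def mulTri (d e : C.tri) (s t : Fin 3 → S) : C.tri :=
  C.triSuper.mul d e + ∑ q : Fin 3, (C.theta ^ (q : ℕ)) ((2 : k) • C.t h2 (s q) (t q))

/-- The factor S₁ enters only through 1 • 1 = 1 and b(1,1) = 2, so the bracket is expressed by data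
of S alone. The sign of the last and second terms is that of super-anticommutativity. -/
theorem magic_mul_oneElement {i j : ZMod 2} {d e : C.tri} {s t : Fin 3 → S}
    (hd : d ∈ C.triSuper.gr i) (hs : ∀ m, s m ∈ C.gr i) (he : e ∈ C.triSuper.gr j)
    (ht : ∀ m, t m ∈ C.gr j) :
    (magic (S1 k h2) C h2).mul (oneElement h2 C d s) (oneElement h2 C e t) =
      oneElement h2 C (mulTri h2 C d e s t)
        fun m => d.1 m (t m) - sg k (i * j) • e.1 m (s m) + C.mul (s (m + 1)) (t (m + 2)) -
          sg k (i * j) • C.mul (t (m + 1)) (s (m + 2)) := by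
  have hone : (1 : k) ∈ (S1 k h2).gr 0 := Submodule.mem_top
  have hst : ∀ {l : ZMod 2} {x : S}, x ∈ C.gr l →
      (1 : k) ⊗ₜ[k] x ∈ (tensorGr (S1 k h2) C).gr l := by
    intro l x hx
    have h := SuperGrading.tmul_mem_tensor (S1 k h2).toSuperGrading C.toSuperGrading hone hx
    rwa [zero_add] at h
  have hb : (S1 k h2).b 1 1 = 2 := by simp [S1]
  have hm : (S1 k h2).mul 1 1 = 1 := by simp [S1]
  refine Prod.ext (S1_tri_eq_zero h2 _) (Prod.ext ?_ (funext fun m => ?_))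
  · rw [magic_mul_tri]
    simp only [oneElement_tri, oneElement_tensor, mulTri]
    refine congrArg (_ + ·) (Finset.sum_congr rfl fun q _ => ?_)
    rw [pairRight, LinearMap.compr₂_apply, tensorPair_tmul _ _ _ _ _ hone (hs q) hone (ht q)]
    simp [hb]
  · rw [magic_mul_tensor]
    simp only [oneElement_fst, oneElement_tri, oneElement_tensor]
    rw [SuperGrading.sflip_apply _ _ _ he (hst (hs m)),
      SuperGrading.sflip_apply _ _ _ (hst (ht (m + 1))) (hst (hs (m + 2))),
      actRight_tmul _ _ m hd hone, actRight_tmul _ _ m he hone, tensorMul,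
      tensorPair_tmul _ _ _ _ _ hone (hs _) hone (ht _),
      tensorPair_tmul _ _ _ _ _ hone (ht _) hone (hs _)]
    simp only [map_zero, LinearMap.zero_apply, mul_zero, sg_zero, one_smul, hm, zero_add, sub_zero,
      mul_comm j i, TensorProduct.tmul_sub, TensorProduct.tmul_add,
      TensorProduct.tmul_smul]

variable (C)

theorem mulTri_mem {i j l : ZMod 2}
    (hl : i + j = l) {d e : C.tri} {s t : Fin 3 → S} (hd : d ∈ C.triSuper.gr i) (hs : ∀ m, s m ∈ C.gr i)
    (he : e ∈ C.triSuper.gr j) (ht : ∀ m, t m ∈ C.gr j) :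
    mulTri h2 C d e s t ∈ C.triSuper.gr l :=
  hl ▸ Submodule.add_mem _ (C.triSuper.mul_mem hd he) (Submodule.sum_mem _ fun q _ =>
    C.theta_pow_mem (Submodule.smul_mem _ _ (C.t_mem h2 (hs q) (ht q))) q)

/-- Here 2 = 2⁻¹ = -1, so twice a triple t_{x,y} has coefficients ±1: the scalars ½ b become b, and
the products l and r change sign. In slot `m` the summands `m`, `m + 1`, `m + 2` contribute entries
0, 2, 1 of their triples. -/
theorem mulTri_apply [CharP k 3] {i j l : ZMod 2} {d e : C.tri}
    {s t : Fin 3 → S} (hd : d ∈ C.triSuper.gr i) (hs : ∀ m, s m ∈ C.gr i)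
    (he : e ∈ C.triSuper.gr j) (ht : ∀ m, t m ∈ C.gr j) (m : Fin 3) {z : S} (hz : z ∈ C.gr l) :
    (mulTri h2 C d e s t).1 m z =
      d.1 m (e.1 m z) - sg k (i * j) • e.1 m (d.1 m z) +
        ((C.b (s (m + 1)) (t (m + 1)) + C.b (s (m + 2)) (t (m + 2))) • z +
          (sg k (i * (j + l)) * C.b (t m) z) • s m - (sg k (j * l) * C.b (s m) z) • t m +
          sg k (j * l) • C.mul (s (m + 1)) (C.mul z (t (m + 1))) +
          sg k (i * (j + l)) • C.mul (C.mul (t (m + 2)) z) (s (m + 2))) := by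
  have h3 : (3 : k) = 0 := by exact_mod_cast CharP.cast_eq_zero k 3
  have hh : (2 : k) = -1 := by linear_combination h3
  have e1 := triSuper_mul_apply C hd he m z
  have e2 := congrFun (sum_theta_apply C fun q => (2 : k) • C.t h2 (s q) (t q)) m
  change (C.triSuper.mul d e).1 m z + (((∑ q : Fin 3, (C.theta ^ (q : ℕ))
    ((2 : k) • C.t h2 (s q) (t q)) : C.tri) : Fin 3 → Module.End k S) m) z = _
  rw [e1, e2]
  congr 1
  match m with
  | 0 =>
    change (2 : k) • (C.t h2 (s 0) (t 0)).1 0 z + (2 : k) • (C.t h2 (s 1) (t 1)).1 2 z +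
      (2 : k) • (C.t h2 (s 2) (t 2)).1 1 z = _
    rw [C.t_zero_apply h2 (hs 0) (ht 0) hz, C.t_two_apply h2 (hs 1) (ht 1) hz,
      C.t_one_apply h2 (hs 2) (ht 2) hz, hh]
    simp only [inv_neg, inv_one, zero_add]
    module
  | 1 =>
    change (2 : k) • (C.t h2 (s 0) (t 0)).1 1 z + (2 : k) • (C.t h2 (s 1) (t 1)).1 0 z +
      (2 : k) • (C.t h2 (s 2) (t 2)).1 2 z = _
    rw [C.t_one_apply h2 (hs 0) (ht 0) hz, C.t_zero_apply h2 (hs 1) (ht 1) hz,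
      C.t_two_apply h2 (hs 2) (ht 2) hz, hh]
    simp only [inv_neg, inv_one, show (1 + 1 : Fin 3) = 2 from rfl, show (1 + 2 : Fin 3) = 0 from rfl]
    module
  | 2 =>
    change (2 : k) • (C.t h2 (s 0) (t 0)).1 2 z + (2 : k) • (C.t h2 (s 1) (t 1)).1 1 z +
      (2 : k) • (C.t h2 (s 2) (t 2)).1 0 z = _
    rw [C.t_two_apply h2 (hs 0) (ht 0) hz, C.t_one_apply h2 (hs 1) (ht 1) hz,
      C.t_zero_apply h2 (hs 2) (ht 2) hz, hh]
    simp only [inv_neg, inv_one, show (2 + 1 : Fin 3) = 0 from rfl, show (2 + 2 : Fin 3) = 1 from rfl]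
    module

/-- Used for one even and one odd factor, where super-anticommutativity has no extra sign; the
odd-even products then follow from the even-odd ones. -/
theorem mulTri_add_mulTri {d e : C.tri} {s t : Fin 3 → S}
    (h : C.triSuper.mul d e + C.triSuper.mul e d = 0)
    (hst : ∀ q, C.t h2 (s q) (t q) + C.t h2 (t q) (s q) = 0) :
    mulTri h2 C d e s t + mulTri h2 C e d t s = 0 := by
  rw [mulTri, mulTri, add_add_add_comm, h, zero_add, ← Finset.sum_add_distrib]
  refine Finset.sum_eq_zero fun q _ => ?_
  rw [← map_add, ← smul_add, hst, smul_zero, map_zero]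

theorem tri_eq_of_add_eq_zero {x y z : C.tri} (hy : x + y = 0) (hz : x + z = 0) : y = z :=
  add_left_cancel (hy.trans hz.symm)

end

end SymmetricCompositionSuperalgebra

/-! ### Explicit elements of tri(S_{4,2}) -/

namespace B42

variable {k : Type*} [Field k]

/-- The even endomorphism `(f, v) ↦ (B f - f E, A v)` of `B(4,2)`. -/
def evenMap (A B E : Matrix (Fin 2) (Fin 2) k) : Module.End k (Space k) where
  toFun x := (!![B 0 0 * x.1 0 0 + B 0 1 * x.1 1 0 - (x.1 0 0 * E 0 0 + x.1 0 1 * E 1 0),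
      B 0 0 * x.1 0 1 + B 0 1 * x.1 1 1 - (x.1 0 0 * E 0 1 + x.1 0 1 * E 1 1);
      B 1 0 * x.1 0 0 + B 1 1 * x.1 1 0 - (x.1 1 0 * E 0 0 + x.1 1 1 * E 1 0),
      B 1 0 * x.1 0 1 + B 1 1 * x.1 1 1 - (x.1 1 0 * E 0 1 + x.1 1 1 * E 1 1)],
    ![A 0 0 * x.2 0 + A 0 1 * x.2 1, A 1 0 * x.2 0 + A 1 1 * x.2 1])
  map_add' x y := by apply space_ext <;> simp <;> ring
  map_smul' c x := by apply space_ext <;> simp <;> ring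

theorem evenMap_apply (A B E : Matrix (Fin 2) (Fin 2) k) (x : Space k) : evenMap A B E x =
    (!![B 0 0 * x.1 0 0 + B 0 1 * x.1 1 0 - (x.1 0 0 * E 0 0 + x.1 0 1 * E 1 0),
      B 0 0 * x.1 0 1 + B 0 1 * x.1 1 1 - (x.1 0 0 * E 0 1 + x.1 0 1 * E 1 1);
      B 1 0 * x.1 0 0 + B 1 1 * x.1 1 0 - (x.1 1 0 * E 0 0 + x.1 1 1 * E 1 0),
      B 1 0 * x.1 0 1 + B 1 1 * x.1 1 1 - (x.1 1 0 * E 0 1 + x.1 1 1 * E 1 1)],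
    ![A 0 0 * x.2 0 + A 0 1 * x.2 1, A 1 0 * x.2 0 + A 1 1 * x.2 1]) := rfl

/-- The odd endomorphism of `B(4,2)` given by a trilinear form. -/
def oddMap (P : Fin 2 → Fin 2 → Fin 2 → k) : Module.End k (Space k) where
  toFun x := (!![P 1 1 0 * x.2 0 - P 0 1 0 * x.2 1, P 0 0 0 * x.2 1 - P 1 0 0 * x.2 0;
      P 1 1 1 * x.2 0 - P 0 1 1 * x.2 1, P 0 0 1 * x.2 1 - P 1 0 1 * x.2 0],
    ![P 0 1 0 * x.1 1 1 - P 0 1 1 * x.1 0 1 + P 0 0 0 * x.1 1 0 - P 0 0 1 * x.1 0 0,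
      P 1 1 0 * x.1 1 1 - P 1 1 1 * x.1 0 1 + P 1 0 0 * x.1 1 0 - P 1 0 1 * x.1 0 0])
  map_add' x y := by apply space_ext <;> simp <;> ring
  map_smul' c x := by apply space_ext <;> simp <;> ring

theorem oddMap_apply (P : Fin 2 → Fin 2 → Fin 2 → k) (x : Space k) :
    oddMap P x = (!![P 1 1 0 * x.2 0 - P 0 1 0 * x.2 1, P 0 0 0 * x.2 1 - P 1 0 0 * x.2 0;
      P 1 1 1 * x.2 0 - P 0 1 1 * x.2 1, P 0 0 1 * x.2 1 - P 1 0 1 * x.2 0],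
    ![P 0 1 0 * x.1 1 1 - P 0 1 1 * x.1 0 1 + P 0 0 0 * x.1 1 0 - P 0 0 1 * x.1 0 0,
      P 1 1 0 * x.1 1 1 - P 1 1 1 * x.1 0 1 + P 1 0 0 * x.1 1 0 - P 1 0 1 * x.1 0 0]) := rfl

variable [CharP k 3]

theorem S42_mul (x y : Space k) : (S42 k).mul x y = paraMul x y := rfl

theorem S42_b (x y : Space k) : (S42 k).b x y = b x y := rfl

theorem mem_S42_even {x : Space k} : x ∈ (S42 k).gr 0 ↔ x.2 = 0 := by
  change x ∈ (grading (k := k)).gr 0 ↔ _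
  simp [grading]

theorem mem_S42_odd {x : Space k} : x ∈ (S42 k).gr 1 ↔ x.1 = 0 := by
  change x ∈ (grading (k := k)).gr 1 ↔ _
  simp [grading]

/-- Trace zero means membership in sp(V) = sl(V), and the polar form of the determinant on 2 × 2
matrices is the product of the alternating forms of source and target. -/
theorem evenMap_mem_osp {A B E : Matrix (Fin 2) (Fin 2) k} (hA : A 1 1 = -A 0 0)
    (hB : B 1 1 = -B 0 0) (hE : E 1 1 = -E 0 0) : evenMap A B E ∈ (S42 k).osp 0 := by
  refine ⟨fun j x hx => ?_, fun j x _ y => ?_⟩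
  · rw [zero_add]
    rcases zmod2_cases j with rfl | rfl
    · rw [mem_S42_even] at hx ⊢
      simp [evenMap_apply, hx]
    · rw [mem_S42_odd] at hx ⊢
      ext a c
      fin_cases a <;> fin_cases c <;> simp [evenMap_apply, hx]
  · simp [S42_b, b_eq, evenMap_apply, Matrix.mul_apply, Matrix.mulVec, dotProduct, Fin.sum_univ_two,
      hA, hB, hE]
    ring

theorem oddMap_mem_osp (P : Fin 2 → Fin 2 → Fin 2 → k) : oddMap P ∈ (S42 k).osp 1 := by
  refine ⟨fun j x hx => ?_, fun j x hx y => ?_⟩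
  · rcases zmod2_cases j with rfl | rfl
    · rw [mem_S42_even] at hx
      rw [add_zero, mem_S42_odd]
      ext a c
      fin_cases a <;> fin_cases c <;> simp [oddMap_apply, hx]
    · rw [mem_S42_odd] at hx
      rw [zmod2_one_add_one, mem_S42_even]
      ext a
      fin_cases a <;> simp [oddMap_apply, hx]
  · rcases zmod2_cases j with rfl | rfl
    · rw [mem_S42_even] at hx
      simp [S42_b, b_eq, oddMap_apply, hx]
      ring
    · rw [mem_S42_odd] at hx
      simp [S42_b, b_eq, oddMap_apply, hx]
      ring

/-- In slot `m` the odd vectors are V_m and the matrices are Hom(V_{m+1}, V_{m+2}). The product • is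
made of composition, evaluation and the alternating forms, all invariant under the three copies of
sl₂. -/
theorem evenMap_mem_triGr {A : Fin 3 → Matrix (Fin 2) (Fin 2) k} (hA : ∀ m, A m 1 1 = -A m 0 0) :
    ![evenMap (A 0) (A 2) (A 1), evenMap (A 1) (A 0) (A 2), evenMap (A 2) (A 1) (A 0)] ∈
      (S42 k).triGr 0 := by
  refine ⟨fun m => ?_, fun j x _ y => ?_⟩
  · fin_cases m <;> exact evenMap_mem_osp (hA _) (hA _) (hA _)
  · simp only [S42_mul, zero_mul, sg_zero, one_smul, Matrix.cons_val_zero, Matrix.cons_val_one,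
      Matrix.cons_val_two, Matrix.head_cons, Matrix.tail_cons, Matrix.cons_val]
    apply space_ext <;>
      simp [evenMap_apply, paraMul_eq, Matrix.mul_apply, Matrix.mulVec, dotProduct,
        Fin.sum_univ_two, hA] <;> ring

/-- The slots carry the same trilinear form with its arguments rotated, in step with θ. -/
theorem oddMap_mem_triGr (P : Fin 2 → Fin 2 → Fin 2 → k) :
    ![oddMap P, oddMap fun i j l => P l i j, oddMap fun i j l => P j l i] ∈ (S42 k).triGr 1 := by
  have h3 : (3 : k) = 0 := by exact_mod_cast CharP.cast_eq_zero k 3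
  refine ⟨fun m => ?_, fun j x hx y => ?_⟩
  · match m with
    | 0 => exact oddMap_mem_osp P
    | 1 => exact oddMap_mem_osp fun i j l => P l i j
    | 2 => exact oddMap_mem_osp fun i j l => P j l i
  · simp only [S42_mul, one_mul, Matrix.cons_val_zero, Matrix.cons_val_one,
      Matrix.cons_val_two, Matrix.head_cons, Matrix.tail_cons, Matrix.cons_val]
    rcases zmod2_cases j with rfl | rfl
    · rw [mem_S42_even] at hx
      apply space_ext <;> simp [oddMap_apply, paraMul_eq, hx] <;> ring
    · rw [mem_S42_odd] at hx
      -- For odd `x` the identity fails over the integers: in the two coordinates of V the defect is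
      -- three times this expression.
      have e (a : Fin 2) := congrArg (· * (x.2 0 * P a 1 1 * y.2 0 - P a 1 0 * x.2 0 * y.2 1 +
        y.2 1 * P a 0 0 * x.2 1 - y.2 0 * x.2 1 * P a 0 1)) h3
      apply space_ext <;> simp [oddMap_apply, paraMul_eq, hx]
      · ring
      · ring
      · ring
      · ring
      · linear_combination e 0
      · linear_combination e 1

end B42

/-! ### Determination of tri(S_{4,2}) -/

namespace B42

open SymmetricCompositionSuperalgebra

variable {k : Type*} [Field k]

theorem endo_ext {d e : Module.End k (Space k)} (h0 : ∀ f, d (f, 0) = e (f, 0))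
    (h1 : ∀ v, d (0, v) = e (0, v)) : d = e := by
  refine LinearMap.ext fun x => ?_
  have hx : x = (x.1, 0) + (0, x.2) := by simp
  rw [hx, map_add, map_add, h0, h1]

theorem eq_zero_of_form {w : Fin 2 → k} (h : ∀ v : Fin 2 → k, v 0 * w 1 - v 1 * w 0 = 0) :
    w = 0 := by
  have h0 := h ![0, 1]
  have h1 := h ![1, 0]
  simp at h0 h1
  ext a
  fin_cases a <;> assumption

theorem apply_odd {d : Module.End k (Space k)} (v : Fin 2 → k) :
    d (0, v) = v 0 • d (0, ![1, 0]) + v 1 • d (0, ![0, 1]) := by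
  rw [← map_smul, ← map_smul, ← map_add]
  congr 1
  apply space_ext <;> simp

variable [CharP k 3]

theorem even_mem (f : Matrix (Fin 2) (Fin 2) k) : ((f, 0) : Space k) ∈ (S42 k).gr 0 :=
  mem_S42_even.mpr rfl

theorem odd_mem (v : Fin 2 → k) : ((0, v) : Space k) ∈ (S42 k).gr 1 := mem_S42_odd.mpr rfl

/-- In d₀(f • v) = d₁(f) • v + f • d₂(v) with v odd, f • v is odd as well, so only d₁(f) • v = 0
remains for all v. Left multiplication by a matrix on V is faithful. -/
theorem apply_even_eq_zero {d : Fin 3 → Module.End k (Space k)} (hd : d ∈ (S42 k).triGr 0)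
    (h0 : ∀ v, d 0 (0, v) = 0) (h2 : ∀ v, d 2 (0, v) = 0) (f : Matrix (Fin 2) (Fin 2) k) :
    d 1 (f, 0) = 0 := by
  have hg := (hd.1 1).1 0 _ (even_mem f)
  rw [add_zero, mem_S42_even] at hg
  have key (v : Fin 2 → k) := hd.2 0 _ (even_mem f) (0, v)
  have hv0 := key ![1, 0]
  have hv1 := key ![0, 1]
  have hp (v : Fin 2 → k) : (S42 k).mul (f, 0) (0, v) =
      (0, ![-(f 0 0 * v 0) - f 0 1 * v 1, -(f 1 0 * v 0) - f 1 1 * v 1]) := by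
    rw [S42_mul, paraMul_eq]
    apply space_ext <;> simp
  rw [hp, h0, h2, map_zero, smul_zero, add_zero, S42_mul, paraMul_eq] at hv0 hv1
  have e1 := congrFun (congrArg Prod.snd hv0) 0
  have e2 := congrFun (congrArg Prod.snd hv0) 1
  have e3 := congrFun (congrArg Prod.snd hv1) 0
  have e4 := congrFun (congrArg Prod.snd hv1) 1
  simp [hg] at e1 e2 e3 e4
  apply space_ext <;> simp [*]

/-- The three slots are treated alike by rotating the triple. -/
theorem triGr_even_eq_zero {d : Fin 3 → Module.End k (Space k)} (hd : d ∈ (S42 k).triGr 0)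
    (h : ∀ m v, d m (0, v) = 0) : d = 0 := by
  funext m
  refine endo_ext (fun f => ?_) (h m)
  match m with
  | 0 => exact apply_even_eq_zero ((S42 k).shift_mem hd) (h 2) (h 1) f
  | 1 => exact apply_even_eq_zero hd (h 0) (h 2) f
  | 2 => exact apply_even_eq_zero ((S42 k).shift_shift_mem hd) (h 1) (h 0) f

/-- The superform pairs the two halves of an odd operator, End(V) → V and V → End(V), so each
determines the other. -/
theorem osp_odd_eq_zero {d : Module.End k (Space k)} (hd : d ∈ (S42 k).osp 1)
    (h : ∀ v, d (0, v) = 0) : d = 0 := by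
  refine endo_ext (fun f => ?_) h
  have hg := hd.1 0 _ (even_mem f)
  rw [add_zero, mem_S42_odd] at hg
  refine Prod.ext hg (eq_zero_of_form fun v => ?_)
  have e := hd.2 1 _ (odd_mem v) (f, 0)
  simp [h, S42_b, b_eq] at e
  linear_combination -e

theorem osp_odd_eq_zero' {d : Module.End k (Space k)} (hd : d ∈ (S42 k).osp 1)
    (h : ∀ f, d (f, 0) = 0) : d = 0 := by
  refine endo_ext h fun v => ?_
  have hg := hd.1 1 _ (odd_mem v)
  rw [zmod2_one_add_one, mem_S42_even] at hg
  have e (f : Matrix (Fin 2) (Fin 2) k) := hd.2 1 _ (odd_mem v) (f, 0)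
  have e1 := e !![1, 0; 0, 0]
  have e2 := e !![0, 1; 0, 0]
  have e3 := e !![0, 0; 1, 0]
  have e4 := e !![0, 0; 0, 1]
  simp [h, S42_b, b_eq] at e1 e2 e3 e4
  apply space_ext <;> simp [*]

/-- Vanishing on V makes d₀ = 0 by `osp_odd_eq_zero`. What remains is d₁(f) • g + f • d₂(g) = 0 for
all matrices f and g, and matrix units force d₁ and then d₂ to vanish on End(V). -/
theorem triGr_odd_eq_zero {d : Fin 3 → Module.End k (Space k)} (hd : d ∈ (S42 k).triGr 1)
    (h : ∀ v, d 0 (0, v) = 0) : d = 0 := by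
  have h0 := osp_odd_eq_zero (hd.1 0) h
  have key (f g : Matrix (Fin 2) (Fin 2) k) : -(g 1 1 * (d 1 (f, 0)).2 0) +
        g 0 1 * (d 1 (f, 0)).2 1 - f 0 0 * (d 2 (g, 0)).2 0 - f 0 1 * (d 2 (g, 0)).2 1 = 0 ∧
      g 1 0 * (d 1 (f, 0)).2 0 - g 0 0 * (d 1 (f, 0)).2 1 - f 1 0 * (d 2 (g, 0)).2 0 -
        f 1 1 * (d 2 (g, 0)).2 1 = 0 := by
    have e := hd.2 0 _ (even_mem f) (g, 0)
    rw [h0, LinearMap.zero_apply, S42_mul, S42_mul, paraMul_eq (d 1 _), paraMul_eq (f, 0)] at e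
    have e0 := congrFun (congrArg Prod.snd e) 0
    have e1 := congrFun (congrArg Prod.snd e) 1
    simp at e0 e1
    constructor
    · linear_combination -e0
    · linear_combination -e1
  have hodd (m : Fin 3) (f : Matrix (Fin 2) (Fin 2) k) : (d m (f, 0)).1 = 0 := by
    have hg := (hd.1 m).1 0 _ (even_mem f)
    rwa [add_zero, mem_S42_odd] at hg
  -- If the top row of `f` is zero, d₂ drops out of the first coordinate of `key`, and two matrix
  -- units for `g` isolate the coordinates of d₁(f). The bottom row is handled by the second
  -- coordinate.
  have top (f : Matrix (Fin 2) (Fin 2) k) (h1 : f 0 0 = 0) (h2 : f 0 1 = 0) : d 1 (f, 0) = 0 := by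
    have a := (key f !![0, 0; 0, 1]).1
    have c := (key f !![0, 1; 0, 0]).1
    simp [h1, h2] at a c
    refine Prod.ext (hodd 1 f) (funext fun i => ?_)
    fin_cases i <;> assumption
  have bot (f : Matrix (Fin 2) (Fin 2) k) (h1 : f 1 0 = 0) (h2 : f 1 1 = 0) : d 1 (f, 0) = 0 := by
    have a := (key f !![0, 0; 1, 0]).2
    have c := (key f !![1, 0; 0, 0]).2
    simp [h1, h2] at a c
    refine Prod.ext (hodd 1 f) (funext fun i => ?_)
    fin_cases i <;> assumption
  have h1 : d 1 = 0 := by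
    refine osp_odd_eq_zero' (hd.1 1) fun f => ?_
    have hf : ((f, 0) : Space k) =
        (!![f 0 0, f 0 1; 0, 0], 0) + (!![0, 0; f 1 0, f 1 1], 0) := by
      apply space_ext <;> simp
    rw [hf, map_add, bot _ (by simp) (by simp), top _ (by simp) (by simp), add_zero]
  have h2 : d 2 = 0 := by
    refine osp_odd_eq_zero' (hd.1 2) fun g => ?_
    have a := (key !![1, 0; 0, 0] g).1
    have c := (key !![0, 1; 0, 0] g).1
    simp [h1] at a c
    refine Prod.ext (hodd 2 g) (funext fun i => ?_)
    fin_cases i <;> assumption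
  funext m
  match m with
  | 0 => exact h0
  | 1 => exact h1
  | 2 => exact h2

/-- Cuts the verification of an identity in the triality algebra down to odd test vectors. -/
theorem tri_ext_even {d e : (S42 k).tri} (hd : d ∈ (S42 k).triSuper.gr 0)
    (he : e ∈ (S42 k).triSuper.gr 0) (h : ∀ m v, d.1 m (0, v) = e.1 m (0, v)) : d = e := by
  rw [mem_triSuper_gr] at hd he
  have hde := sub_mem hd he
  exact sub_eq_zero.mp (Subtype.ext (triGr_even_eq_zero hde fun m v => sub_eq_zero.mpr (h m v)))

/-- For odd elements one slot is enough, in contrast to `tri_ext_even`. -/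
theorem tri_ext_odd {d e : (S42 k).tri} (hd : d ∈ (S42 k).triSuper.gr 1)
    (he : e ∈ (S42 k).triSuper.gr 1) (h : ∀ v, d.1 0 (0, v) = e.1 0 (0, v)) : d = e := by
  rw [mem_triSuper_gr] at hd he
  have hde := sub_mem hd he
  exact sub_eq_zero.mp (Subtype.ext (triGr_odd_eq_zero hde fun v => sub_eq_zero.mpr (h v)))

/-- The matrices are those of the d_m on V; after subtraction of the element they define, nothing is
left on odd vectors. -/
theorem exists_evenMap {d : Fin 3 → Module.End k (Space k)} (hd : d ∈ (S42 k).triGr 0) :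
    ∃ A : Fin 3 → Matrix (Fin 2) (Fin 2) k, (∀ m, A m 1 1 = -A m 0 0) ∧
      d = ![evenMap (A 0) (A 2) (A 1), evenMap (A 1) (A 0) (A 2), evenMap (A 2) (A 1) (A 0)] := by
  let A (m : Fin 3) : Matrix (Fin 2) (Fin 2) k :=
    !![(d m (0, ![1, 0])).2 0, (d m (0, ![0, 1])).2 0;
      (d m (0, ![1, 0])).2 1, (d m (0, ![0, 1])).2 1]
  -- Invariance of the alternating form on the two basis vectors of V is vanishing of the trace.
  have hA (m : Fin 3) : A m 1 1 = -A m 0 0 := by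
    have e := (hd.1 m).2 1 _ (odd_mem ![1, 0]) (0, ![0, 1])
    simp [S42_b, b_eq] at e
    simp only [A, Matrix.of_apply, Matrix.cons_val_zero, Matrix.cons_val_one]
    linear_combination e
  have hodd (m : Fin 3) (v : Fin 2 → k) : (d m (0, v)).1 = 0 := by
    have hg := (hd.1 m).1 1 _ (odd_mem v)
    rwa [zero_add, mem_S42_odd] at hg
  have hm (m : Fin 3) (B E : Matrix (Fin 2) (Fin 2) k) (v : Fin 2 → k) :
      d m (0, v) - evenMap (A m) B E (0, v) = 0 := by
    rw [apply_odd, evenMap_apply]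
    apply space_ext <;> simp [hodd, A] <;> ring
  refine ⟨A, hA, sub_eq_zero.mp (triGr_even_eq_zero (sub_mem hd (evenMap_mem_triGr hA)) ?_)⟩
  intro m v
  match m with
  | 0 => exact hm 0 _ _ v
  | 1 => exact hm 1 _ _ v
  | 2 => exact hm 2 _ _ v

theorem exists_oddMap {d : Fin 3 → Module.End k (Space k)} (hd : d ∈ (S42 k).triGr 1) :
    ∃ P : Fin 2 → Fin 2 → Fin 2 → k,
      d = ![oddMap P, oddMap fun i j l => P l i j, oddMap fun i j l => P j l i] := by
  -- These values solve the formula for `oddMap P` on the two basis vectors of V for the entries of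
  -- `P`.
  let P (i j l : Fin 2) : k := ![![(d 0 (0, ![0, 1])).1 l 1, -(d 0 (0, ![0, 1])).1 l 0],
    ![-(d 0 (0, ![1, 0])).1 l 1, (d 0 (0, ![1, 0])).1 l 0]] i j
  have heven (v : Fin 2 → k) : (d 0 (0, v)).2 = 0 := by
    have hg := (hd.1 0).1 1 _ (odd_mem v)
    rwa [zmod2_one_add_one, mem_S42_even] at hg
  refine ⟨P, sub_eq_zero.mp (triGr_odd_eq_zero (sub_mem hd (oddMap_mem_triGr P)) fun v => ?_)⟩
  change d 0 (0, v) - oddMap P (0, v) = 0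
  rw [apply_odd, oddMap_apply]
  apply space_ext <;> simp [heven, P] <;> ring

end B42

/-! ### Criterion for an isomorphism with g(S₁, S) -/

namespace Superalgebra

variable {k A A' : Type*} [Field k] [AddCommGroup A] [Module k A] [AddCommGroup A'] [Module k A']

variable (k A A') in
/-- The linear maps between two modules over a field. -/
abbrev LinearHom : Type _ := A →ₗ[k] A'

/-- A bijective linear map that preserves parities and products of homogeneous elements is an
isomorphism. -/
noncomputable def Iso.ofBijective {B : Superalgebra k A} {B' : Superalgebra k A'}
    (f : LinearHom k A A') (hf : Function.Bijective f)
    (map_mem : ∀ i, ∀ x ∈ B.gr i, f x ∈ B'.gr i)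
    (map_mul : ∀ i j, ∀ x ∈ B.gr i, ∀ y ∈ B.gr j, f (B.mul x y) = B'.mul (f x) (f y)) :
    B.Iso B' where
  toEquiv := LinearEquiv.ofBijective f hf
  map_mem := map_mem
  map_mul := by
    -- Both sides are bilinear, so homogeneous arguments decide.
    have h : B.mul.compr₂ f = B'.mul.compl₁₂ f f :=
      B.ext_hom fun i x hx => B.ext_hom fun j y hy => map_mul i j x hx y hy
    exact LinearMap.congr_fun₂ h

end Superalgebra

namespace SymmetricCompositionSuperalgebra

variable {k S A : Type*} [Field k] [AddCommGroup S] [Module k S] [AddCommGroup A] [Module k A]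

theorem tmul_one_injective {s t : S} (h : (1 : k) ⊗ₜ[k] s = 1 ⊗ₜ[k] t) : s = t := by
  have := congrArg (TensorProduct.lid k S) h
  simpa using this

theorem exists_tmul_one (z : k ⊗[k] S) : ∃ s : S, (1 : k) ⊗ₜ[k] s = z :=
  ⟨TensorProduct.lid k S z, by
    rw [← TensorProduct.lid_symm_apply, LinearEquiv.symm_apply_apply]⟩

/-- The linear map into `g(S₁, S)` with given coordinates in `tri(S)` and three copies of `S`. -/
def oneHom (h2 : (2 : k) ≠ 0) {C : SymmetricCompositionSuperalgebra k S} (D : Superalgebra.LinearHom k A C.tri)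
    (s : Superalgebra.LinearHom k A (Fin 3 → S)) : Superalgebra.LinearHom k A (MagicSpace (S1 k h2) C) where
  toFun X := oneElement h2 C (D X) (s X)
  map_add' X Y := by
    refine Prod.ext (add_zero _).symm (Prod.ext (map_add D X Y) (funext fun m => ?_))
    change (1 : k) ⊗ₜ[k] _ = (1 : k) ⊗ₜ[k] _ + (1 : k) ⊗ₜ[k] _
    rw [← TensorProduct.tmul_add, map_add]
    rfl
  map_smul' c X := by
    refine Prod.ext (smul_zero _).symm (Prod.ext (map_smul D c X) (funext fun m => ?_))
    change (1 : k) ⊗ₜ[k] _ = c • ((1 : k) ⊗ₜ[k] _)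
    rw [← TensorProduct.tmul_smul, map_smul]
    rfl

theorem oneHom_apply (h2 : (2 : k) ≠ 0) {C : SymmetricCompositionSuperalgebra k S}
    (D : Superalgebra.LinearHom k A C.tri) (s : Superalgebra.LinearHom k A (Fin 3 → S)) (X : A) :
    oneHom h2 D s X = oneElement h2 C (D X) (s X) := rfl

theorem oneHom_injective (h2 : (2 : k) ≠ 0) {C : SymmetricCompositionSuperalgebra k S}
    {D : Superalgebra.LinearHom k A C.tri} {s : Superalgebra.LinearHom k A (Fin 3 → S)} (h : ∀ X, D X = 0 → s X = 0 → X = 0) :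
    Function.Injective (oneHom h2 D s) := by
  rw [injective_iff_map_eq_zero]
  intro X hX
  rw [oneHom_apply] at hX
  have hD : (oneElement h2 C (D X) (s X)).2.1 = 0 := by rw [hX]; rfl
  have hs (m : Fin 3) : (oneElement h2 C (D X) (s X)).2.2 m = 0 := by rw [hX]; rfl
  refine h X hD (funext fun m => tmul_one_injective (k := k) ?_)
  exact (hs m).trans (TensorProduct.tmul_zero _ _).symm

theorem oneHom_surjective (h2 : (2 : k) ≠ 0) {C : SymmetricCompositionSuperalgebra k S}
    {D : Superalgebra.LinearHom k A C.tri} {s : Superalgebra.LinearHom k A (Fin 3 → S)} (h : ∀ (d : C.tri) (t : Fin 3 → S), ∃ X, D X = d ∧ s X = t) :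
    Function.Surjective (oneHom h2 D s) := by
  rintro ⟨d', d, z⟩
  choose t ht using fun m => exists_tmul_one (z m)
  obtain ⟨X, rfl, hX⟩ := h d t
  refine ⟨X, Prod.ext ((S1_tri_eq_zero h2 _).trans (S1_tri_eq_zero h2 _).symm)
    (Prod.ext rfl (funext fun m => Eq.trans ?_ (ht m)))⟩
  change (1 : k) ⊗ₜ[k] s X m = _
  rw [hX]

/-- A superalgebra is isomorphic to `g(S₁, S)` if it has the same structure constants with respect
to coordinates in `tri(S)` and three copies of `S`. -/
theorem nonempty_iso_magic (h2 : (2 : k) ≠ 0) (C : SymmetricCompositionSuperalgebra k S)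
    (B : Superalgebra k A) (D : Superalgebra.LinearHom k A C.tri) (s : Superalgebra.LinearHom k A (Fin 3 → S))
    (hD : ∀ {i : ZMod 2} {X : A}, X ∈ B.gr i → D X ∈ C.triSuper.gr i)
    (hs : ∀ {i : ZMod 2} {X : A}, X ∈ B.gr i → ∀ m, s X m ∈ C.gr i)
    (tri_mul : ∀ {i j : ZMod 2} {X Y : A}, X ∈ B.gr i → Y ∈ B.gr j →
      mulTri h2 C (D X) (D Y) (s X) (s Y) = D (B.mul X Y))
    (tensor_mul : ∀ {i j : ZMod 2} {X Y : A}, X ∈ B.gr i → Y ∈ B.gr j → ∀ m,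
      (D X).1 m (s Y m) - sg k (i * j) • (D Y).1 m (s X m) + C.mul (s X (m + 1)) (s Y (m + 2)) -
        sg k (i * j) • C.mul (s Y (m + 1)) (s X (m + 2)) = s (B.mul X Y) m)
    (inj : ∀ X : A, D X = 0 → s X = 0 → X = 0) (surj : ∀ (d : C.tri) (t : Fin 3 → S), ∃ X : A, D X = d ∧ s X = t) :
    Nonempty (B.Iso (magic (S1 k h2) C h2)) := by
  refine ⟨Superalgebra.Iso.ofBijective (oneHom h2 D s)
    ⟨oneHom_injective h2 inj, oneHom_surjective h2 surj⟩
    (fun i X hX => oneElement_mem h2 (hD hX) (hs hX)) fun i j X hX Y hY => ?_⟩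
  rw [oneHom_apply, oneHom_apply, oneHom_apply,
    magic_mul_oneElement h2 (hD hX) (hs hX) (hD hY) (hs hY), tri_mul hX hY,
    funext (tensor_mul hX hY)]

end SymmetricCompositionSuperalgebra

/-! ### Linear identification of sp₆ ⊕ V(ω₃) with tri(S_{4,2}) ⊕ S_{4,2}³ -/

namespace SpWedgeModel

open SymmetricCompositionSuperalgebra B42

variable {k : Type*} [Field k]

/-- The three `𝔰𝔩₂` components of an element of `sp₆`. -/
def sl2 (x : Fin 21 → k) : Fin 3 → Matrix (Fin 2) (Fin 2) k :=
  ![!![x 0, x 1; x 2, -x 0], !![x 3, x 4; x 5, -x 3], !![x 6, x 7; x 8, -x 6]]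

/-- The components of an element of `sp₆` that are even elements of `B(4,2)`. -/
def evenPart (x : Fin 21 → k) : Fin 3 → B42.Space k :=
  ![(!![x 9, x 10; x 11, x 12], 0), (!![x 13, x 14; x 15, x 16], 0),
    (!![x 17, x 18; x 19, x 20], 0)]

/-- The trilinear form that is a component of an element of `V(ω₃)`. -/
def cube (y : Fin 14 → k) (i j l : Fin 2) : k :=
  ![![![y 0, y 1], ![y 2, y 3]], ![![y 4, y 5], ![y 6, y 7]]] i j l

/-- The components of an element of `V(ω₃)` that are odd elements of `B(4,2)`. -/
def oddPart (y : Fin 14 → k) : Fin 3 → B42.Space k :=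
  ![(0, ![y 8, y 9]), (0, ![y 10, y 11]), (0, ![y 12, y 13])]

theorem sl2_trace (x : Fin 21 → k) (m : Fin 3) : sl2 x m 1 1 = -sl2 x m 0 0 := by
  fin_cases m <;> simp [sl2]

variable [CharP k 3]

theorem evenPart_mem (x : Fin 21 → k) (m : Fin 3) : evenPart x m ∈ (S42 k).gr 0 := by
  rw [mem_S42_even]
  fin_cases m <;> simp [evenPart]

theorem oddPart_mem (y : Fin 14 → k) (m : Fin 3) : oddPart y m ∈ (S42 k).gr 1 := by
  rw [mem_S42_odd]
  fin_cases m <;> simp [oddPart]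

/-- The component in `tri(S_{4,2})` of an element of `sp₆`. -/
noncomputable def evenTri (x : Fin 21 → k) : (S42 k).tri :=
  ⟨![evenMap (sl2 x 0) (sl2 x 2) (sl2 x 1), evenMap (sl2 x 1) (sl2 x 0) (sl2 x 2),
    evenMap (sl2 x 2) (sl2 x 1) (sl2 x 0)],
    (S42 k).triGr_le_tri 0 (evenMap_mem_triGr (sl2_trace x))⟩

/-- The component in `tri(S_{4,2})` of an element of `V(ω₃)`. -/
noncomputable def oddTri (y : Fin 14 → k) : (S42 k).tri :=
  ⟨![oddMap (cube y), oddMap fun i j l => cube y l i j, oddMap fun i j l => cube y j l i],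
    (S42 k).triGr_le_tri 1 (oddMap_mem_triGr (cube y))⟩

theorem evenTri_mem (x : Fin 21 → k) : evenTri x ∈ (S42 k).triSuper.gr 0 :=
  mem_triSuper_gr _ |>.mpr (evenMap_mem_triGr (sl2_trace x))

theorem oddTri_mem (y : Fin 14 → k) : oddTri y ∈ (S42 k).triSuper.gr 1 :=
  mem_triSuper_gr _ |>.mpr (oddMap_mem_triGr (cube y))

theorem evenTri_zero (x : Fin 21 → k) :
    (evenTri x).1 0 = evenMap (sl2 x 0) (sl2 x 2) (sl2 x 1) := rfl

theorem evenTri_one (x : Fin 21 → k) :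
    (evenTri x).1 1 = evenMap (sl2 x 1) (sl2 x 0) (sl2 x 2) := rfl

theorem evenTri_two (x : Fin 21 → k) :
    (evenTri x).1 2 = evenMap (sl2 x 2) (sl2 x 1) (sl2 x 0) := rfl

theorem oddTri_zero (y : Fin 14 → k) : (oddTri y).1 0 = oddMap (cube y) := rfl

theorem oddTri_one (y : Fin 14 → k) : (oddTri y).1 1 = oddMap fun i j l => cube y l i j := rfl

theorem oddTri_two (y : Fin 14 → k) : (oddTri y).1 2 = oddMap fun i j l => cube y j l i := rfl

theorem evenTri_add (x x' : Fin 21 → k) : evenTri (x + x') = evenTri x + evenTri x' := by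
  refine tri_ext_even (evenTri_mem _) (Submodule.add_mem _ (evenTri_mem _) (evenTri_mem _))
    fun m v => ?_
  change _ = (evenTri x).1 m (0, v) + (evenTri x').1 m (0, v)
  fin_cases m <;> simp only [Fin.zero_eta, Fin.mk_one, Fin.reduceFinMk, evenTri_zero, evenTri_one,
    evenTri_two, evenMap_apply] <;> apply space_ext <;> simp [sl2] <;> ring

theorem evenTri_smul (c : k) (x : Fin 21 → k) : evenTri (c • x) = c • evenTri x := by
  refine tri_ext_even (evenTri_mem _) (Submodule.smul_mem _ _ (evenTri_mem _)) fun m v => ?_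
  change _ = c • (evenTri x).1 m (0, v)
  fin_cases m <;> simp only [Fin.zero_eta, Fin.mk_one, Fin.reduceFinMk, evenTri_zero, evenTri_one,
    evenTri_two, evenMap_apply] <;> apply space_ext <;> simp [sl2] <;> ring

theorem oddTri_add (y y' : Fin 14 → k) : oddTri (y + y') = oddTri y + oddTri y' := by
  refine tri_ext_odd (oddTri_mem _) (Submodule.add_mem _ (oddTri_mem _) (oddTri_mem _)) fun v => ?_
  change _ = (oddTri y).1 0 (0, v) + (oddTri y').1 0 (0, v)
  simp only [oddTri_zero, oddMap_apply]
  apply space_ext <;> simp [cube] <;> ring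

theorem oddTri_smul (c : k) (y : Fin 14 → k) : oddTri (c • y) = c • oddTri y := by
  refine tri_ext_odd (oddTri_mem _) (Submodule.smul_mem _ _ (oddTri_mem _)) fun v => ?_
  change _ = c • (oddTri y).1 0 (0, v)
  simp only [oddTri_zero, oddMap_apply]
  apply space_ext <;> simp [cube] <;> ring

variable (k) in
/-- The component in `tri(S_{4,2})` of an element of `sp₆ ⊕ V(ω₃)`. -/
noncomputable def triHom : Superalgebra.LinearHom k (Space k) (S42 k).tri where
  toFun X := evenTri X.1 + oddTri X.2
  map_add' X Y := by
    rw [Prod.fst_add, Prod.snd_add, evenTri_add, oddTri_add, add_add_add_comm]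
  map_smul' c X := by
    rw [Prod.smul_fst, Prod.smul_snd, evenTri_smul, oddTri_smul, RingHom.id_apply, smul_add]

variable (k) in
/-- The components of an element of `sp₆ ⊕ V(ω₃)` in the three copies of `S_{4,2}`. -/
noncomputable def partHom : Superalgebra.LinearHom k (Space k) (Fin 3 → B42.Space k) where
  toFun X m := evenPart X.1 m + oddPart X.2 m
  map_add' X Y := by
    funext m
    fin_cases m <;> apply space_ext <;> simp [evenPart, oddPart]
  map_smul' c X := by
    funext m
    fin_cases m <;> apply space_ext <;> simp [evenPart, oddPart]

theorem triHom_apply (X : Space k) : triHom k X = evenTri X.1 + oddTri X.2 := rfl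

theorem partHom_apply (X : Space k) (m : Fin 3) :
    partHom k X m = evenPart X.1 m + oddPart X.2 m := rfl

theorem evenTri_map_zero : evenTri (0 : Fin 21 → k) = 0 := by
  simpa using evenTri_smul (0 : k) 0

theorem oddTri_map_zero : oddTri (0 : Fin 14 → k) = 0 := by
  simpa using oddTri_smul (0 : k) 0

theorem evenPart_map_zero (m : Fin 3) : evenPart (0 : Fin 21 → k) m = 0 := by
  fin_cases m <;> apply space_ext <;> simp [evenPart]

theorem oddPart_map_zero (m : Fin 3) : oddPart (0 : Fin 14 → k) m = 0 := by
  fin_cases m <;> apply space_ext <;> simp [oddPart]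

theorem triHom_even (x : Fin 21 → k) : triHom k (x, 0) = evenTri x := by
  rw [triHom_apply, oddTri_map_zero, add_zero]

theorem triHom_odd (y : Fin 14 → k) : triHom k (0, y) = oddTri y := by
  rw [triHom_apply, evenTri_map_zero, zero_add]

theorem partHom_even (x : Fin 21 → k) : partHom k (x, 0) = evenPart x := by
  funext m
  rw [partHom_apply, oddPart_map_zero, add_zero]

theorem partHom_odd (y : Fin 14 → k) : partHom k (0, y) = oddPart y := by
  funext m
  rw [partHom_apply, evenPart_map_zero, zero_add]

/-- On odd vectors, slot `m` is just the matrix `sl2 x m`. -/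
theorem sl2_of_evenTri_eq_zero {x : Fin 21 → k} (h : evenTri x = 0) (m : Fin 3) : sl2 x m = 0 := by
  have key (m : Fin 3) (v : Fin 2 → k) : (evenTri x).1 m (0, v) = 0 := by rw [h]; rfl
  have k1 := key m ![1, 0]
  have k2 := key m ![0, 1]
  have e1 := congrFun (congrArg Prod.snd k1)
  have e2 := congrFun (congrArg Prod.snd k2)
  ext a c
  fin_cases m <;> simp [evenTri_zero, evenTri_one, evenTri_two, evenMap_apply, Fin.forall_fin_two]
    at e1 e2 <;> fin_cases a <;> fin_cases c <;> simp [*]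

theorem cube_of_oddTri_eq_zero {y : Fin 14 → k} (h : oddTri y = 0) (i j l : Fin 2) :
    cube y i j l = 0 := by
  have key (v : Fin 2 → k) : (oddTri y).1 0 (0, v) = 0 := by rw [h]; rfl
  have k1 := congrArg Prod.fst (key ![1, 0])
  have k2 := congrArg Prod.fst (key ![0, 1])
  have e1 (a c : Fin 2) := congrFun (congrFun k1 a) c
  have e2 (a c : Fin 2) := congrFun (congrFun k2 a) c
  simp [oddTri_zero, oddMap_apply, Fin.forall_fin_two] at e1 e2
  fin_cases i <;> fin_cases j <;> fin_cases l <;> simp [*]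

theorem eq_zero_of_triHom {X : Space k} (ht : triHom k X = 0) (hs : partHom k X = 0) : X = 0 := by
  rw [triHom_apply] at ht
  have he : evenTri X.1 = 0 := by
    -- The common value is both even and odd, hence zero.
    have e : (evenTri X.1).1 = -(oddTri X.2).1 :=
      eq_neg_of_add_eq_zero_left (congrArg Subtype.val ht)
    refine Subtype.ext ((S42 k).triples.eq_zero_of_mem (evenTri_mem X.1) ?_)
    rw [e]
    exact neg_mem (oddTri_mem X.2)
  rw [he, zero_add] at ht
  have hA := sl2_of_evenTri_eq_zero he
  have hP := cube_of_oddTri_eq_zero ht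
  have hA' (m : Fin 3) (a c : Fin 2) : sl2 X.1 m a c = 0 := by rw [hA]; rfl
  have h1 (m : Fin 3) (a c : Fin 2) := congrFun (congrFun (congrArg Prod.fst (congrFun hs m)) a) c
  have h2 (m : Fin 3) (a : Fin 2) := congrFun (congrArg Prod.snd (congrFun hs m)) a
  simp [Fin.forall_fin_two, Fin.forall_fin_succ, sl2, cube, partHom_apply, evenPart, oddPart] at hA' hP h1 h2
  refine Prod.ext (funext fun i => ?_) (funext fun i => ?_)
  · fin_cases i <;> simp [*]
  · fin_cases i <;> simp [*]

theorem exists_triHom (e : (S42 k).tri) (s : Fin 3 → B42.Space k) :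
    ∃ X, triHom k X = e ∧ partHom k X = s := by
  obtain ⟨e, he⟩ := e
  obtain ⟨e0, he0, e1, he1, rfl⟩ := (S42 k).mem_tri.mp he
  obtain ⟨A, hA, rfl⟩ := exists_evenMap he0
  obtain ⟨P, rfl⟩ := exists_oddMap he1
  -- The coordinates are read off the normal forms of the two parity components and the entries of
  -- the three vectors of S_{4,2}.
  refine ⟨(![A 0 0 0, A 0 0 1, A 0 1 0, A 1 0 0, A 1 0 1, A 1 1 0, A 2 0 0, A 2 0 1, A 2 1 0,
    (s 0).1 0 0, (s 0).1 0 1, (s 0).1 1 0, (s 0).1 1 1, (s 1).1 0 0, (s 1).1 0 1, (s 1).1 1 0,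
    (s 1).1 1 1, (s 2).1 0 0, (s 2).1 0 1, (s 2).1 1 0, (s 2).1 1 1],
    ![P 0 0 0, P 0 0 1, P 0 1 0, P 0 1 1, P 1 0 0, P 1 0 1, P 1 1 0, P 1 1 1, (s 0).2 0, (s 0).2 1,
      (s 1).2 0, (s 1).2 1, (s 2).2 0, (s 2).2 1]), ?_⟩
  refine ⟨Subtype.ext ?_, funext fun m => ?_⟩
  · rw [triHom_apply]
    change _ + _ = _ + _
    refine congrArg₂ (· + ·) ?_ ?_
    · have hA' (m : Fin 3) : A m = !![A m 0 0, A m 0 1; A m 1 0, -A m 0 0] := by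
        ext a c
        fin_cases a <;> fin_cases c <;> simp [hA]
      rw [hA' 0, hA' 1, hA' 2]
      rfl
    · have hP : P = fun i j l => ![![![P 0 0 0, P 0 0 1], ![P 0 1 0, P 0 1 1]],
          ![![P 1 0 0, P 1 0 1], ![P 1 1 0, P 1 1 1]]] i j l := by
        funext i j l
        fin_cases i <;> fin_cases j <;> fin_cases l <;> rfl
      rw [hP]
      rfl
  · fin_cases m <;> apply space_ext <;> simp [partHom_apply, evenPart, oddPart]

end SpWedgeModel

/-! ### Comparison of structure constants: even times even -/

namespace SpWedgeModel

open SymmetricCompositionSuperalgebra B42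

variable {k : Type*} [Field k]

variable [CharP k 3]

set_option maxHeartbeats 1000000 in
-- Slot 0 of the product formula `tensor_mul` in `nonempty_iso_magic`, with `m + 1` and `m + 2`
-- evaluated; the other slots and parities follow the same pattern.
theorem even_even_tensor_zero (x x' : Fin 21 → k) :
    (evenTri x).1 0 (evenPart x' 0) - sg k (0 * 0) • (evenTri x').1 0 (evenPart x 0) +
      (S42 k).mul (evenPart x 1) (evenPart x' 2) -
      sg k (0 * 0) • (S42 k).mul (evenPart x' 1) (evenPart x 2) =
      evenPart (evenBracket x x') 0 := by
  simp only [evenTri_zero, evenMap_apply, S42_mul, paraMul_eq]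
  apply space_ext <;> simp [sl2, evenPart, evenBracket] <;> ring

set_option maxHeartbeats 1000000 in
theorem even_even_tensor_one (x x' : Fin 21 → k) :
    (evenTri x).1 1 (evenPart x' 1) - sg k (0 * 0) • (evenTri x').1 1 (evenPart x 1) +
      (S42 k).mul (evenPart x 2) (evenPart x' 0) -
      sg k (0 * 0) • (S42 k).mul (evenPart x' 2) (evenPart x 0) =
      evenPart (evenBracket x x') 1 := by
  simp only [evenTri_one, evenMap_apply, S42_mul, paraMul_eq]
  apply space_ext <;> simp [sl2, evenPart, evenBracket] <;> ring

set_option maxHeartbeats 1000000 in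
theorem even_even_tensor_two (x x' : Fin 21 → k) :
    (evenTri x).1 2 (evenPart x' 2) - sg k (0 * 0) • (evenTri x').1 2 (evenPart x 2) +
      (S42 k).mul (evenPart x 0) (evenPart x' 1) -
      sg k (0 * 0) • (S42 k).mul (evenPart x' 0) (evenPart x 1) =
      evenPart (evenBracket x x') 2 := by
  simp only [evenTri_two, evenMap_apply, S42_mul, paraMul_eq]
  apply space_ext <;> simp [sl2, evenPart, evenBracket] <;> ring

set_option maxHeartbeats 1000000 in
-- The left side is `mulTri_apply` on a general odd vector; by `tri_ext_even` no other test vectors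
-- are needed, but all three slots are.
theorem even_even_tri_zero (x x' : Fin 21 → k) (p q : k) :
    (evenTri x).1 0 ((evenTri x').1 0 (0, ![p, q])) -
      sg k (0 * 0) • (evenTri x').1 0 ((evenTri x).1 0 (0, ![p, q])) +
        (((S42 k).b (evenPart x 1) (evenPart x' 1) +
            (S42 k).b (evenPart x 2) (evenPart x' 2)) • (0, ![p, q]) +
          (sg k (0 * (0 + 1)) * (S42 k).b (evenPart x' 0) (0, ![p, q])) • evenPart x 0 -
          (sg k (0 * 1) * (S42 k).b (evenPart x 0) (0, ![p, q])) • evenPart x' 0 +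
          sg k (0 * 1) •
            (S42 k).mul (evenPart x 1) ((S42 k).mul (0, ![p, q]) (evenPart x' 1)) +
          sg k (0 * (0 + 1)) •
            (S42 k).mul ((S42 k).mul (evenPart x' 2) (0, ![p, q])) (evenPart x 2)) =
      (evenTri (evenBracket x x')).1 0 (0, ![p, q]) := by
  have h3 : (3 : k) = 0 := by exact_mod_cast CharP.cast_eq_zero k 3
  simp only [evenTri_zero, evenMap_apply, S42_mul, S42_b, paraMul_eq, b_eq]
  apply space_ext <;> simp [sl2, evenPart, evenBracket] <;> grind

set_option maxHeartbeats 1000000 in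
theorem even_even_tri_one (x x' : Fin 21 → k) (p q : k) :
    (evenTri x).1 1 ((evenTri x').1 1 (0, ![p, q])) -
      sg k (0 * 0) • (evenTri x').1 1 ((evenTri x).1 1 (0, ![p, q])) +
        (((S42 k).b (evenPart x 2) (evenPart x' 2) +
            (S42 k).b (evenPart x 0) (evenPart x' 0)) • (0, ![p, q]) +
          (sg k (0 * (0 + 1)) * (S42 k).b (evenPart x' 1) (0, ![p, q])) • evenPart x 1 -
          (sg k (0 * 1) * (S42 k).b (evenPart x 1) (0, ![p, q])) • evenPart x' 1 +
          sg k (0 * 1) •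
            (S42 k).mul (evenPart x 2) ((S42 k).mul (0, ![p, q]) (evenPart x' 2)) +
          sg k (0 * (0 + 1)) •
            (S42 k).mul ((S42 k).mul (evenPart x' 0) (0, ![p, q])) (evenPart x 0)) =
      (evenTri (evenBracket x x')).1 1 (0, ![p, q]) := by
  have h3 : (3 : k) = 0 := by exact_mod_cast CharP.cast_eq_zero k 3
  simp only [evenTri_one, evenMap_apply, S42_mul, S42_b, paraMul_eq, b_eq]
  apply space_ext <;> simp [sl2, evenPart, evenBracket] <;> grind

set_option maxHeartbeats 1000000 in
theorem even_even_tri_two (x x' : Fin 21 → k) (p q : k) :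
    (evenTri x).1 2 ((evenTri x').1 2 (0, ![p, q])) -
      sg k (0 * 0) • (evenTri x').1 2 ((evenTri x).1 2 (0, ![p, q])) +
        (((S42 k).b (evenPart x 0) (evenPart x' 0) +
            (S42 k).b (evenPart x 1) (evenPart x' 1)) • (0, ![p, q]) +
          (sg k (0 * (0 + 1)) * (S42 k).b (evenPart x' 2) (0, ![p, q])) • evenPart x 2 -
          (sg k (0 * 1) * (S42 k).b (evenPart x 2) (0, ![p, q])) • evenPart x' 2 +
          sg k (0 * 1) •
            (S42 k).mul (evenPart x 0) ((S42 k).mul (0, ![p, q]) (evenPart x' 0)) +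
          sg k (0 * (0 + 1)) •
            (S42 k).mul ((S42 k).mul (evenPart x' 1) (0, ![p, q])) (evenPart x 1)) =
      (evenTri (evenBracket x x')).1 2 (0, ![p, q]) := by
  have h3 : (3 : k) = 0 := by exact_mod_cast CharP.cast_eq_zero k 3
  simp only [evenTri_two, evenMap_apply, S42_mul, S42_b, paraMul_eq, b_eq]
  apply space_ext <;> simp [sl2, evenPart, evenBracket] <;> grind

end SpWedgeModel

/-! ### Comparison of structure constants: even times odd -/

namespace SpWedgeModel

open SymmetricCompositionSuperalgebra B42

variable {k : Type*} [Field k]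

variable [CharP k 3]

set_option maxHeartbeats 1000000 in
theorem even_odd_tensor_zero (x : Fin 21 → k) (y : Fin 14 → k) :
    (evenTri x).1 0 (oddPart y 0) - sg k (0 * 1) • (oddTri y).1 0 (evenPart x 0) +
      (S42 k).mul (evenPart x 1) (oddPart y 2) -
      sg k (0 * 1) • (S42 k).mul (oddPart y 1) (evenPart x 2) =
      oddPart (action x y) 0 := by
  simp only [evenTri_zero, oddTri_zero, evenMap_apply, oddMap_apply, S42_mul, paraMul_eq]
  apply space_ext <;> simp [sl2, cube, evenPart, oddPart, action] <;> ring

set_option maxHeartbeats 1000000 in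
theorem even_odd_tensor_one (x : Fin 21 → k) (y : Fin 14 → k) :
    (evenTri x).1 1 (oddPart y 1) - sg k (0 * 1) • (oddTri y).1 1 (evenPart x 1) +
      (S42 k).mul (evenPart x 2) (oddPart y 0) -
      sg k (0 * 1) • (S42 k).mul (oddPart y 2) (evenPart x 0) =
      oddPart (action x y) 1 := by
  simp only [evenTri_one, oddTri_one, evenMap_apply, oddMap_apply, S42_mul, paraMul_eq]
  apply space_ext <;> simp [sl2, cube, evenPart, oddPart, action] <;> ring

set_option maxHeartbeats 1000000 in
theorem even_odd_tensor_two (x : Fin 21 → k) (y : Fin 14 → k) :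
    (evenTri x).1 2 (oddPart y 2) - sg k (0 * 1) • (oddTri y).1 2 (evenPart x 2) +
      (S42 k).mul (evenPart x 0) (oddPart y 1) -
      sg k (0 * 1) • (S42 k).mul (oddPart y 0) (evenPart x 1) =
      oddPart (action x y) 2 := by
  simp only [evenTri_two, oddTri_two, evenMap_apply, oddMap_apply, S42_mul, paraMul_eq]
  apply space_ext <;> simp [sl2, cube, evenPart, oddPart, action] <;> ring

set_option maxHeartbeats 1000000 in
-- The product is odd, so by `tri_ext_odd` this slot decides.
theorem even_odd_tri_zero (x : Fin 21 → k) (y : Fin 14 → k) (p q : k) :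
    (evenTri x).1 0 ((oddTri y).1 0 (0, ![p, q])) -
      sg k (0 * 1) • (oddTri y).1 0 ((evenTri x).1 0 (0, ![p, q])) +
        (((S42 k).b (evenPart x 1) (oddPart y 1) +
            (S42 k).b (evenPart x 2) (oddPart y 2)) • (0, ![p, q]) +
          (sg k (0 * (1 + 1)) * (S42 k).b (oddPart y 0) (0, ![p, q])) • evenPart x 0 -
          (sg k (1 * 1) * (S42 k).b (evenPart x 0) (0, ![p, q])) • oddPart y 0 +
          sg k (1 * 1) •
            (S42 k).mul (evenPart x 1) ((S42 k).mul (0, ![p, q]) (oddPart y 1)) +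
          sg k (0 * (1 + 1)) •
            (S42 k).mul ((S42 k).mul (oddPart y 2) (0, ![p, q])) (evenPart x 2)) =
      (oddTri (action x y)).1 0 (0, ![p, q]) := by
  have h3 : (3 : k) = 0 := by exact_mod_cast CharP.cast_eq_zero k 3
  simp only [evenTri_zero, oddTri_zero, evenMap_apply, oddMap_apply, S42_mul, S42_b, paraMul_eq, b_eq]
  apply space_ext <;> simp [sl2, cube, evenPart, oddPart, action, zmod2_one_add_one] <;> grind

end SpWedgeModel

namespace SpWedgeModel

open SymmetricCompositionSuperalgebra B42

variable {k : Type*} [Field k] [CharP k 3]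

/-- The operators σ are visibly super-skew, and by `tri_ext_odd` they already determine the odd
triple. -/
theorem t_add_t (h2 : (2 : k) ≠ 0) {x y : B42.Space k} (hx : x ∈ (S42 k).gr 0)
    (hy : y ∈ (S42 k).gr 1) : (S42 k).t h2 x y + (S42 k).t h2 y x = 0 := by
  have h := (S42 k).t_mem h2 hx hy
  have h' := (S42 k).t_mem h2 hy hx
  rw [zero_add] at h
  rw [add_zero] at h'
  refine tri_ext_odd (Submodule.add_mem _ h h') (Submodule.zero_mem _) fun v => ?_
  change ((S42 k).t h2 x y).1 0 (0, v) + ((S42 k).t h2 y x).1 0 (0, v) = 0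
  rw [(S42 k).t_zero_apply h2 hy hx (odd_mem v), (S42 k).t_zero_apply h2 hx hy (odd_mem v)]
  simp only [zero_mul, one_mul, zero_add, sg_zero]
  abel

theorem triSuper_mul_add_mul {d e : (S42 k).tri} (hd : d ∈ (S42 k).triSuper.gr 0)
    (he : e ∈ (S42 k).triSuper.gr 1) :
    (S42 k).triSuper.mul d e + (S42 k).triSuper.mul e d = 0 := by
  have h := (S42 k).triSuper.mul_mem hd he
  have h' := (S42 k).triSuper.mul_mem he hd
  rw [zero_add] at h
  rw [add_zero] at h'
  refine tri_ext_odd (Submodule.add_mem _ h h') (Submodule.zero_mem _) fun v => ?_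
  change ((S42 k).triSuper.mul d e).1 0 (0, v) + ((S42 k).triSuper.mul e d).1 0 (0, v) = 0
  rw [triSuper_mul_apply _ he hd, triSuper_mul_apply _ hd he]
  simp

/-- With one even factor the sign is trivial, so the left side is the negative of the one in `h`. -/
theorem odd_even_tensor (x : Fin 21 → k) (y : Fin 14 → k) (m : Fin 3)
    (h : (evenTri x).1 m (oddPart y m) - sg k (0 * 1) • (oddTri y).1 m (evenPart x m) +
      (S42 k).mul (evenPart x (m + 1)) (oddPart y (m + 2)) -
      sg k (0 * 1) • (S42 k).mul (oddPart y (m + 1)) (evenPart x (m + 2)) =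
      oddPart (action x y) m) :
    (oddTri y).1 m (evenPart x m) - sg k (1 * 0) • (evenTri x).1 m (oddPart y m) +
      (S42 k).mul (oddPart y (m + 1)) (evenPart x (m + 2)) -
      sg k (1 * 0) • (S42 k).mul (evenPart x (m + 1)) (oddPart y (m + 2)) =
      oddPart (-action x y) m := by
  have hneg : oddPart (-action x y) m = -oddPart (action x y) m := by
    fin_cases m <;> apply space_ext <;> simp [oddPart]
  rw [hneg, ← h]
  simp only [mul_zero, zero_mul, sg_zero, one_smul]
  abel

end SpWedgeModel

/-! ### Comparison of structure constants: odd times odd -/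

namespace SpWedgeModel

open SymmetricCompositionSuperalgebra B42

variable {k : Type*} [Field k]

variable [CharP k 3]

set_option maxHeartbeats 1000000 in
-- The odd-odd comparisons fix the normalisation of `oddBracket`; its coefficients need to match
-- only modulo 3.
theorem odd_odd_tensor_zero (y y' : Fin 14 → k) :
    (oddTri y).1 0 (oddPart y' 0) - sg k (1 * 1) • (oddTri y').1 0 (oddPart y 0) +
      (S42 k).mul (oddPart y 1) (oddPart y' 2) -
      sg k (1 * 1) • (S42 k).mul (oddPart y' 1) (oddPart y 2) =
      evenPart (oddBracket y y') 0 := by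
  have h3 : (3 : k) = 0 := by exact_mod_cast CharP.cast_eq_zero k 3
  simp only [oddTri_zero, oddMap_apply, S42_mul, paraMul_eq]
  apply space_ext <;> simp [sl2, cube, evenPart, oddPart, oddBracket] <;> grind

set_option maxHeartbeats 1000000 in
theorem odd_odd_tensor_one (y y' : Fin 14 → k) :
    (oddTri y).1 1 (oddPart y' 1) - sg k (1 * 1) • (oddTri y').1 1 (oddPart y 1) +
      (S42 k).mul (oddPart y 2) (oddPart y' 0) -
      sg k (1 * 1) • (S42 k).mul (oddPart y' 2) (oddPart y 0) =
      evenPart (oddBracket y y') 1 := by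
  have h3 : (3 : k) = 0 := by exact_mod_cast CharP.cast_eq_zero k 3
  simp only [oddTri_one, oddMap_apply, S42_mul, paraMul_eq]
  apply space_ext <;> simp [sl2, cube, evenPart, oddPart, oddBracket] <;> grind

set_option maxHeartbeats 1000000 in
theorem odd_odd_tensor_two (y y' : Fin 14 → k) :
    (oddTri y).1 2 (oddPart y' 2) - sg k (1 * 1) • (oddTri y').1 2 (oddPart y 2) +
      (S42 k).mul (oddPart y 0) (oddPart y' 1) -
      sg k (1 * 1) • (S42 k).mul (oddPart y' 0) (oddPart y 1) =
      evenPart (oddBracket y y') 2 := by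
  have h3 : (3 : k) = 0 := by exact_mod_cast CharP.cast_eq_zero k 3
  simp only [oddTri_two, oddMap_apply, S42_mul, paraMul_eq]
  apply space_ext <;> simp [sl2, cube, evenPart, oddPart, oddBracket] <;> grind

set_option maxHeartbeats 1000000 in
theorem odd_odd_tri_zero (y y' : Fin 14 → k) (p q : k) :
    (oddTri y).1 0 ((oddTri y').1 0 (0, ![p, q])) -
      sg k (1 * 1) • (oddTri y').1 0 ((oddTri y).1 0 (0, ![p, q])) +
        (((S42 k).b (oddPart y 1) (oddPart y' 1) +
            (S42 k).b (oddPart y 2) (oddPart y' 2)) • (0, ![p, q]) +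
          (sg k (1 * (1 + 1)) * (S42 k).b (oddPart y' 0) (0, ![p, q])) • oddPart y 0 -
          (sg k (1 * 1) * (S42 k).b (oddPart y 0) (0, ![p, q])) • oddPart y' 0 +
          sg k (1 * 1) •
            (S42 k).mul (oddPart y 1) ((S42 k).mul (0, ![p, q]) (oddPart y' 1)) +
          sg k (1 * (1 + 1)) •
            (S42 k).mul ((S42 k).mul (oddPart y' 2) (0, ![p, q])) (oddPart y 2)) =
      (evenTri (oddBracket y y')).1 0 (0, ![p, q]) := by
  have h3 : (3 : k) = 0 := by exact_mod_cast CharP.cast_eq_zero k 3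
  simp only [evenTri_zero, oddTri_zero, evenMap_apply, oddMap_apply, S42_mul, S42_b, paraMul_eq, b_eq]
  apply space_ext <;> simp [sl2, cube, evenPart, oddPart, oddBracket, zmod2_one_add_one] <;> grind

set_option maxHeartbeats 1000000 in
theorem odd_odd_tri_one (y y' : Fin 14 → k) (p q : k) :
    (oddTri y).1 1 ((oddTri y').1 1 (0, ![p, q])) -
      sg k (1 * 1) • (oddTri y').1 1 ((oddTri y).1 1 (0, ![p, q])) +
        (((S42 k).b (oddPart y 2) (oddPart y' 2) +
            (S42 k).b (oddPart y 0) (oddPart y' 0)) • (0, ![p, q]) +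
          (sg k (1 * (1 + 1)) * (S42 k).b (oddPart y' 1) (0, ![p, q])) • oddPart y 1 -
          (sg k (1 * 1) * (S42 k).b (oddPart y 1) (0, ![p, q])) • oddPart y' 1 +
          sg k (1 * 1) •
            (S42 k).mul (oddPart y 2) ((S42 k).mul (0, ![p, q]) (oddPart y' 2)) +
          sg k (1 * (1 + 1)) •
            (S42 k).mul ((S42 k).mul (oddPart y' 0) (0, ![p, q])) (oddPart y 0)) =
      (evenTri (oddBracket y y')).1 1 (0, ![p, q]) := by
  have h3 : (3 : k) = 0 := by exact_mod_cast CharP.cast_eq_zero k 3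
  simp only [evenTri_one, oddTri_one, evenMap_apply, oddMap_apply, S42_mul, S42_b, paraMul_eq, b_eq]
  apply space_ext <;> simp [sl2, cube, evenPart, oddPart, oddBracket, zmod2_one_add_one] <;> grind

set_option maxHeartbeats 1000000 in
theorem odd_odd_tri_two (y y' : Fin 14 → k) (p q : k) :
    (oddTri y).1 2 ((oddTri y').1 2 (0, ![p, q])) -
      sg k (1 * 1) • (oddTri y').1 2 ((oddTri y).1 2 (0, ![p, q])) +
        (((S42 k).b (oddPart y 0) (oddPart y' 0) +
            (S42 k).b (oddPart y 1) (oddPart y' 1)) • (0, ![p, q]) +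
          (sg k (1 * (1 + 1)) * (S42 k).b (oddPart y' 2) (0, ![p, q])) • oddPart y 2 -
          (sg k (1 * 1) * (S42 k).b (oddPart y 2) (0, ![p, q])) • oddPart y' 2 +
          sg k (1 * 1) •
            (S42 k).mul (oddPart y 0) ((S42 k).mul (0, ![p, q]) (oddPart y' 0)) +
          sg k (1 * (1 + 1)) •
            (S42 k).mul ((S42 k).mul (oddPart y' 1) (0, ![p, q])) (oddPart y 1)) =
      (evenTri (oddBracket y y')).1 2 (0, ![p, q]) := by
  have h3 : (3 : k) = 0 := by exact_mod_cast CharP.cast_eq_zero k 3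
  simp only [evenTri_two, oddTri_two, evenMap_apply, oddMap_apply, S42_mul, S42_b, paraMul_eq, b_eq]
  apply space_ext <;> simp [sl2, cube, evenPart, oddPart, oddBracket, zmod2_one_add_one] <;> grind

end SpWedgeModel

/-! ### The isomorphism with g(S₁, S_{4,2}) -/

namespace SpWedgeModel

open SymmetricCompositionSuperalgebra B42

theorem eq_cons {α : Type*} (v : Fin 2 → α) : v = ![v 0, v 1] := by
  ext i
  fin_cases i <;> rfl

variable {k : Type*} [Field k] [CharP k 3]

theorem even_even_tri (h2 : (2 : k) ≠ 0) (x x' : Fin 21 → k) :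
    mulTri h2 (S42 k) (evenTri x) (evenTri x') (evenPart x) (evenPart x') = evenTri (evenBracket x x') := by
  refine tri_ext_even (mulTri_mem _ _ (zero_add 0) (evenTri_mem x) (evenPart_mem x) (evenTri_mem x')
    (evenPart_mem x')) (evenTri_mem _) fun m v => ?_
  rw [mulTri_apply _ _ (evenTri_mem x) (evenPart_mem x) (evenTri_mem x')
    (evenPart_mem x') m (odd_mem v), eq_cons v]
  match m with
  | 0 => exact even_even_tri_zero x x' _ _
  | 1 => exact even_even_tri_one x x' _ _
  | 2 => exact even_even_tri_two x x' _ _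

theorem even_odd_tri (h2 : (2 : k) ≠ 0) (x : Fin 21 → k) (y : Fin 14 → k) :
    mulTri h2 (S42 k) (evenTri x) (oddTri y) (evenPart x) (oddPart y) = oddTri (action x y) := by
  refine tri_ext_odd (mulTri_mem _ _ (zero_add 1) (evenTri_mem x) (evenPart_mem x) (oddTri_mem y)
    (oddPart_mem y)) (oddTri_mem _) fun v => ?_
  rw [mulTri_apply _ _ (evenTri_mem x) (evenPart_mem x) (oddTri_mem y)
    (oddPart_mem y) 0 (odd_mem v), eq_cons v]
  exact even_odd_tri_zero x y _ _

/-- Derived from `even_odd_tri` by super-anticommutativity, not computed again. -/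
theorem odd_even_tri (h2 : (2 : k) ≠ 0) (x : Fin 21 → k) (y : Fin 14 → k) :
    mulTri h2 (S42 k) (oddTri y) (evenTri x) (oddPart y) (evenPart x) = oddTri (-action x y) := by
  refine tri_eq_of_add_eq_zero (S42 k) (x := oddTri (action x y)) ?_ ?_
  · rw [← even_odd_tri h2]
    exact mulTri_add_mulTri h2 (S42 k) (triSuper_mul_add_mul (evenTri_mem x) (oddTri_mem y))
      fun q => t_add_t h2 (evenPart_mem x q) (oddPart_mem y q)
  · rw [← oddTri_add, add_neg_cancel, oddTri_map_zero]

theorem odd_odd_tri (h2 : (2 : k) ≠ 0) (y y' : Fin 14 → k) :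
    mulTri h2 (S42 k) (oddTri y) (oddTri y') (oddPart y) (oddPart y') = evenTri (oddBracket y y') := by
  refine tri_ext_even (mulTri_mem _ _ zmod2_one_add_one (oddTri_mem y) (oddPart_mem y)
    (oddTri_mem y') (oddPart_mem y')) (evenTri_mem _) fun m v => ?_
  rw [mulTri_apply _ _ (oddTri_mem y) (oddPart_mem y) (oddTri_mem y')
    (oddPart_mem y') m (odd_mem v), eq_cons v]
  match m with
  | 0 => exact odd_odd_tri_zero y y' _ _
  | 1 => exact odd_odd_tri_one y y' _ _
  | 2 => exact odd_odd_tri_two y y' _ _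

theorem exists_eq_of_mem {i : ZMod 2} {X : Space k} (hX : X ∈ (algebra k).gr i) :
    (i = 0 ∧ ∃ x, X = (x, 0)) ∨ (i = 1 ∧ ∃ y, X = (0, y)) := by
  rcases zmod2_cases i with rfl | rfl
  · exact .inl ⟨rfl, X.1, Prod.ext rfl (mem_algebra_even.mp hX)⟩
  · exact .inr ⟨rfl, X.2, Prod.ext (mem_algebra_odd.mp hX) rfl⟩

theorem mul_even_even (x x' : Fin 21 → k) :
    (algebra k).mul (x, 0) (x', 0) = (evenBracket x x', 0) := by
  simp [algebra_mul, mul, oddBracket_zero, action_zero]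

theorem mul_even_odd (x : Fin 21 → k) (y : Fin 14 → k) :
    (algebra k).mul (x, 0) (0, y) = (0, action x y) := by
  simp [algebra_mul, mul, evenBracket_zero, zero_oddBracket, zero_action]

theorem mul_odd_even (x : Fin 21 → k) (y : Fin 14 → k) :
    (algebra k).mul (0, y) (x, 0) = (0, -action x y) := by
  simp [algebra_mul, mul, zero_evenBracket, oddBracket_zero, zero_action]

theorem mul_odd_odd (y y' : Fin 14 → k) :
    (algebra k).mul (0, y) (0, y') = (oddBracket y y', 0) := by
  simp [algebra_mul, mul, evenBracket_zero, zero_action]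

theorem triHom_mul (h2 : (2 : k) ≠ 0) {i j : ZMod 2} {X Y : Space k} (hX : X ∈ (algebra k).gr i)
    (hY : Y ∈ (algebra k).gr j) : mulTri h2 (S42 k) (triHom k X) (triHom k Y)
      (partHom k X) (partHom k Y) = triHom k ((algebra k).mul X Y) := by
  obtain ⟨rfl, x, rfl⟩ | ⟨rfl, y, rfl⟩ := exists_eq_of_mem hX <;>
    obtain ⟨rfl, x', rfl⟩ | ⟨rfl, y', rfl⟩ := exists_eq_of_mem hY
  · have e := congrArg (triHom k) (mul_even_even x x')
    rw [triHom_even (evenBracket x x')] at e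
    rw [e, triHom_even x, triHom_even x', partHom_even x, partHom_even x']
    exact even_even_tri h2 _ _
  · have e := congrArg (triHom k) (mul_even_odd x y')
    rw [triHom_odd (action x y')] at e
    rw [e, triHom_even x, triHom_odd y', partHom_even x, partHom_odd y']
    exact even_odd_tri h2 _ _
  · have e := congrArg (triHom k) (mul_odd_even x' y)
    rw [triHom_odd (-action x' y)] at e
    rw [e, triHom_even x', triHom_odd y, partHom_even x', partHom_odd y]
    exact odd_even_tri h2 _ _
  · have e := congrArg (triHom k) (mul_odd_odd y y')
    rw [triHom_even (oddBracket y y')] at e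
    rw [e, triHom_odd y, triHom_odd y', partHom_odd y, partHom_odd y']
    exact odd_odd_tri h2 _ _

theorem partHom_mul {i j : ZMod 2} {X Y : Space k} (hX : X ∈ (algebra k).gr i)
    (hY : Y ∈ (algebra k).gr j) (m : Fin 3) :
    (triHom k X).1 m (partHom k Y m) - sg k (i * j) • (triHom k Y).1 m (partHom k X m) +
      (S42 k).mul (partHom k X (m + 1)) (partHom k Y (m + 2)) -
      sg k (i * j) • (S42 k).mul (partHom k Y (m + 1)) (partHom k X (m + 2)) =
      partHom k ((algebra k).mul X Y) m := by
  obtain ⟨rfl, x, rfl⟩ | ⟨rfl, y, rfl⟩ := exists_eq_of_mem hX <;>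
    obtain ⟨rfl, x', rfl⟩ | ⟨rfl, y', rfl⟩ := exists_eq_of_mem hY
  · rw [mul_even_even x x', triHom_even, triHom_even, partHom_even, partHom_even, partHom_even]
    match m with
    | 0 => exact even_even_tensor_zero x x'
    | 1 => exact even_even_tensor_one x x'
    | 2 => exact even_even_tensor_two x x'
  · rw [mul_even_odd x y', triHom_even, triHom_odd, partHom_even, partHom_odd, partHom_odd]
    match m with
    | 0 => exact even_odd_tensor_zero x y'
    | 1 => exact even_odd_tensor_one x y'
    | 2 => exact even_odd_tensor_two x y'
  · rw [mul_odd_even x' y, triHom_even, triHom_odd, partHom_even, partHom_odd, partHom_odd]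
    match m with
    | 0 => exact odd_even_tensor x' y 0 (even_odd_tensor_zero x' y)
    | 1 => exact odd_even_tensor x' y 1 (even_odd_tensor_one x' y)
    | 2 => exact odd_even_tensor x' y 2 (even_odd_tensor_two x' y)
  · rw [mul_odd_odd y y', triHom_odd, triHom_odd, partHom_odd, partHom_odd, partHom_even]
    match m with
    | 0 => exact odd_odd_tensor_zero y y'
    | 1 => exact odd_odd_tensor_one y y'
    | 2 => exact odd_odd_tensor_two y y'

variable (k) in
-- Carries every property of the coordinate model over to `g(S₁, S_{4,2})`, including the Lie
-- superalgebra axioms, which are not proved there directly.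
theorem nonempty_iso_gS1S42 : Nonempty ((algebra k).Iso (gS1S42 k)) := by
  refine nonempty_iso_magic (two_ne_zero_of_charP_three k) (S42 k) (algebra k) (triHom k)
    (partHom k) ?_ ?_ (triHom_mul _) partHom_mul (fun X => eq_zero_of_triHom) exists_triHom
  · intro i X hX
    obtain ⟨rfl, x, rfl⟩ | ⟨rfl, y, rfl⟩ := exists_eq_of_mem hX
    · rw [triHom_even]; exact evenTri_mem x
    · rw [triHom_odd]; exact oddTri_mem y
  · intro i X hX m
    obtain ⟨rfl, x, rfl⟩ | ⟨rfl, y, rfl⟩ := exists_eq_of_mem hX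
    · rw [partHom_even]; exact evenPart_mem x m
    · rw [partHom_odd]; exact oddPart_mem y m

variable (k) in
/-- The even part of `sp₆ ⊕ V(ω₃)` is `sp₆`. -/
def evenEquiv : (algebra k).gr 0 ≃ₗ[k] (Fin 21 → k) where
  toFun X := X.1.1
  map_add' _ _ := rfl
  map_smul' _ _ := rfl
  invFun x := ⟨(x, 0), mem_algebra_even.mpr rfl⟩
  left_inv X := Subtype.ext (Prod.ext rfl (mem_algebra_even.mp X.2).symm)
  right_inv _ := rfl

variable (k) in
/-- The odd part of `sp₆ ⊕ V(ω₃)` is `V(ω₃)`. -/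
def oddEquiv : (algebra k).gr 1 ≃ₗ[k] (Fin 14 → k) where
  toFun X := X.1.2
  map_add' _ _ := rfl
  map_smul' _ _ := rfl
  invFun y := ⟨(0, y), mem_algebra_odd.mpr rfl⟩
  left_inv X := Subtype.ext (Prod.ext (mem_algebra_odd.mp X.2).symm rfl)
  right_inv _ := rfl

end SpWedgeModel

/-! ### Plücker coordinates on ⋀³W -/

namespace SpWedgeModel

variable {k : Type*} [Field k]

/-- The enumeration `b₁, a₁, b₂, a₂, b₃, a₃` of the symplectic basis. -/
def slot : Fin 6 → Fin 3 ⊕ Fin 3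
  | 0 => .inl 0
  | 1 => .inr 0
  | 2 => .inl 1
  | 3 => .inr 1
  | 4 => .inl 2
  | 5 => .inr 2

theorem slot_bijective : Function.Bijective slot := by
  constructor
  · intro a b
    revert a b
    decide
  · decide

theorem sum_slot (f : Fin 3 ⊕ Fin 3 → k) : ∑ p, f p = ∑ i, f (slot i) :=
  (Equiv.sum_comp (Equiv.ofBijective slot slot_bijective) f).symm

/-- The coordinate of an element of `⋀³ W` given by three coordinates of `W`. -/
noncomputable def minor (p q r : Fin 6) : (⋀[k]^3 (W6 k)) →ₗ[k] k :=
  exteriorPower.pairingDual k (W6 k) 3 (exteriorPower.ιMulti k 3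
    ![LinearMap.proj (slot p), LinearMap.proj (slot q), LinearMap.proj (slot r)])

theorem minor_ιMulti (p q r : Fin 6) (z : Fin 3 → W6 k) :
    minor p q r (exteriorPower.ιMulti k 3 z) =
      z 0 (slot p) * (z 1 (slot q) * z 2 (slot r) - z 1 (slot r) * z 2 (slot q)) -
      z 0 (slot q) * (z 1 (slot p) * z 2 (slot r) - z 1 (slot r) * z 2 (slot p)) +
      z 0 (slot r) * (z 1 (slot p) * z 2 (slot q) - z 1 (slot q) * z 2 (slot p)) := by
  rw [minor, exteriorPower.pairingDual_ιMulti_ιMulti, Matrix.det_fin_three]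
  simp
  ring

theorem linearMap_ext_ιMulti {M : Type*} [AddCommGroup M] [Module k M]
    {f g : (⋀[k]^3 (W6 k)) →ₗ[k] M}
    (h : ∀ z, f (exteriorPower.ιMulti k 3 z) = g (exteriorPower.ιMulti k 3 z)) : f = g :=
  exteriorPower.linearMap_ext (AlternatingMap.ext h)

theorem minor_swap_left (p q r : Fin 6) (w : ⋀[k]^3 (W6 k)) : minor p q r w = -minor q p r w := by
  have h : minor (k := k) p q r = -minor q p r := by
    refine linearMap_ext_ιMulti fun z => ?_
    rw [LinearMap.neg_apply, minor_ιMulti, minor_ιMulti]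
    ring
  rw [h, LinearMap.neg_apply]

theorem minor_swap_right (p q r : Fin 6) (w : ⋀[k]^3 (W6 k)) : minor p q r w = -minor p r q w := by
  have h : minor (k := k) p q r = -minor p r q := by
    refine linearMap_ext_ιMulti fun z => ?_
    rw [LinearMap.neg_apply, minor_ιMulti, minor_ιMulti]
    ring
  rw [h, LinearMap.neg_apply]

/-- The side condition makes this a terminating rewrite rule: with `decide` as discharger, `simp`
sorts the indices of a minor. -/
theorem minor_sort_left (p q r : Fin 6) (w : ⋀[k]^3 (W6 k)) (_ : q < p) :
    minor p q r w = -minor q p r w := minor_swap_left p q r w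

theorem minor_sort_right (p q r : Fin 6) (w : ⋀[k]^3 (W6 k)) (_ : r < q) :
    minor p q r w = -minor p r q w := minor_swap_right p q r w

theorem minor_self_left (p q : Fin 6) (w : ⋀[k]^3 (W6 k)) : minor p p q w = 0 := by
  have h : minor (k := k) p p q = 0 := by
    refine linearMap_ext_ιMulti fun z => ?_
    rw [LinearMap.zero_apply, minor_ιMulti]
    ring
  rw [h, LinearMap.zero_apply]

theorem minor_self_right (p q : Fin 6) (w : ⋀[k]^3 (W6 k)) : minor p q q w = 0 := by
  have h : minor (k := k) p q q = 0 := by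
    refine linearMap_ext_ιMulti fun z => ?_
    rw [LinearMap.zero_apply, minor_ιMulti]
    ring
  rw [h, LinearMap.zero_apply]

/-- A derivation acts on a minor by replacing one row index at a time, as in the product rule for
determinants. -/
theorem minor_spWedge (p q r : Fin 6) (X : sp6 k) (w : ⋀[k]^3 (W6 k)) :
    minor p q r (spWedge X w) =
      (∑ i, X.1 (slot p) (slot i) * minor i q r w) + (∑ i, X.1 (slot q) (slot i) * minor p i r w) +
        ∑ i, X.1 (slot r) (slot i) * minor p q i w := by
  have h : minor p q r ∘ₗ spWedge X =
      (∑ i, X.1 (slot p) (slot i) • minor i q r) + (∑ i, X.1 (slot q) (slot i) • minor p i r) +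
        ∑ i, X.1 (slot r) (slot i) • minor p q i := by
    refine linearMap_ext_ιMulti fun z => ?_
    rw [LinearMap.comp_apply, spWedge, wedgeDeriv_ιMulti, map_sum]
    simp only [Fin.sum_univ_three, minor_ιMulti, LinearMap.add_apply, LinearMap.sum_apply,
      LinearMap.smul_apply, Function.update_self, smul_eq_mul, Matrix.toLin'_apply,
      Matrix.mulVec, dotProduct, sum_slot]
    simp [Function.update, Finset.mul_sum, Finset.sum_mul]
    simp only [← Finset.sum_add_distrib, ← Finset.sum_sub_distrib, Fin.sum_univ_six]
    ring
  simpa using LinearMap.congr_fun h w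

/-- The minus sign arises because `slot` lists b_i before a_i while {a_i|b_i} = 1. -/
theorem contraction_apply (p : Fin 6) (w : ⋀[k]^3 (W6 k)) :
    contraction k w (slot p) = -(minor 0 1 p w + minor 2 3 p w + minor 4 5 p w) := by
  have h : LinearMap.proj (slot p) ∘ₗ contraction k =
      -(minor 0 1 p + minor 2 3 p + minor 4 5 p) := by
    refine linearMap_ext_ιMulti fun z => ?_
    have e : contraction k (exteriorPower.ιMulti k 3 z) = contractionAlt k z := by
      rw [contraction, exteriorPower.alternatingMapLinearEquiv_apply_ιMulti]
    rw [LinearMap.comp_apply, e]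
    simp only [LinearMap.neg_apply, LinearMap.add_apply, minor_ιMulti, slot, contractionAlt,
      AlternatingMap.coe_mk, MultilinearMap.coe_mk, LinearMap.proj_apply, Pi.add_apply,
      Pi.smul_apply, smul_eq_mul, altForm_eq, Fin.sum_univ_three]
    ring
  simpa using LinearMap.congr_fun h w

/-- The minors with increasing indices are the dual basis of the standard basis of the exterior
power. -/
theorem eq_zero_of_minor {w : ⋀[k]^3 (W6 k)} (h : ∀ p q r, p < q → q < r → minor p q r w = 0) :
    w = 0 := by
  let b : Module.Basis (Fin 6) k (W6 k) :=
    (Pi.basisFun k (Fin 3 ⊕ Fin 3)).reindex (Equiv.ofBijective slot slot_bijective).symm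
  refine (b.exteriorPower 3).ext_elem fun s => ?_
  rw [map_zero, Finsupp.zero_apply, exteriorPower.basis_repr_apply]
  set g := Set.powersetCard.ofFinEmbEquiv.symm s with hg
  have e : exteriorPower.ιMultiDual k 3 b s = minor (g 0) (g 1) (g 2) := by
    refine linearMap_ext_ιMulti fun z => ?_
    rw [exteriorPower.ιMultiDual_apply_ιMulti, minor_ιMulti, Matrix.det_fin_three]
    simp [b, ← hg]
    ring
  rw [e]
  exact h _ _ _ (g.strictMono (by decide)) (g.strictMono (by decide))

end SpWedgeModel

/-! ### The kernel of the contraction in coordinates -/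

namespace SpWedgeModel

variable {k : Type*} [Field k]

variable (k)

/-- The coordinates of `⋀³ W` that determine the elements of the kernel of the contraction. -/
noncomputable def coordinate : Fin 14 → ((⋀[k]^3 (W6 k)) →ₗ[k] k)
  | 0 => minor 0 2 4
  | 1 => minor 0 2 5
  | 2 => minor 0 3 4
  | 3 => minor 0 3 5
  | 4 => minor 1 2 4
  | 5 => minor 1 2 5
  | 6 => minor 1 3 4
  | 7 => minor 1 3 5
  | 8 => minor 0 4 5
  | 9 => minor 1 4 5
  | 10 => minor 0 1 2
  | 11 => minor 0 1 3
  | 12 => minor 2 3 4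
  | 13 => minor 2 3 5

/-- The coordinates as a linear map. -/
noncomputable def coordinates : (⋀[k]^3 (W6 k)) →ₗ[k] (Fin 14 → k) := LinearMap.pi (coordinate k)

variable {k}

theorem minor_of_mem_ker {w : ⋀[k]^3 (W6 k)} (hw : w ∈ LinearMap.ker (contraction k)) (p : Fin 6) :
    minor 0 1 p w + minor 2 3 p w + minor 4 5 p w = 0 := by
  have h := contraction_apply p w
  rw [LinearMap.mem_ker.mp hw, Pi.zero_apply] at h
  exact neg_eq_zero.mp h.symm

/-- Each of the six coordinates of φ(w) = 0 eliminates one minor; of the twenty there remain the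
fourteen in `coordinate`. -/
theorem minor_relations {w : ⋀[k]^3 (W6 k)} (hw : w ∈ LinearMap.ker (contraction k)) :
    minor 0 2 3 w = -minor 0 4 5 w ∧ minor 1 2 3 w = -minor 1 4 5 w ∧
    minor 2 4 5 w = -minor 0 1 2 w ∧ minor 3 4 5 w = -minor 0 1 3 w ∧
    minor 0 1 4 w = -minor 2 3 4 w ∧ minor 0 1 5 w = -minor 2 3 5 w := by
  have h0 := minor_of_mem_ker hw 0
  have h1 := minor_of_mem_ker hw 1
  have h2 := minor_of_mem_ker hw 2
  have h3 := minor_of_mem_ker hw 3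
  have h4 := minor_of_mem_ker hw 4
  have h5 := minor_of_mem_ker hw 5
  simp (discharger := decide) only [minor_self_left, minor_self_right, minor_sort_left,
    minor_sort_right, neg_neg, neg_zero] at h0 h1 h2 h3 h4 h5
  refine ⟨?_, ?_, ?_, ?_, ?_, ?_⟩
  · linear_combination h0
  · linear_combination h1
  · linear_combination h2
  · linear_combination h3
  · linear_combination h4
  · linear_combination h5

/-- Expanding by `minor_spWedge`, sorting the indices and eliminating six minors gives exactly the
formulas of `action`. -/
theorem coordinates_spWedge (x : Fin 21 → k) {w : ⋀[k]^3 (W6 k)}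
    (hw : w ∈ LinearMap.ker (contraction k)) :
    coordinates k (spWedge (sp6Equiv k x) w) = action x (coordinates k w) := by
  obtain ⟨h0, h1, h2, h3, h4, h5⟩ := minor_relations hw
  funext l
  simp only [coordinates, LinearMap.pi_apply]
  fin_cases l <;>
  simp (discharger := decide) only [Fin.reduceFinMk, Fin.zero_eta, Fin.mk_one, Fin.isValue,
    action, coordinate, LinearMap.pi_apply, minor_spWedge, sp6Equiv_coe, Fin.sum_univ_six,
    slot, toMatrix, minor_self_left, minor_self_right, minor_sort_left, minor_sort_right,
    neg_neg, neg_zero, h0, h1, h2, h3, h4, h5] <;> ring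

theorem coordinates_injective {w : ⋀[k]^3 (W6 k)} (hw : w ∈ LinearMap.ker (contraction k))
    (h : coordinates k w = 0) : w = 0 := by
  obtain ⟨h0, h1, h2, h3, h4, h5⟩ := minor_relations hw
  have hc : ∀ l, coordinate k l w = 0 := fun l => congrFun h l
  have c0 : minor 0 2 4 w = 0 := hc 0
  have c1 : minor 0 2 5 w = 0 := hc 1
  have c2 : minor 0 3 4 w = 0 := hc 2
  have c3 : minor 0 3 5 w = 0 := hc 3
  have c4 : minor 1 2 4 w = 0 := hc 4
  have c5 : minor 1 2 5 w = 0 := hc 5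
  have c6 : minor 1 3 4 w = 0 := hc 6
  have c7 : minor 1 3 5 w = 0 := hc 7
  have c8 : minor 0 4 5 w = 0 := hc 8
  have c9 : minor 1 4 5 w = 0 := hc 9
  have c10 : minor 0 1 2 w = 0 := hc 10
  have c11 : minor 0 1 3 w = 0 := hc 11
  have c12 : minor 2 3 4 w = 0 := hc 12
  have c13 : minor 2 3 5 w = 0 := hc 13
  rw [c8, neg_zero] at h0
  rw [c9, neg_zero] at h1
  rw [c10, neg_zero] at h2
  rw [c11, neg_zero] at h3
  rw [c12, neg_zero] at h4
  rw [c13, neg_zero] at h5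
  refine eq_zero_of_minor fun p q r hpq hqr => ?_
  fin_cases p <;> fin_cases q <;> first | exact absurd hpq (by decide) | skip
  all_goals fin_cases r <;> first | exact absurd hqr (by decide) | assumption

/-- a_m ∧ b_m ∧ e_p maps to e_p as soon as e_p is orthogonal to a_m and b_m, so m is taken different
from the index of e_p. -/
theorem contraction_surjective : Function.Surjective (contraction k) := by
  rw [← LinearMap.range_eq_top, eq_top_iff, ← (Pi.basisFun k (Fin 3 ⊕ Fin 3)).span_eq,
    Submodule.span_le]
  rintro _ ⟨p, rfl⟩
  have e : ∀ z, contraction k (exteriorPower.ιMulti k 3 z) = contractionAlt k z := fun z => by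
    rw [contraction, exteriorPower.alternatingMapLinearEquiv_apply_ιMulti]
  have key : ∀ (m : Fin 3), p ≠ .inl m → p ≠ .inr m →
      Pi.single p 1 ∈ LinearMap.range (contraction k) := by
    intro m hl hr
    refine ⟨exteriorPower.ιMulti k 3 ![Pi.single (.inr m) 1, Pi.single (.inl m) 1, Pi.single p 1], ?_⟩
    rw [e]
    simp only [contractionAlt, AlternatingMap.coe_mk, MultilinearMap.coe_mk, Matrix.cons_val_zero,
      Matrix.cons_val_one, Matrix.cons_val_two, Matrix.head_cons, Matrix.tail_cons]
    have h1 : altForm (Pi.single (.inr m) 1 : W6 k) (Pi.single (.inl m) 1) = 1 := by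
      simp [altForm_eq, Pi.single_apply]
    have h2 : altForm (Pi.single (.inl m) 1 : W6 k) (Pi.single p 1) = 0 := by
      rcases p with p | p <;> simp_all [altForm_eq, Pi.single_apply, eq_comm]
    have h3 : altForm (Pi.single p 1 : W6 k) (Pi.single (.inr m) 1) = 0 := by
      rcases p with p | p <;> simp_all [altForm_eq, Pi.single_apply, eq_comm]
    simp [h1, h2, h3]
  rw [Pi.basisFun_apply]
  rcases p with m | m <;> exact key (m + 1) (by simp) (by simp)

variable (k) in
-- Rank-nullity with dim ⋀³W = 20 and the six-dimensional image W.
theorem finrank_ker_contraction : Module.finrank k (LinearMap.ker (contraction k)) = 14 := by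
  have h := LinearMap.finrank_range_add_finrank_ker (contraction k)
  rw [LinearMap.range_eq_top.mpr contraction_surjective, finrank_top, exteriorPower.finrank_eq] at h
  simp only [Module.finrank_fintype_fun_eq_card, Fintype.card_sum, Fintype.card_fin] at h
  have : Nat.choose (3 + 3) 3 = 20 := by decide
  omega

variable (k) in
/-- The coordinates of the kernel of the contraction, as a linear map. -/
noncomputable def kerCoordinates : LinearMap.ker (contraction k) →ₗ[k] (Fin 14 → k) :=
  (coordinates k).comp (LinearMap.ker (contraction k)).subtype

end SpWedgeModel

/-! ### Invariance of the kernel -/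

namespace SpWedgeModel

variable {k : Type*} [Field k]

theorem bijective_of_finrank_eq {V : Type*} [AddCommGroup V] [Module k V] {n : ℕ}
    (f : V →ₗ[k] (Fin n → k)) (hn : Module.finrank k V = n) (hf : ∀ v, f v = 0 → v = 0) :
    Function.Bijective f := by
  have h1 : Function.Injective f := (injective_iff_map_eq_zero f).mpr hf
  have h2 := LinearMap.finrank_range_of_inj h1
  refine ⟨h1, LinearMap.range_eq_top.mp (Submodule.eq_top_of_finrank_eq ?_)⟩
  rw [h2, hn, Module.finrank_fin_fun]

theorem kerCoordinates_bijective : Function.Bijective (kerCoordinates k) :=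
  bijective_of_finrank_eq (V := LinearMap.ker (contraction k)) (kerCoordinates k)
    (finrank_ker_contraction k) fun w hw => Subtype.ext (coordinates_injective w.2 hw)

variable (k) in
/-- The coordinates of the kernel of the contraction. -/
noncomputable def kerEquiv : LinearMap.ker (contraction k) ≃ₗ[k] (Fin 14 → k) :=
  LinearEquiv.ofBijective (kerCoordinates k) kerCoordinates_bijective

theorem kerEquiv_apply (w : LinearMap.ker (contraction k)) :
    kerEquiv k w = coordinates k w.1 := rfl

/-- φ is sp₆-equivariant since it is built from the invariant form only: the terms in which X meets
the form cancel in pairs. -/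
theorem contraction_spWedge (X : sp6 k) (w : ⋀[k]^3 (W6 k)) :
    contraction k (spWedge X w) = (X.1).mulVec (contraction k w) := by
  have h : contraction k ∘ₗ spWedge X = Matrix.mulVecLin X.1 ∘ₗ contraction k := by
    refine linearMap_ext_ιMulti fun z => ?_
    have e : ∀ z, contraction k (exteriorPower.ιMulti k 3 z) = contractionAlt k z := fun z => by
      rw [contraction, exteriorPower.alternatingMapLinearEquiv_apply_ιMulti]
    have hX := altForm_invariant X
    rw [LinearMap.comp_apply, LinearMap.comp_apply, spWedge, wedgeDeriv_ιMulti, map_sum]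
    simp only [e, Fin.sum_univ_three]
    simp [contractionAlt, Function.update, Matrix.mulVec_add, Matrix.mulVec_smul]
    have h01 := hX (z 0) (z 1)
    have h12 := hX (z 1) (z 2)
    have h20 := hX (z 2) (z 0)
    rw [add_eq_zero_iff_eq_neg] at h01 h12 h20
    rw [h01, h12, h20]
    module
  exact LinearMap.congr_fun h w

theorem spWedge_mem_ker (X : sp6 k) {w : ⋀[k]^3 (W6 k)} (hw : w ∈ LinearMap.ker (contraction k)) :
    spWedge X w ∈ LinearMap.ker (contraction k) := by
  rw [LinearMap.mem_ker, contraction_spWedge, LinearMap.mem_ker.mp hw, Matrix.mulVec_zero]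

end SpWedgeModel

/-! ### Irreducibility of V(ω₃) -/

namespace SpWedgeModel

variable {k : Type*} [Field k]

/-- The weights of the fourteen dimensional module. -/
def weight : Fin 14 → Fin 3 → ℤ
  | 0 => ![1, 1, 1]
  | 1 => ![1, 1, -1]
  | 2 => ![1, -1, 1]
  | 3 => ![1, -1, -1]
  | 4 => ![-1, 1, 1]
  | 5 => ![-1, 1, -1]
  | 6 => ![-1, -1, 1]
  | 7 => ![-1, -1, -1]
  | 8 => ![1, 0, 0]
  | 9 => ![-1, 0, 0]
  | 10 => ![0, 1, 0]
  | 11 => ![0, -1, 0]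
  | 12 => ![0, 0, 1]
  | 13 => ![0, 0, -1]

/-- The diagonal element of `sp₆` with given entries. -/
def torus (c : Fin 3 → k) : Fin 21 → k
  | 0 => c 0
  | 3 => c 1
  | 6 => c 2
  | _ => 0

theorem torus_action (c : Fin 3 → k) (v : Fin 14 → k) (l : Fin 14) :
    action (torus c) v l = (∑ m, c m * weight l m) * v l := by
  fin_cases l <;> simp [action, torus, weight, Fin.sum_univ_three] <;> ring

/-- The entries of the weights are -1, 0 or 1, so distinct weights stay distinct modulo 3. This is
all that separates the weight spaces in characteristic 3. -/
theorem exists_weight_ne {l l' : Fin 14} (h : l ≠ l') :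
    ∃ m, ¬ (3 : ℤ) ∣ weight l m - weight l' m := by
  revert l l'
  decide

/-- A subspace invariant under the diagonal matrices is spanned by basis vectors. -/
theorem single_mem_of_torus [CharP k 3] {N : Submodule k (Fin 14 → k)}
    (hN : ∀ x, ∀ v ∈ N, action x v ∈ N) {v : Fin 14 → k} (hv : v ∈ N) (l : Fin 14) :
    Pi.single l (v l) ∈ N := by
  have hw : ∀ m, ∀ v ∈ N, (fun i => (weight i m : k) * v i) ∈ N := by
    intro m v hv
    have h := hN (torus (Pi.single m 1)) v hv
    have e : action (torus (Pi.single m 1)) v = fun i => (weight i m : k) * v i := by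
      funext i
      rw [torus_action]
      simp [Pi.single_apply]
    rwa [e] at h
  -- Interpolation, one index at a time: a diagonal operator minus its eigenvalue at `a`, suitably
  -- scaled, kills coordinate `a`, fixes coordinate `l`, and keeps zeros zero.
  have key : ∀ s : Finset (Fin 14), l ∉ s → ∃ u ∈ N, u l = v l ∧ (∀ i ∈ s, u i = 0) := by
    intro s
    induction s using Finset.induction_on with
    | empty => exact fun _ => ⟨v, hv, rfl, by simp⟩
    | insert a s ha ih =>
      intro hl
      obtain ⟨hla, hls⟩ := not_or.mp (fun h => hl (Finset.mem_insert.mpr h))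
      obtain ⟨u, hu, hul, hus⟩ := ih hls
      obtain ⟨m, hm⟩ := exists_weight_ne hla
      have hne : (weight l m : k) - weight a m ≠ 0 := by
        rw [← Int.cast_sub, Ne, CharP.intCast_eq_zero_iff k 3]
        exact_mod_cast hm
      refine ⟨((weight l m : k) - weight a m)⁻¹ • ((fun i => (weight i m : k) * u i) -
        (weight a m : k) • u), N.smul_mem _ (N.sub_mem (hw m u hu) (N.smul_mem _ hu)), ?_, ?_⟩
      · simp only [Pi.smul_apply, Pi.sub_apply, smul_eq_mul, hul]
        field_simp
      · intro i hi
        rcases Finset.mem_insert.mp hi with rfl | hi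
        · simp
        · simp [hus i hi]
  obtain ⟨u, hu, hul, hus⟩ := key (Finset.univ.erase l) (by simp)
  have e : u = Pi.single l (v l) := by
    funext i
    by_cases h : i = l
    · subst h; simp [hul]
    · simp [h, hus i (by simp [h])]
  rwa [e] at hu

theorem single_mem_of_action {N : Submodule k (Fin 14 → k)}
    (hN : ∀ x, ∀ v ∈ N, action x v ∈ N) (i : Fin 21) {c : k} (hc : c ≠ 0) {l l' : Fin 14}
    (h : action (Pi.single i (1 : k)) (Pi.single l 1) = c • Pi.single l' 1)
    (hl : Pi.single l (1 : k) ∈ N) : Pi.single l' (1 : k) ∈ N := by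
  have h' := N.smul_mem c⁻¹ (hN (Pi.single i 1) _ hl)
  rwa [h, smul_smul, inv_mul_cancel₀ hc, one_smul] at h'

/-- Root vectors carry the basis vectors around the cycle 0, 1, 3, 2, 6, 4, 5, 7, 9, 8, 10, 11, 13,
12, 0 with nonzero coefficients. -/
theorem action_single_single :
    action (Pi.single 8 (1 : k)) (Pi.single 0 1) = (1 : k) • Pi.single 1 1 ∧
    action (Pi.single 5 (1 : k)) (Pi.single 1 1) = (1 : k) • Pi.single 3 1 ∧
    action (Pi.single 7 (1 : k)) (Pi.single 3 1) = (1 : k) • Pi.single 2 1 ∧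
    action (Pi.single 2 (1 : k)) (Pi.single 2 1) = (1 : k) • Pi.single 6 1 ∧
    action (Pi.single 4 (1 : k)) (Pi.single 6 1) = (1 : k) • Pi.single 4 1 ∧
    action (Pi.single 8 (1 : k)) (Pi.single 4 1) = (1 : k) • Pi.single 5 1 ∧
    action (Pi.single 5 (1 : k)) (Pi.single 5 1) = (1 : k) • Pi.single 7 1 ∧
    action (Pi.single 10 (1 : k)) (Pi.single 7 1) = (1 : k) • Pi.single 9 1 ∧
    action (Pi.single 1 (1 : k)) (Pi.single 9 1) = (1 : k) • Pi.single 8 1 ∧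
    action (Pi.single 17 (1 : k)) (Pi.single 8 1) = (-1 : k) • Pi.single 10 1 ∧
    action (Pi.single 5 (1 : k)) (Pi.single 10 1) = (1 : k) • Pi.single 11 1 ∧
    action (Pi.single 12 (1 : k)) (Pi.single 11 1) = (-1 : k) • Pi.single 13 1 ∧
    action (Pi.single 7 (1 : k)) (Pi.single 13 1) = (1 : k) • Pi.single 12 1 ∧
    action (Pi.single 18 (1 : k)) (Pi.single 12 1) = (-2 : k) • Pi.single 0 1 := by
  refine ⟨?_, ?_, ?_, ?_, ?_, ?_, ?_, ?_, ?_, ?_, ?_, ?_, ?_, ?_⟩ <;> funext m <;> fin_cases m <;>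
    simp [action, Pi.single_apply]

/-- The fourteen dimensional module is irreducible. -/
theorem action_irreducible [CharP k 3] {N : Submodule k (Fin 14 → k)}
    (hN : ∀ x, ∀ v ∈ N, action x v ∈ N) : N = ⊥ ∨ N = ⊤ := by
  by_cases hbot : N = ⊥
  · exact Or.inl hbot
  obtain ⟨v, hv, hv0⟩ := N.ne_bot_iff.mp hbot
  obtain ⟨l, hl⟩ := Function.ne_iff.mp hv0
  have hl1 : (Pi.single l 1 : Fin 14 → k) ∈ N := by
    have h := N.smul_mem (v l)⁻¹ (single_mem_of_torus hN hv l)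
    have e : (v l)⁻¹ • (Pi.single l (v l) : Fin 14 → k) = Pi.single l 1 := by
      rw [← Pi.single_smul, smul_eq_mul, inv_mul_cancel₀ hl]
    rwa [e] at h
  obtain ⟨a0, a1, a2, a3, a4, a5, a6, a7, a8, a9, a10, a11, a12, a13⟩ :=
    action_single_single (k := k)
  have hn : (-2 : k) ≠ 0 := neg_ne_zero.mpr (two_ne_zero_of_charP_three k)
  have s0 := single_mem_of_action hN _ one_ne_zero a0
  have s1 := single_mem_of_action hN _ one_ne_zero a1
  have s2 := single_mem_of_action hN _ one_ne_zero a2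
  have s3 := single_mem_of_action hN _ one_ne_zero a3
  have s4 := single_mem_of_action hN _ one_ne_zero a4
  have s5 := single_mem_of_action hN _ one_ne_zero a5
  have s6 := single_mem_of_action hN _ one_ne_zero a6
  have s7 := single_mem_of_action hN _ one_ne_zero a7
  have s8 := single_mem_of_action hN _ one_ne_zero a8
  have s9 := single_mem_of_action hN _ (neg_ne_zero.mpr one_ne_zero) a9
  have s10 := single_mem_of_action hN _ one_ne_zero a10
  have s11 := single_mem_of_action hN _ (neg_ne_zero.mpr one_ne_zero) a11
  have s12 := single_mem_of_action hN _ one_ne_zero a12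
  have s13 := single_mem_of_action hN _ hn a13
  -- `r i` follows the cycle from the basis vector `i` back to 0; from 0 all the others are then
  -- reached.
  have r12 := s13
  have r13 := fun h => r12 (s12 h)
  have r11 := fun h => r13 (s11 h)
  have r10 := fun h => r11 (s10 h)
  have r8 := fun h => r10 (s9 h)
  have r9 := fun h => r8 (s8 h)
  have r7 := fun h => r9 (s7 h)
  have r5 := fun h => r7 (s6 h)
  have r4 := fun h => r5 (s5 h)
  have r6 := fun h => r4 (s4 h)
  have r2 := fun h => r6 (s3 h)
  have r3 := fun h => r2 (s2 h)
  have r1 := fun h => r3 (s1 h)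
  have h0 : (Pi.single 0 1 : Fin 14 → k) ∈ N := by
    fin_cases l
    exacts [hl1, r1 hl1, r2 hl1, r3 hl1, r4 hl1, r5 hl1, r6 hl1, r7 hl1, r8 hl1, r9 hl1, r10 hl1, r11 hl1, r12 hl1, r13 hl1]
  have h1 := s0 h0
  have h3 := s1 h1
  have h2 := s2 h3
  have h6 := s3 h2
  have h4 := s4 h6
  have h5 := s5 h4
  have h7 := s6 h5
  have h9 := s7 h7
  have h8 := s8 h9
  have h10 := s9 h8
  have h11 := s10 h10
  have h13 := s11 h11
  have h12 := s12 h13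
  have hall : ∀ i, (Pi.single i 1 : Fin 14 → k) ∈ N := by
    intro i
    fin_cases i
    exacts [h0, h1, h2, h3, h4, h5, h6, h7, h8, h9, h10, h11, h12, h13]
  refine Or.inr (eq_top_iff.mpr ?_)
  rw [← (Pi.basisFun k (Fin 14)).span_eq, Submodule.span_le]
  rintro _ ⟨i, rfl⟩
  rw [Pi.basisFun_apply]
  exact hall i

end SpWedgeModel

/-! ### The highest weight vector -/

namespace SpWedgeModel

variable {k : Type*} [Field k]

theorem coordinates_spWedge_eq (X : sp6 k) {w : ⋀[k]^3 (W6 k)}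
    (hw : w ∈ LinearMap.ker (contraction k)) :
    coordinates k (spWedge X w) = action (ofMatrix X.1) (coordinates k w) := by
  have h := coordinates_spWedge ((sp6Equiv k).symm X) hw
  rw [LinearEquiv.apply_symm_apply] at h
  exact h

theorem eq_of_coordinates_eq {w w' : ⋀[k]^3 (W6 k)} (hw : w ∈ LinearMap.ker (contraction k))
    (hw' : w' ∈ LinearMap.ker (contraction k)) (h : coordinates k w = coordinates k w') :
    w = w' := by
  refine sub_eq_zero.mp (coordinates_injective ((LinearMap.ker (contraction k)).sub_mem hw hw') ?_)
  rw [LinearMap.map_sub, h, sub_self]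

theorem isIrreducibleSubmodule_ker_contraction [CharP k 3] :
    IsIrreducibleSubmodule k (LinearMap.ker (contraction k)) := by
  refine ⟨fun X w hw => spWedge_mem_ker X hw, ?_, ?_⟩
  · intro h
    have h14 := finrank_ker_contraction k
    rw [h, finrank_bot] at h14
    exact absurd h14 (by decide)
  · intro N hN hinv
    have hcl : ∀ x, ∀ v ∈ N.map (coordinates k), action x v ∈ N.map (coordinates k) := by
      rintro x _ ⟨w, hw, rfl⟩
      exact ⟨spWedge (sp6Equiv k x) w, hinv _ w hw, coordinates_spWedge x (hN hw)⟩
    rcases action_irreducible hcl with h | h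
    · left
      rw [Submodule.eq_bot_iff]
      intro w hw
      refine coordinates_injective (hN hw) ?_
      exact (Submodule.mem_bot k).mp (h ▸ Submodule.mem_map_of_mem hw)
    · right
      refine le_antisymm hN fun w hw => ?_
      have hmem : coordinates k w ∈ N.map (coordinates k) := h ▸ Submodule.mem_top
      obtain ⟨u, hu, huw⟩ := hmem
      rwa [← eq_of_coordinates_eq (hN hu) hw huw]

variable (k) in
/-- The vector `b₁ ∧ b₂ ∧ b₃`. -/
noncomputable def highestWeightVector : ⋀[k]^3 (W6 k) :=
  exteriorPower.ιMulti k 3 fun i : Fin 3 => (Pi.single (Sum.inl i) 1 : W6 k)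

theorem highestWeightVector_mem : highestWeightVector k ∈ LinearMap.ker (contraction k) := by
  rw [LinearMap.mem_ker, highestWeightVector, contraction,
    exteriorPower.alternatingMapLinearEquiv_apply_ιMulti]
  have h : ∀ i j : Fin 3, altForm (Pi.single (.inl i) 1 : W6 k) (Pi.single (.inl j) 1) = 0 := by
    intro i j
    simp [altForm_eq]
  simp [contractionAlt, h]

theorem coordinates_highestWeightVector :
    coordinates k (highestWeightVector k) = Pi.single 0 1 := by
  funext l
  fin_cases l <;> simp [coordinates, coordinate, highestWeightVector, minor_ιMulti, slot]

/-- In coordinates the vector is the unit vector 0. The entries of X that could move it lie in the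
lower left block or on and below the diagonal of the upper left one, up to the symmetries of sp₆. -/
theorem isHighestWeightVectorOmega3 :
    IsHighestWeightVectorOmega3 k (highestWeightVector k) := by
  have hw := highestWeightVector_mem (k := k)
  have hz : (0 : ⋀[k]^3 (W6 k)) ∈ LinearMap.ker (contraction k) := Submodule.zero_mem _
  refine ⟨fun h => ?_, fun X hX => ?_, fun X hX => ?_⟩
  · have h0 := congrFun (coordinates_highestWeightVector (k := k)) 0
    rw [h, LinearMap.map_zero] at h0
    simp at h0
  · refine eq_of_coordinates_eq (spWedge_mem_ker X hw) hz ?_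
    rw [coordinates_spWedge_eq X hw, coordinates_highestWeightVector, LinearMap.map_zero]
    obtain ⟨h1, h2⟩ := hX
    obtain ⟨s1, s2, s3⟩ := mem_sp6_iff.mp X.2
    have d := fun i => h2 i i le_rfl
    have l1 := h2 1 0 (by decide)
    have l2 := h2 2 0 (by decide)
    have l3 := h2 2 1 (by decide)
    funext m
    fin_cases m <;> simp [action, ofMatrix, h1, d, s3, l1, l2, l3]
  · refine eq_of_coordinates_eq (spWedge_mem_ker X hw) (Submodule.smul_mem _ _ hw) ?_
    rw [coordinates_spWedge_eq X hw, LinearMap.map_smul, coordinates_highestWeightVector]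
    have hd : ∀ {i j}, i ≠ j → X.1 i j = 0 := fun h => hX h
    funext m
    fin_cases m <;> simp [action, ofMatrix, hd, Fin.sum_univ_three]

end SpWedgeModel

/-! ### Simplicity -/

namespace SpWedgeModel

variable {k : Type*} [Field k]

theorem even_eq_top {N : Submodule k (Fin 21 → k)} (h : ∀ l, Pi.single l 1 ∈ N) : N = ⊤ := by
  rw [eq_top_iff, ← (Pi.basisFun k (Fin 21)).span_eq, Submodule.span_le]
  rintro _ ⟨i, rfl⟩
  rw [Pi.basisFun_apply]
  exact h i

theorem odd_eq_top {N : Submodule k (Fin 14 → k)} (h : ∀ l, Pi.single l 1 ∈ N) : N = ⊤ := by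
  rw [eq_top_iff, ← (Pi.basisFun k (Fin 14)).span_eq, Submodule.span_le]
  rintro _ ⟨i, rfl⟩
  rw [Pi.basisFun_apply]
  exact h i

variable (k) in
/-- The inclusion of the even part. -/
def inEven : (Fin 21 → k) →ₗ[k] Space k := LinearMap.inl k _ _

variable (k) in
/-- The inclusion of the odd part. -/
def inOdd : (Fin 14 → k) →ₗ[k] Space k := LinearMap.inr k _ _

theorem inEven_apply (x : Fin 21 → k) : inEven k x = (x, 0) := rfl

theorem inOdd_apply (v : Fin 14 → k) : inOdd k v = (0, v) := rfl

theorem inEven_add_inOdd (X : Space k) : inEven k X.1 + inOdd k X.2 = X := by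
  simp [inEven_apply, inOdd_apply]

theorem mul_inEven_inEven (x y : Fin 21 → k) :
    (algebra k).mul (inEven k x) (inEven k y) = inEven k (evenBracket x y) := by
  simp [algebra_mul, mul, inEven_apply, action_zero, zero_oddBracket]

theorem mul_inEven_inOdd (x : Fin 21 → k) (v : Fin 14 → k) :
    (algebra k).mul (inEven k x) (inOdd k v) = inOdd k (action x v) := by
  simp [algebra_mul, mul, inEven_apply, inOdd_apply, evenBracket_zero, zero_oddBracket, zero_action]

theorem mul_inOdd_inEven (v : Fin 14 → k) (x : Fin 21 → k) :
    (algebra k).mul (inOdd k v) (inEven k x) = -inOdd k (action x v) := by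
  simp [algebra_mul, mul, inEven_apply, inOdd_apply, zero_evenBracket, oddBracket_zero, zero_action]

theorem mul_inOdd_inOdd (v w : Fin 14 → k) :
    (algebra k).mul (inOdd k v) (inOdd k w) = inEven k (oddBracket v w) := by
  simp [algebra_mul, mul, inEven_apply, inOdd_apply, zero_evenBracket, zero_action]

theorem eq_top_of_units {N : Submodule k (Space k)}
    (he : ∀ l, inEven k (Pi.single l 1) ∈ N) (ho : ∀ l, inOdd k (Pi.single l 1) ∈ N) : N = ⊤ := by
  have h1 : N.comap (inEven k) = ⊤ := even_eq_top he
  have h2 : N.comap (inOdd k) = ⊤ := odd_eq_top ho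
  rw [eq_top_iff]
  intro X _
  rw [← inEven_add_inOdd X]
  refine N.add_mem ?_ ?_
  · rw [← Submodule.mem_comap, h1]
    trivial
  · rw [← Submodule.mem_comap, h2]
    trivial

set_option maxHeartbeats 1000000 in
-- Every even unit vector is, up to a factor ±2, a bracket of two odd ones, so the odd part
-- generates.
theorem oddBracket_single_single :
    oddBracket (Pi.single 8 (1 : k)) (Pi.single 9 1) = (2 : k) • Pi.single 0 1 ∧
    oddBracket (Pi.single 0 (1 : k)) (Pi.single 3 1) = (-2 : k) • Pi.single 1 1 ∧
    oddBracket (Pi.single 4 (1 : k)) (Pi.single 7 1) = (2 : k) • Pi.single 2 1 ∧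
    oddBracket (Pi.single 10 (1 : k)) (Pi.single 11 1) = (2 : k) • Pi.single 3 1 ∧
    oddBracket (Pi.single 0 (1 : k)) (Pi.single 5 1) = (-2 : k) • Pi.single 4 1 ∧
    oddBracket (Pi.single 2 (1 : k)) (Pi.single 7 1) = (2 : k) • Pi.single 5 1 ∧
    oddBracket (Pi.single 12 (1 : k)) (Pi.single 13 1) = (2 : k) • Pi.single 6 1 ∧
    oddBracket (Pi.single 0 (1 : k)) (Pi.single 6 1) = (-2 : k) • Pi.single 7 1 ∧
    oddBracket (Pi.single 1 (1 : k)) (Pi.single 7 1) = (2 : k) • Pi.single 8 1 ∧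
    oddBracket (Pi.single 2 (1 : k)) (Pi.single 9 1) = (2 : k) • Pi.single 9 1 ∧
    oddBracket (Pi.single 0 (1 : k)) (Pi.single 9 1) = (-2 : k) • Pi.single 10 1 ∧
    oddBracket (Pi.single 3 (1 : k)) (Pi.single 9 1) = (2 : k) • Pi.single 11 1 ∧
    oddBracket (Pi.single 1 (1 : k)) (Pi.single 9 1) = (-2 : k) • Pi.single 12 1 ∧
    oddBracket (Pi.single 1 (1 : k)) (Pi.single 11 1) = (2 : k) • Pi.single 13 1 ∧
    oddBracket (Pi.single 0 (1 : k)) (Pi.single 11 1) = (-2 : k) • Pi.single 14 1 ∧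
    oddBracket (Pi.single 5 (1 : k)) (Pi.single 11 1) = (2 : k) • Pi.single 15 1 ∧
    oddBracket (Pi.single 4 (1 : k)) (Pi.single 11 1) = (-2 : k) • Pi.single 16 1 ∧
    oddBracket (Pi.single 4 (1 : k)) (Pi.single 13 1) = (2 : k) • Pi.single 17 1 ∧
    oddBracket (Pi.single 0 (1 : k)) (Pi.single 13 1) = (-2 : k) • Pi.single 18 1 ∧
    oddBracket (Pi.single 6 (1 : k)) (Pi.single 13 1) = (2 : k) • Pi.single 19 1 ∧
    oddBracket (Pi.single 2 (1 : k)) (Pi.single 13 1) = (-2 : k) • Pi.single 20 1 := by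
  refine ⟨?_, ?_, ?_, ?_, ?_, ?_, ?_, ?_, ?_, ?_, ?_, ?_, ?_, ?_, ?_, ?_, ?_, ?_, ?_, ?_, ?_⟩ <;>
    funext m <;> fin_cases m <;> simp [oddBracket, Pi.single_apply]

/-- Each coordinate of `x` occurs, up to sign, as a matrix entry of the action. -/
theorem eq_zero_of_action {x : Fin 21 → k} (h : ∀ v, action x v = 0) : x = 0 := by
  have h' := fun j l => congrFun (h (Pi.single j 1)) l
  funext m
  fin_cases m
  · simpa [action, Pi.single_apply] using h' 8 8
  · simpa [action, Pi.single_apply] using h' 4 0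
  · simpa [action, Pi.single_apply] using h' 0 4
  · simpa [action, Pi.single_apply] using h' 10 10
  · simpa [action, Pi.single_apply] using h' 2 0
  · simpa [action, Pi.single_apply] using h' 0 2
  · simpa [action, Pi.single_apply] using h' 12 12
  · simpa [action, Pi.single_apply] using h' 1 0
  · simpa [action, Pi.single_apply] using h' 0 1
  · simpa [action, Pi.single_apply] using h' 1 8
  · simpa [action, Pi.single_apply] using h' 3 8
  · simpa [action, Pi.single_apply] using h' 0 8
  · simpa [action, Pi.single_apply] using h' 2 8
  · simpa [action, Pi.single_apply] using h' 12 8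
  · simpa [action, Pi.single_apply] using h' 13 8
  · simpa [action, Pi.single_apply] using h' 12 9
  · simpa [action, Pi.single_apply] using h' 13 9
  · simpa [action, Pi.single_apply] using h' 11 9
  · simpa [action, Pi.single_apply] using h' 11 8
  · simpa [action, Pi.single_apply] using h' 10 9
  · simpa [action, Pi.single_apply] using h' 10 8

theorem isSimple_algebra [CharP k 3] : (algebra k).IsSimple := by
  have h2 : (2 : k) ≠ 0 := two_ne_zero_of_charP_three k
  have hn : (-2 : k) ≠ 0 := neg_ne_zero.mpr h2
  obtain ⟨b0, b1, b2, b3, b4, b5, b6, b7, b8, b9, b10, b11, b12, b13, b14, b15, b16, b17, b18, b19, b20⟩ :=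
    oddBracket_single_single (k := k)
  constructor
  · refine ⟨inOdd k (Pi.single 8 1), inOdd k (Pi.single 9 1), fun h => ?_⟩
    rw [mul_inOdd_inOdd, b0] at h
    have h' := congrFun (congrArg Prod.fst h) 0
    simp [inEven_apply, h2] at h'
  · intro I hI hg
    have hcl : ∀ x, ∀ v ∈ I.comap (inOdd k), action x v ∈ I.comap (inOdd k) := by
      intro x v hv
      rw [Submodule.mem_comap, ← mul_inEven_inOdd]
      exact (hI _ hv _).2
    have hodd : ∀ X ∈ I, X.2 ∈ I.comap (inOdd k) := by
      intro X hX
      have h := Superalgebra.proj_mem_of_isHomogeneous _ hg hX 1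
      rw [← inEven_add_inOdd X, map_add,
        (algebra k).proj_of_mem (i := 0) (mem_algebra_even.mpr rfl),
        (algebra k).proj_of_mem (i := 1) (mem_algebra_odd.mpr rfl)] at h
      simpa using h
    -- If the odd part of `I` is zero, an even element of `I` annihilates V(ω₃) and vanishes by
    -- faithfulness; if it is everything, brackets of odd elements supply the even part.
    rcases action_irreducible hcl with h | h
    · left
      rw [Submodule.eq_bot_iff]
      intro X hX
      have hX2 : X.2 = 0 := (Submodule.mem_bot k).mp (h ▸ hodd X hX)
      have hX1 : X.1 = 0 := by
        refine eq_zero_of_action fun v => ?_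
        have hm := (hI X hX (inOdd k v)).1
        rw [← inEven_add_inOdd X, hX2, map_zero, add_zero, mul_inEven_inOdd] at hm
        exact (Submodule.mem_bot k).mp (h ▸ (Submodule.mem_comap.mpr hm))
      exact Prod.ext hX1 hX2
    · right
      have ho : ∀ v, inOdd k v ∈ I := fun v => by
        rw [← Submodule.mem_comap, h]
        trivial
      have key : ∀ {v w : Fin 14 → k} {c : k} {l : Fin 21}, c ≠ 0 →
          oddBracket v w = c • Pi.single l 1 → inEven k (Pi.single l 1) ∈ I := by
        intro v w c l hc hvw
        have hm := I.smul_mem c⁻¹ (hI _ (ho v) (inOdd k w)).1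
        rwa [mul_inOdd_inOdd, hvw, map_smul, smul_smul, inv_mul_cancel₀ hc, one_smul] at hm
      refine eq_top_of_units (fun l => ?_) fun l => ho _
      fin_cases l
      exacts [key h2 b0, key hn b1, key h2 b2, key h2 b3, key hn b4,
        key h2 b5, key h2 b6, key hn b7, key h2 b8, key h2 b9,
        key hn b10, key h2 b11, key hn b12, key h2 b13, key hn b14,
        key h2 b15, key hn b16, key h2 b17, key hn b18, key h2 b19,
        key hn b20]

end SpWedgeModel

/-! ### Roots and the principal grading -/

namespace SpWedgeModel

variable {k : Type*} [Field k]

/-- The roots of `sp₆`. -/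
def rootWeight : Fin 21 → Fin 3 → ℤ
  | 0 => ![0, 0, 0]
  | 1 => ![2, 0, 0]
  | 2 => ![-2, 0, 0]
  | 3 => ![0, 0, 0]
  | 4 => ![0, 2, 0]
  | 5 => ![0, -2, 0]
  | 6 => ![0, 0, 0]
  | 7 => ![0, 0, 2]
  | 8 => ![0, 0, -2]
  | 9 => ![0, -1, 1]
  | 10 => ![0, 1, 1]
  | 11 => ![0, -1, -1]
  | 12 => ![0, 1, -1]
  | 13 => ![1, 0, -1]
  | 14 => ![1, 0, 1]
  | 15 => ![-1, 0, -1]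
  | 16 => ![-1, 0, 1]
  | 17 => ![-1, 1, 0]
  | 18 => ![1, 1, 0]
  | 19 => ![-1, -1, 0]
  | 20 => ![1, -1, 0]
  | ⟨_ + 21, h⟩ => absurd h (by omega)

theorem torus_evenBracket (c : Fin 3 → k) (y : Fin 21 → k) (l : Fin 21) :
    evenBracket (torus c) y l = (∑ m, c m * rootWeight l m) * y l := by
  fin_cases l <;> simp [evenBracket, torus, rootWeight,
    Fin.sum_univ_three, -mul_eq_mul_right_iff, -mul_eq_mul_left_iff] <;> ring

/-- The degrees of the coordinates of the even part in the principal grading. -/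
def evenDegree : Fin 21 → ℤ
  -- The degrees come from giving δ₁, δ₂, δ₃ the values 4, 1, 2, for which the simple roots δ₃ - δ₂,
  -- δ₂ and δ₁ - δ₂ - δ₃ have degree 1.
  | 0 => 0
  | 1 => 8
  | 2 => -8
  | 3 => 0
  | 4 => 2
  | 5 => -2
  | 6 => 0
  | 7 => 4
  | 8 => -4
  | 9 => 1
  | 10 => 3
  | 11 => -3
  | 12 => -1
  | 13 => 2
  | 14 => 6
  | 15 => -6
  | 16 => -2
  | 17 => -3
  | 18 => 5
  | 19 => -5
  | 20 => 3
  | ⟨_ + 21, h⟩ => absurd h (by omega)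

/-- The degrees of the coordinates of the odd part in the principal grading. -/
def oddDegree : Fin 14 → ℤ
  | 0 => 7
  | 1 => 3
  | 2 => 5
  | 3 => 1
  | 4 => -1
  | 5 => -5
  | 6 => -3
  | 7 => -7
  | 8 => 4
  | 9 => -4
  | 10 => 1
  | 11 => -1
  | 12 => 2
  | 13 => -2

variable (k)

/-- The components of the principal grading. -/
def degree (m : ℤ) : Submodule k (Space k) where
  carrier := {X | (∀ l, evenDegree l ≠ m → X.1 l = 0) ∧ ∀ l, oddDegree l ≠ m → X.2 l = 0}
  add_mem' hX hY := ⟨fun l hl => by simp [hX.1 l hl, hY.1 l hl],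
    fun l hl => by simp [hX.2 l hl, hY.2 l hl]⟩
  zero_mem' := ⟨fun _ _ => rfl, fun _ _ => rfl⟩
  smul_mem' c X hX := ⟨fun l hl => by simp [hX.1 l hl], fun l hl => by simp [hX.2 l hl]⟩

/-- The projections of the principal grading. -/
def degreeProj (m : ℤ) : Space k →ₗ[k] Space k where
  toFun X := (fun l => if evenDegree l = m then X.1 l else 0,
    fun l => if oddDegree l = m then X.2 l else 0)
  map_add' X Y := by
    refine Prod.ext (funext fun l => ?_) (funext fun l => ?_) <;> simp <;> split_ifs <;> simp
  map_smul' c X := by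
    refine Prod.ext (funext fun l => ?_) (funext fun l => ?_) <;> simp

variable {k}

theorem degreeProj_apply {m : ℤ} (m' : ℤ) {X : Space k} (hX : X ∈ degree k m) :
    degreeProj k m' X = if m' = m then X else 0 := by
  refine Prod.ext (funext fun l => ?_) (funext fun l => ?_)
  · have h := hX.1 l
    by_cases h1 : evenDegree l = m' <;> by_cases h2 : m' = m <;> simp_all [degreeProj]
  · have h := hX.2 l
    by_cases h1 : oddDegree l = m' <;> by_cases h2 : m' = m <;> simp_all [degreeProj]

theorem inEven_mem_degree {m : ℤ} {x : Fin 21 → k} (h : ∀ l, evenDegree l ≠ m → x l = 0) :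
    inEven k x ∈ degree k m := ⟨h, fun _ _ => rfl⟩

theorem inOdd_mem_degree {m : ℤ} {v : Fin 14 → k} (h : ∀ l, oddDegree l ≠ m → v l = 0) :
    inOdd k v ∈ degree k m := ⟨fun _ _ => rfl, h⟩

end SpWedgeModel

namespace SpWedgeModel

variable {k : Type*} [Field k]

theorem mul_inEven (x : Fin 21 → k) (X : Space k) :
    (algebra k).mul (inEven k x) X = (evenBracket x X.1, action x X.2) := by
  simp [algebra_mul, mul, inEven_apply, action_zero, zero_oddBracket]

theorem mul_inOdd (v : Fin 14 → k) (X : Space k) :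
    (algebra k).mul (inOdd k v) X = (oddBracket v X.2, -action X.1 v) := by
  simp [algebra_mul, mul, inOdd_apply, zero_evenBracket, zero_action]

/-- A linear endomorphism raises the degree by `d`. -/
def RaisesDegree (d : ℤ) (X : Space k) : Prop :=
  ∀ m, ∀ Y ∈ degree k m, (algebra k).mul X Y ∈ degree k (m + d)

theorem RaisesDegree.neg {d : ℤ} {X : Space k} (h : RaisesDegree d X) : RaisesDegree d (-X) := by
  intro m Y hY
  rw [map_neg, LinearMap.neg_apply]
  exact (degree k (m + d)).neg_mem (h m Y hY)

/-- The hypotheses say that coordinate `l` of the product involves only coordinates whose degree is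
lower by `d`. In this form they are checked by `simp`, with `decide` comparing degrees. -/
theorem raisesDegree_inEven {d : ℤ} {x : Fin 21 → k}
    (h1 : ∀ y l, (∀ j, evenDegree j + d = evenDegree l → y j = 0) → evenBracket x y l = 0)
    (h2 : ∀ v l, (∀ j, oddDegree j + d = oddDegree l → v j = 0) → action x v l = 0) :
    RaisesDegree d (inEven k x) := by
  intro m Y hY
  rw [mul_inEven]
  exact ⟨fun l hl => h1 _ l fun j hj => hY.1 j (by omega),
    fun l hl => h2 _ l fun j hj => hY.2 j (by omega)⟩

theorem raisesDegree_inOdd {d : ℤ} {v : Fin 14 → k}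
    (h1 : ∀ w l, (∀ j, oddDegree j + d = evenDegree l → w j = 0) → oddBracket v w l = 0)
    (h2 : ∀ y l, (∀ j, evenDegree j + d = oddDegree l → y j = 0) → action y v l = 0) :
    RaisesDegree d (inOdd k v) := by
  intro m Y hY
  rw [mul_inOdd]
  exact ⟨fun l hl => h1 _ l fun j hj => hY.2 j (by omega),
    fun l hl => neg_eq_zero.mpr (h2 _ l fun j hj => hY.1 j (by omega))⟩

/-- This and the next five cover the generators: 9, 10, 3 are the positions of the simple root
vectors, 12, 11, 4 those of their negatives. -/
theorem raisesDegree_even_nine : RaisesDegree 1 (inEven k (Pi.single 9 1)) := by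
  refine raisesDegree_inEven (fun y l h => ?_) fun v l h => ?_ <;> fin_cases l <;>
    simp (discharger := decide) [evenBracket, action, Pi.single_apply, h]

theorem raisesDegree_even_twelve : RaisesDegree (-1) (inEven k (Pi.single 12 1)) := by
  refine raisesDegree_inEven (fun y l h => ?_) fun v l h => ?_ <;> fin_cases l <;>
    simp (discharger := decide) [evenBracket, action, Pi.single_apply, h]

theorem raisesDegree_odd_ten : RaisesDegree 1 (inOdd k (Pi.single 10 1)) := by
  refine raisesDegree_inOdd (fun y l h => ?_) fun v l h => ?_ <;> fin_cases l <;>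
    simp (discharger := decide) [oddBracket, action, Pi.single_apply, h]

theorem raisesDegree_odd_eleven : RaisesDegree (-1) (inOdd k (Pi.single 11 1)) := by
  refine raisesDegree_inOdd (fun y l h => ?_) fun v l h => ?_ <;> fin_cases l <;>
    simp (discharger := decide) [oddBracket, action, Pi.single_apply, h]

theorem raisesDegree_odd_three : RaisesDegree 1 (inOdd k (Pi.single 3 1)) := by
  refine raisesDegree_inOdd (fun y l h => ?_) fun v l h => ?_ <;> fin_cases l <;>
    simp (discharger := decide) [oddBracket, action, Pi.single_apply, h]

theorem raisesDegree_odd_four : RaisesDegree (-1) (inOdd k (Pi.single 4 1)) := by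
  refine raisesDegree_inOdd (fun y l h => ?_) fun v l h => ?_ <;> fin_cases l <;>
    simp (discharger := decide) [oddBracket, action, Pi.single_apply, h]

end SpWedgeModel

/-! ### Generation by simple root vectors -/

namespace SpWedgeModel

variable {k : Type*} [Field k]

set_option maxHeartbeats 1000000 in
theorem evenBracket_single_single :
    evenBracket (Pi.single 9 (1 : k)) (Pi.single 10 1) = (2 : k) • Pi.single 7 1 ∧
    evenBracket (Pi.single 12 (1 : k)) (Pi.single 11 1) = (2 : k) • Pi.single 8 1 := by
  refine ⟨?_, ?_⟩ <;>
    funext m <;> fin_cases m <;> simp [evenBracket, Pi.single_apply]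

set_option maxHeartbeats 1000000 in
theorem action_single_single_generators :
    action (Pi.single 9 (1 : k)) (Pi.single 10 1) = (-1 : k) • Pi.single 12 1 ∧
    action (Pi.single 12 (1 : k)) (Pi.single 11 1) = (-1 : k) • Pi.single 13 1 ∧
    action (Pi.single 4 (1 : k)) (Pi.single 3 1) = (1 : k) • Pi.single 1 1 ∧
    action (Pi.single 5 (1 : k)) (Pi.single 4 1) = (1 : k) • Pi.single 6 1 ∧
    action (Pi.single 10 (1 : k)) (Pi.single 3 1) = (1 : k) • Pi.single 8 1 ∧
    action (Pi.single 11 (1 : k)) (Pi.single 4 1) = (-1 : k) • Pi.single 9 1 ∧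
    action (Pi.single 7 (1 : k)) (Pi.single 3 1) = (1 : k) • Pi.single 2 1 ∧
    action (Pi.single 8 (1 : k)) (Pi.single 4 1) = (1 : k) • Pi.single 5 1 ∧
    action (Pi.single 14 (1 : k)) (Pi.single 10 1) = (-2 : k) • Pi.single 0 1 ∧
    action (Pi.single 15 (1 : k)) (Pi.single 11 1) = (2 : k) • Pi.single 7 1 := by
  refine ⟨?_, ?_, ?_, ?_, ?_, ?_, ?_, ?_, ?_, ?_⟩ <;>
    funext m <;> fin_cases m <;> simp [action, Pi.single_apply]

set_option maxHeartbeats 1000000 in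
theorem oddBracket_single_single_generators :
    oddBracket (Pi.single 10 (1 : k)) (Pi.single 10 1) = (-4 : k) • Pi.single 4 1 ∧
    oddBracket (Pi.single 3 (1 : k)) (Pi.single 10 1) = (-2 : k) • Pi.single 13 1 ∧
    oddBracket (Pi.single 11 (1 : k)) (Pi.single 10 1) = (2 : k) • Pi.single 3 1 ∧
    oddBracket (Pi.single 11 (1 : k)) (Pi.single 11 1) = (4 : k) • Pi.single 5 1 ∧
    oddBracket (Pi.single 4 (1 : k)) (Pi.single 11 1) = (-2 : k) • Pi.single 16 1 ∧
    oddBracket (Pi.single 10 (1 : k)) (Pi.single 12 1) = (2 : k) • Pi.single 10 1 ∧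
    oddBracket (Pi.single 3 (1 : k)) (Pi.single 12 1) = (2 : k) • Pi.single 20 1 ∧
    oddBracket (Pi.single 11 (1 : k)) (Pi.single 13 1) = (-2 : k) • Pi.single 11 1 ∧
    oddBracket (Pi.single 4 (1 : k)) (Pi.single 13 1) = (2 : k) • Pi.single 17 1 ∧
    oddBracket (Pi.single 10 (1 : k)) (Pi.single 8 1) = (2 : k) • Pi.single 18 1 ∧
    oddBracket (Pi.single 11 (1 : k)) (Pi.single 9 1) = (-2 : k) • Pi.single 19 1 ∧
    oddBracket (Pi.single 10 (1 : k)) (Pi.single 2 1) = (2 : k) • Pi.single 14 1 ∧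
    oddBracket (Pi.single 11 (1 : k)) (Pi.single 5 1) = (2 : k) • Pi.single 15 1 ∧
    oddBracket (Pi.single 3 (1 : k)) (Pi.single 0 1) = (-2 : k) • Pi.single 1 1 ∧
    oddBracket (Pi.single 4 (1 : k)) (Pi.single 7 1) = (2 : k) • Pi.single 2 1 := by
  refine ⟨?_, ?_, ?_, ?_, ?_, ?_, ?_, ?_, ?_, ?_, ?_, ?_, ?_, ?_, ?_⟩ <;>
    funext m <;> fin_cases m <;> simp [oddBracket, Pi.single_apply]

/-- The simple root vectors and their negatives generate the superalgebra. -/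
theorem eq_top_of_generators [CharP k 3] {N : Submodule k (Space k)}
    (hN : ∀ X ∈ N, ∀ Y ∈ N, (algebra k).mul X Y ∈ N)
    (u9 : inEven k (Pi.single 9 1) ∈ N) (u31 : inOdd k (Pi.single 10 1) ∈ N)
    (u24 : inOdd k (Pi.single 3 1) ∈ N) (u12 : inEven k (Pi.single 12 1) ∈ N)
    (u32 : inOdd k (Pi.single 11 1) ∈ N) (u25 : inOdd k (Pi.single 4 1) ∈ N) : N = ⊤ := by
  have cee : ∀ {x y z : Fin 21 → k} {c : k}, c ≠ 0 → evenBracket x y = c • z →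
      inEven k x ∈ N → inEven k y ∈ N → inEven k z ∈ N := by
    intro x y z c hc h hx hy
    have hm := N.smul_mem c⁻¹ (hN _ hx _ hy)
    rwa [mul_inEven_inEven, h, map_smul, smul_smul, inv_mul_cancel₀ hc, one_smul] at hm
  have ceo : ∀ {x : Fin 21 → k} {v w : Fin 14 → k} {c : k}, c ≠ 0 → action x v = c • w →
      inEven k x ∈ N → inOdd k v ∈ N → inOdd k w ∈ N := by
    intro x v w c hc h hx hv
    have hm := N.smul_mem c⁻¹ (hN _ hx _ hv)
    rwa [mul_inEven_inOdd, h, map_smul, smul_smul, inv_mul_cancel₀ hc, one_smul] at hm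
  have coo : ∀ {v w : Fin 14 → k} {z : Fin 21 → k} {c : k}, c ≠ 0 → oddBracket v w = c • z →
      inOdd k v ∈ N → inOdd k w ∈ N → inEven k z ∈ N := by
    intro v w z c hc h hv hw
    have hm := N.smul_mem c⁻¹ (hN _ hv _ hw)
    rwa [mul_inOdd_inOdd, h, map_smul, smul_smul, inv_mul_cancel₀ hc, one_smul] at hm
  have h1 : (1 : k) ≠ 0 := one_ne_zero
  have m1 : (-1 : k) ≠ 0 := neg_ne_zero.mpr h1
  have h2 : (2 : k) ≠ 0 := two_ne_zero_of_charP_three k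
  have m2 : (-2 : k) ≠ 0 := neg_ne_zero.mpr h2
  have h4 : (4 : k) ≠ 0 := by
    have h := mul_ne_zero h2 h2
    norm_num at h
    exact h
  have m4 : (-4 : k) ≠ 0 := neg_ne_zero.mpr h4
  obtain ⟨a0, a1⟩ :=
    evenBracket_single_single (k := k)
  obtain ⟨c0, c1, c2, c3, c4, c5, c6, c7, c8, c9⟩ :=
    action_single_single_generators (k := k)
  obtain ⟨b0, b1, b2, b3, b4, b5, b6, b7, b8, b9, b10, b11, b12, b13, b14⟩ :=
    oddBracket_single_single_generators (k := k)
  -- `u i` is the membership of the unit vector `i`, even coordinates being numbered 0–20 and odd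
  -- coordinate `j` being `21 + j`. Each line divides a known bracket by its nonzero coefficient.
  have u33 := ceo m1 c0 u9 u31
  have u4 := coo m4 b0 u31 u31
  have u13 := coo m2 b1 u24 u31
  have u3 := coo h2 b2 u32 u31
  have u34 := ceo m1 c1 u12 u32
  have u5 := coo h4 b3 u32 u32
  have u16 := coo m2 b4 u25 u32
  have u10 := coo h2 b5 u31 u33
  have u20 := coo h2 b6 u24 u33
  have u22 := ceo h1 c2 u4 u24
  have u11 := coo m2 b7 u32 u34
  have u17 := coo h2 b8 u25 u34
  have u27 := ceo h1 c3 u5 u25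
  have u7 := cee h2 a0 u9 u10
  have u29 := ceo h1 c4 u10 u24
  have u8 := cee h2 a1 u12 u11
  have u30 := ceo m1 c5 u11 u25
  have u23 := ceo h1 c6 u7 u24
  have u18 := coo h2 b9 u31 u29
  have u26 := ceo h1 c7 u8 u25
  have u19 := coo m2 b10 u32 u30
  have u14 := coo h2 b11 u31 u23
  have u15 := coo h2 b12 u32 u26
  have u21 := ceo m2 c8 u14 u31
  have u28 := ceo h2 c9 u15 u32
  have u1 := coo m2 b13 u24 u21
  have u2 := coo h2 b14 u25 u28
  obtain ⟨d0, -, -, -, -, -, d6, -⟩ := oddBracket_single_single (k := k)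
  have u0 := coo h2 d0 u29 u30
  have u6 := coo h2 d6 u33 u34
  refine eq_top_of_units (fun l => ?_) fun l => ?_ <;> fin_cases l
  exacts [u0, u1, u2, u3, u4, u5, u6, u7, u8, u9,
    u10, u11, u12, u13, u14, u15, u16, u17, u18, u19,
    u20, u21, u22, u23, u24, u25, u26, u27, u28, u29,
    u30, u31, u32, u33, u34]

end SpWedgeModel

/-! ### Chevalley generators and arbitrary realizations -/

namespace SpWedgeModel

variable {k : Type*} [Field k]

variable (k)

/-- The simple root vectors. -/
def simpleE : Fin 3 → Space k
  | 0 => inEven k (Pi.single 9 1)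
  | 1 => inOdd k (Pi.single 10 1)
  | 2 => inOdd k (Pi.single 3 1)

/-- The negatives of the simple root vectors. -/
def simpleF : Fin 3 → Space k
  | 0 => -inEven k (Pi.single 12 1)
  | 1 => inOdd k (Pi.single 11 1)
  | 2 => -inOdd k (Pi.single 4 1)

/-- The coroots as diagonal matrices. -/
def corootVector : Fin 3 → Fin 3 → k
  | 0 => ![0, -1, 1]
  | 1 => ![0, 2, 0]
  | 2 => ![-1, 1, 1]

/-- The simple roots. -/
def rootVector : Fin 3 → Fin 3 → k
  | 0 => ![0, -1, 1]
  | 1 => ![0, 1, 0]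
  | 2 => ![1, -1, -1]

/-- The inclusion of the diagonal matrices. -/
def torusMap : (Fin 3 → k) →ₗ[k] Space k :=
  inEven k ∘ₗ
    { toFun := torus
      map_add' := fun c c' => by funext l; fin_cases l <;> simp [torus]
      map_smul' := fun a c => by funext l; fin_cases l <;> simp [torus] }

variable {k}

theorem torusMap_apply (c : Fin 3 → k) : torusMap k c = inEven k (torus c) := rfl

theorem torusMap_injective : Function.Injective (torusMap k) := by
  intro c c' h
  have h' : torus c = torus c' := congrArg Prod.fst h
  funext m
  fin_cases m
  · exact congrFun h' 0
  · exact congrFun h' 3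
  · exact congrFun h' 6

/-- The signs in `simpleF` are chosen so that these coroots give the matrix A itself, without
rescaling rows. -/
theorem mul_simpleE_simpleF (i : Fin 3) :
    (algebra k).mul (simpleE k i) (simpleF k i) = torusMap k (corootVector k i) := by
  fin_cases i
  · change (algebra k).mul (inEven k _) (-inEven k _) = _
    rw [map_neg, mul_inEven_inEven, ← map_neg, torusMap_apply]
    refine congrArg (inEven k) (funext fun l => ?_)
    fin_cases l <;> simp [evenBracket, torus, corootVector, Pi.single_apply]
  · change (algebra k).mul (inOdd k _) (inOdd k _) = _
    rw [mul_inOdd_inOdd, torusMap_apply]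
    refine congrArg (inEven k) (funext fun l => ?_)
    fin_cases l <;> simp [oddBracket, torus, corootVector, Pi.single_apply]
  · change (algebra k).mul (inOdd k _) (-inOdd k _) = _
    rw [map_neg, mul_inOdd_inOdd, ← map_neg, torusMap_apply]
    refine congrArg (inEven k) (funext fun l => ?_)
    fin_cases l <;> simp [oddBracket, torus, corootVector, Pi.single_apply]

/-- The difference of two distinct simple roots, as an integral vector, is not a weight of the
superalgebra. -/
theorem mul_simpleE_simpleF_of_ne {i j : Fin 3} (hij : i ≠ j) :
    (algebra k).mul (simpleE k i) (simpleF k j) = 0 := by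
  have h1 : action (Pi.single 9 1) (Pi.single 11 1) = (0 : Fin 14 → k) := by
    funext l; fin_cases l <;> simp [action, Pi.single_apply]
  have h2 : action (Pi.single 9 1) (Pi.single 4 1) = (0 : Fin 14 → k) := by
    funext l; fin_cases l <;> simp [action, Pi.single_apply]
  have h3 : action (Pi.single 12 1) (Pi.single 10 1) = (0 : Fin 14 → k) := by
    funext l; fin_cases l <;> simp [action, Pi.single_apply]
  have h4 : oddBracket (Pi.single 10 1) (Pi.single 4 1) = (0 : Fin 21 → k) := by
    funext l; fin_cases l <;> simp [oddBracket, Pi.single_apply]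
  have h5 : action (Pi.single 12 1) (Pi.single 3 1) = (0 : Fin 14 → k) := by
    funext l; fin_cases l <;> simp [action, Pi.single_apply]
  have h6 : oddBracket (Pi.single 3 1) (Pi.single 11 1) = (0 : Fin 21 → k) := by
    funext l; fin_cases l <;> simp [oddBracket, Pi.single_apply]
  fin_cases i <;> fin_cases j <;> first | exact absurd rfl hij | skip
  all_goals simp only [Fin.reduceFinMk, Fin.zero_eta, Fin.mk_one, Fin.isValue, simpleE, simpleF,
      map_neg, mul_inEven_inEven, mul_inOdd_inOdd, mul_inEven_inOdd, mul_inOdd_inEven, h1, h2, h3,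
      h4, h5, h6, map_zero, neg_zero]

theorem mul_torusMap_inEven (c : Fin 3 → k) (l : Fin 21) :
    (algebra k).mul (torusMap k c) (inEven k (Pi.single l 1)) =
      (∑ m, c m * rootWeight l m) • inEven k (Pi.single l 1) := by
  rw [torusMap_apply, mul_inEven_inEven, ← map_smul]
  refine congrArg (inEven k) (funext fun i => ?_)
  rw [torus_evenBracket]
  by_cases h : i = l
  · subst h; simp
  · simp [h]

theorem mul_torusMap_inOdd (c : Fin 3 → k) (l : Fin 14) :
    (algebra k).mul (torusMap k c) (inOdd k (Pi.single l 1)) =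
      (∑ m, c m * weight l m) • inOdd k (Pi.single l 1) := by
  rw [torusMap_apply, mul_inEven_inOdd, ← map_smul]
  refine congrArg (inOdd k) (funext fun i => ?_)
  rw [torus_action]
  by_cases h : i = l
  · subst h; simp
  · simp [h]

theorem mul_torusMap_simpleE (c : Fin 3 → k) (i : Fin 3) :
    (algebra k).mul (torusMap k c) (simpleE k i) = (∑ m, c m * rootVector k i m) • simpleE k i := by
  fin_cases i <;>
    simp [simpleE, mul_torusMap_inEven, mul_torusMap_inOdd, rootVector, rootWeight, weight,
      Fin.sum_univ_three]

theorem mul_torusMap_simpleF (c : Fin 3 → k) (i : Fin 3) :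
    (algebra k).mul (torusMap k c) (simpleF k i) =
      -((∑ m, c m * rootVector k i m) • simpleF k i) := by
  fin_cases i <;>
    simp [simpleF, mul_torusMap_inEven, mul_torusMap_inOdd, rootVector, rootWeight, weight,
      Fin.sum_univ_three] <;> module

theorem mul_torusMap_torusMap (c c' : Fin 3 → k) :
    (algebra k).mul (torusMap k c) (torusMap k c') = 0 := by
  rw [torusMap_apply, torusMap_apply, mul_inEven_inEven]
  have h : evenBracket (torus c) (torus c') = 0 := by
    funext l
    rw [torus_evenBracket]
    fin_cases l <;> simp [torus, rootWeight, Fin.sum_univ_three]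
  rw [h, map_zero]

/-- Over ℤ the products contain -2 and -3 where A has 1 and 0; they agree modulo 3. -/
theorem sum_corootVector_mul_rootVector [CharP k 3] (i j : Fin 3) :
    ∑ m, corootVector k i m * rootVector k j m = cartanMatrixS1S42 k i j := by
  have h3 : (3 : k) = 0 := by exact_mod_cast CharP.cast_eq_zero k 3
  fin_cases i <;> fin_cases j <;>
    simp [corootVector, rootVector, cartanMatrixS1S42, Fin.sum_univ_three] <;> grind

/-- The determinant is -2 over ℤ. -/
theorem det_cartanMatrix [CharP k 3] : (cartanMatrixS1S42 k).det = 1 := by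
  have h3 : (3 : k) = 0 := by exact_mod_cast CharP.cast_eq_zero k 3
  rw [cartanMatrixS1S42, Matrix.det_fin_three]
  simp
  grind

theorem rank_cartanMatrix [CharP k 3] : (cartanMatrixS1S42 k).rank = 3 := by
  have h : IsUnit (cartanMatrixS1S42 k) := by
    rw [Matrix.isUnit_iff_isUnit_det, det_cartanMatrix]
    exact isUnit_one
  simpa using Matrix.rank_of_isUnit _ h

section

variable [CharP k 3] {𝔥 : Type*} [AddCommGroup 𝔥] [Module k 𝔥]
  (R : Realization (cartanMatrixS1S42 k) 𝔥)

/-- The basis of coroots. -/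
noncomputable def corootBasis : Module.Basis (Fin 3) k 𝔥 :=
  basisOfLinearIndependentOfCardEqFinrank R.coroot_linearIndependent (by
    -- The rank is 3, so dim 𝔥 = 6 - 3 = 3 and the coroots already span.
    have h := R.finrank_eq
    rw [rank_cartanMatrix] at h
    rw [Fintype.card_fin]
    omega)

theorem corootBasis_apply (i : Fin 3) : corootBasis R i = R.coroot i := by
  simp [corootBasis]

/-- The identification of a realization with the diagonal matrices. -/
noncomputable def toTorus : 𝔥 →ₗ[k] (Fin 3 → k) := (corootBasis R).constr k (corootVector k)

theorem toTorus_coroot (i : Fin 3) : toTorus R (R.coroot i) = corootVector k i := by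
  rw [← corootBasis_apply, toTorus, Module.Basis.constr_basis]

/-- Coroots form a basis and on it both sides are entries of A, so an abstract realization has no
freedom beyond the concrete one. -/
theorem root_eq (x : 𝔥) (j : Fin 3) : R.root j x = ∑ m, toTorus R x m * rootVector k j m := by
  have h : R.root j =
      (∑ m, rootVector k j m • LinearMap.proj m : (Fin 3 → k) →ₗ[k] k) ∘ₗ toTorus R := by
    refine (corootBasis R).ext fun i => ?_
    rw [corootBasis_apply, R.root_coroot, LinearMap.comp_apply, toTorus_coroot,
      ← sum_corootVector_mul_rootVector]
    simp [mul_comm]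
  rw [h]
  simp [mul_comm]

theorem toTorus_injective : Function.Injective (toTorus R) := by
  rw [injective_iff_map_eq_zero]
  intro x hx
  have h : ∀ i, (corootBasis R).equivFun x i = 0 := by
    have e := (corootBasis R).constr_apply_fintype k (corootVector k) x
    rw [show (corootBasis R).constr k (corootVector k) x = toTorus R x from rfl, hx] at e
    have e0 := congrFun e 0
    have e1 := congrFun e 1
    have e2 := congrFun e 2
    -- The three coroot vectors are independent because 2 ≠ 0.
    simp [Fin.sum_univ_three, corootVector] at e0 e1 e2
    have h2 : (2 : k) ≠ 0 := two_ne_zero_of_charP_three k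
    rw [e0] at e1 e2
    simp only [add_zero] at e2
    rw [← e2] at e1
    simp [h2] at e1
    intro i
    fin_cases i
    · exact e2.symm
    · exact e1
    · exact e0
  refine (corootBasis R).ext_elem fun i => ?_
  simpa using h i

open Contragredient in
/-- The simple root vectors form a Chevalley system. -/
noncomputable def chevalleySystem : ChevalleySystem R {1, 2} (algebra k) where
  e := simpleE k
  f := simpleF k
  h := torusMap k ∘ₗ toTorus R
  e_mem i := by
    fin_cases i <;> simp [Gen.parity, simpleE, mem_algebra_even, mem_algebra_odd, inEven_apply,
      inOdd_apply]
  f_mem i := by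
    fin_cases i <;> simp [Gen.parity, simpleF, mem_algebra_even, mem_algebra_odd, inEven_apply,
      inOdd_apply]
  h_mem x := mem_algebra_even.mpr rfl
  e_f i := by rw [mul_simpleE_simpleF, LinearMap.comp_apply, toTorus_coroot]
  e_f_ne i j hij := mul_simpleE_simpleF_of_ne hij
  h_h x y := mul_torusMap_torusMap _ _
  h_e x i := by rw [LinearMap.comp_apply, mul_torusMap_simpleE, root_eq]
  h_f x i := by rw [LinearMap.comp_apply, mul_torusMap_simpleF, root_eq]
  h_injective := torusMap_injective.comp (toTorus_injective R)
  h_ne_zero := by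
    refine ⟨R.coroot 1, fun h => ?_⟩
    have h' : torusMap k (toTorus R (R.coroot 1)) = 0 := h
    rw [← (torusMap k).map_zero] at h'
    have h0 := congrFun (torusMap_injective h') 1
    rw [toTorus_coroot] at h0
    exact two_ne_zero_of_charP_three k (by simpa [corootVector] using h0)
  generates N hN he hf := by
    refine eq_top_of_generators hN (he 0) (he 1) (he 2) ?_ (hf 1) ?_
    · exact N.neg_mem_iff.mp (hf 0)
    · exact N.neg_mem_iff.mp (hf 2)
  deg := degree k
  deg_h x := by
    refine inEven_mem_degree fun l hl => ?_
    revert hl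
    fin_cases l <;> simp [evenDegree, torus]
  deg_e i := by
    fin_cases i
    · exact inEven_mem_degree fun l hl => Pi.single_eq_of_ne (by rintro rfl; exact hl rfl) _
    · exact inOdd_mem_degree fun l hl => Pi.single_eq_of_ne (by rintro rfl; exact hl rfl) _
    · exact inOdd_mem_degree fun l hl => Pi.single_eq_of_ne (by rintro rfl; exact hl rfl) _
  deg_f i := by
    fin_cases i
    · exact Submodule.neg_mem _ (inEven_mem_degree fun l hl =>
        Pi.single_eq_of_ne (by rintro rfl; exact hl rfl) _)
    · exact inOdd_mem_degree fun l hl => Pi.single_eq_of_ne (by rintro rfl; exact hl rfl) _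
    · exact Submodule.neg_mem _ (inOdd_mem_degree fun l hl =>
        Pi.single_eq_of_ne (by rintro rfl; exact hl rfl) _)
  deg_e_mul i m X hX := by
    fin_cases i
    · exact raisesDegree_even_nine m X hX
    · exact raisesDegree_odd_ten m X hX
    · exact raisesDegree_odd_three m X hX
  deg_f_mul i m X hX := by
    fin_cases i
    · exact raisesDegree_even_twelve.neg m X hX
    · exact raisesDegree_odd_eleven m X hX
    · exact raisesDegree_odd_four.neg m X hX
  degProj := degreeProj k
  degProj_apply m m' X hX := degreeProj_apply m' hX

theorem nonempty_iso_contragredient : Nonempty ((algebra k).Iso (contragredient R {1, 2})) :=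
  (chevalleySystem R).nonempty_iso isLie_algebra isSimple_algebra

end

/-- A realization of the Cartan matrix on `k³`. -/
theorem nonempty_realization [CharP k 3] :
    Nonempty (Realization (cartanMatrixS1S42 k) (Fin 3 → k)) := by
  have hdet : IsUnit (cartanMatrixS1S42 k).det := by
    rw [det_cartanMatrix]
    exact isUnit_one
  refine ⟨{
    -- With the standard basis as coroots the roots must be the columns of A, which are independent
    -- since A is invertible.
    root := fun j => ∑ i, cartanMatrixS1S42 k i j • LinearMap.proj i
    coroot := fun i => Pi.single i 1
    root_linearIndependent := ?_
    coroot_linearIndependent := ?_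
    root_coroot := ?_
    finite := inferInstance
    finrank_eq := ?_ }⟩
  · rw [Fintype.linearIndependent_iff]
    intro g hg
    have h : (cartanMatrixS1S42 k).mulVec g = 0 := by
      funext i
      have h := LinearMap.congr_fun hg (Pi.single i 1)
      simpa [Matrix.mulVec, dotProduct, Pi.single_apply, mul_comm] using h
    exact congrFun (Matrix.eq_zero_of_mulVec_eq_zero hdet.ne_zero h)
  · have h := (Pi.basisFun k (Fin 3)).linearIndependent
    have e : (fun i => Pi.single i 1 : Fin 3 → Fin 3 → k) = Pi.basisFun k (Fin 3) :=
      funext fun i => (Pi.basisFun_apply k (Fin 3) i).symm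
    rwa [e]
  · intro i j
    simp [Pi.single_apply]
  · rw [rank_cartanMatrix, Module.finrank_fin_fun]

end SpWedgeModel

/-! ### Even and odd part, and conclusion -/

open SpWedgeModel in
-- Both sides were given the same coordinates: `sp6Equiv` turns `evenBracket` into the commutator,
-- and `kerEquiv` turns the action on the kernel into `action`.
theorem SpWedgeModel.exists_equiv_sp6_ker {k : Type*} [Field k] [CharP k 3] :
    ∃ (φ : (algebra k).gr 0 ≃ₗ[k] sp6 k)
      (ψ : (algebra k).gr 1 ≃ₗ[k] LinearMap.ker (contraction k)),
      (∀ x y, φ ((algebra k).evenMul x y) = ⁅φ x, φ y⁆) ∧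
      ∀ x y, (ψ ((algebra k).evenAct x y) : ⋀[k]^3 (W6 k)) = spWedge (φ x) (ψ y) := by
  refine ⟨(evenEquiv k).trans (sp6Equiv k), (oddEquiv k).trans (kerEquiv k).symm,
    fun x y => ?_, fun x y => ?_⟩
  · change sp6Equiv k ((algebra k).mul x.1 y.1).1 = ⁅sp6Equiv k x.1.1, sp6Equiv k y.1.1⁆
    have hx := mem_algebra_even.mp x.2
    rw [← sp6Equiv_evenBracket, algebra_mul, mul, hx, zero_oddBracket, add_zero]
  · change ((kerEquiv k).symm ((algebra k).mul x.1 y.1).2).1 =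
      spWedge (sp6Equiv k x.1.1) ((kerEquiv k).symm y.1.2).1
    have hy := mem_algebra_odd.mp y.2
    have hm := spWedge_mem_ker (sp6Equiv k x.1.1) ((kerEquiv k).symm y.1.2).2
    have h := coordinates_spWedge x.1.1 ((kerEquiv k).symm y.1.2).2
    rw [← kerEquiv_apply, LinearEquiv.apply_symm_apply] at h
    have e : (kerEquiv k).symm ((algebra k).mul x.1 y.1).2 = ⟨_, hm⟩ := by
      rw [LinearEquiv.symm_apply_eq, kerEquiv_apply, h, algebra_mul, mul, hy, zero_action, sub_zero]
    rw [e]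

namespace Superalgebra

variable {k A A' : Type*} [Field k] [AddCommGroup A] [Module k A] [AddCommGroup A'] [Module k A']

/-- The restriction of an isomorphism of superalgebras to the components of parity `i`. -/
def Iso.grEquiv {B : Superalgebra k A} {B' : Superalgebra k A'} (e : B.Iso B') (i : ZMod 2) :
    B.gr i ≃ₗ[k] B'.gr i where
  toFun x := ⟨e.toEquiv x, e.map_mem i x x.2⟩
  map_add' x y := Subtype.ext (map_add e.toEquiv x.1 y.1)
  map_smul' c x := Subtype.ext (map_smul e.toEquiv c x.1)
  invFun x := ⟨e.symm.toEquiv x, e.symm.map_mem i x x.2⟩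
  left_inv x := Subtype.ext (e.toEquiv.symm_apply_apply x)
  right_inv x := Subtype.ext (e.toEquiv.apply_symm_apply x)

theorem Iso.grEquiv_evenMul {B : Superalgebra k A} {B' : Superalgebra k A'} (e : B.Iso B')
    (x y : B.gr 0) : e.grEquiv 0 (B.evenMul x y) = B'.evenMul (e.grEquiv 0 x) (e.grEquiv 0 y) :=
  Subtype.ext (e.map_mul x y)

theorem Iso.grEquiv_evenAct {B : Superalgebra k A} {B' : Superalgebra k A'} (e : B.Iso B')
    (x : B.gr 0) (y : B.gr 1) :
    e.grEquiv 1 (B.evenAct x y) = B'.evenAct (e.grEquiv 0 x) (e.grEquiv 1 y) :=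
  Subtype.ext (e.map_mul x y)

theorem Iso.exists_equiv_sp6_ker {B : Superalgebra k A} {B' : Superalgebra k A'} (e : B.Iso B')
    (h : ∃ (φ : B'.gr 0 ≃ₗ[k] sp6 k) (ψ : B'.gr 1 ≃ₗ[k] LinearMap.ker (contraction k)),
      (∀ x y, φ (B'.evenMul x y) = ⁅φ x, φ y⁆) ∧
      ∀ x y, (ψ (B'.evenAct x y) : ⋀[k]^3 (W6 k)) = spWedge (φ x) (ψ y)) :
    ∃ (φ : B.gr 0 ≃ₗ[k] sp6 k) (ψ : B.gr 1 ≃ₗ[k] LinearMap.ker (contraction k)),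
      (∀ x y, φ (B.evenMul x y) = ⁅φ x, φ y⁆) ∧
      ∀ x y, (ψ (B.evenAct x y) : ⋀[k]^3 (W6 k)) = spWedge (φ x) (ψ y) := by
  obtain ⟨φ, ψ, h0, h1⟩ := h
  refine ⟨(e.grEquiv 0).trans φ, (e.grEquiv 1).trans ψ, fun x y => ?_, fun x y => ?_⟩
  · rw [LinearEquiv.trans_apply, e.grEquiv_evenMul, h0]
    rfl
  · rw [LinearEquiv.trans_apply, e.grEquiv_evenAct, h1]
    rfl

end Superalgebra

theorem mainTheorem2 {k : Type*} [Field k] [CharP k 3] :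
    (gS1S42 k).IsLie ∧
    (Nonempty (Realization (cartanMatrixS1S42 k) (Fin 3 → k)) ∧
      ∀ (𝔥 : Type*) [AddCommGroup 𝔥] [Module k 𝔥] (R : Realization (cartanMatrixS1S42 k) 𝔥),
        Nonempty ((gS1S42 k).Iso (contragredient R {1, 2}))) ∧
    (gS1S42 k).IsSimple ∧
    (Module.finrank k (LinearMap.ker (contraction k)) = 14 ∧
      IsIrreducibleSubmodule k (LinearMap.ker (contraction k)) ∧
      exteriorPower.ιMulti k 3 (fun i : Fin 3 => (Pi.single (Sum.inl i) 1 : W6 k)) ∈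
        LinearMap.ker (contraction k) ∧
      IsHighestWeightVectorOmega3 k
        (exteriorPower.ιMulti k 3 fun i : Fin 3 => (Pi.single (Sum.inl i) 1 : W6 k))) ∧
    ∃ (φ : (gS1S42 k).gr 0 ≃ₗ[k] sp6 k) (ψ : (gS1S42 k).gr 1 ≃ₗ[k] LinearMap.ker (contraction k)),
      (∀ x y, φ ((gS1S42 k).evenMul x y) = ⁅φ x, φ y⁆) ∧
      ∀ x y, (ψ ((gS1S42 k).evenAct x y) : ⋀[k]^3 (W6 k)) = spWedge (φ x) (ψ y) := by
  obtain ⟨e⟩ := SpWedgeModel.nonempty_iso_gS1S42 k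
  refine ⟨SpWedgeModel.isLie_algebra.of_iso e.symm,
    ⟨SpWedgeModel.nonempty_realization, fun 𝔥 _ _ R => ?_⟩,
    SpWedgeModel.isSimple_algebra.of_iso e.symm,
    ⟨SpWedgeModel.finrank_ker_contraction k, SpWedgeModel.isIrreducibleSubmodule_ker_contraction,
      SpWedgeModel.highestWeightVector_mem, SpWedgeModel.isHighestWeightVectorOmega3⟩, ?_⟩
  · obtain ⟨e'⟩ := SpWedgeModel.nonempty_iso_contragredient R
    exact ⟨e.symm.trans e'⟩
  · exact e.symm.exists_equiv_sp6_ker SpWedgeModel.exists_equiv_sp6_ker
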